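/- Let $N\ge 2$ and let $W(x)=k(|x|)$ be a radial potential in $C^3(\mathbb R^N\setminus\{0\})$. A radial function with profile $g$ on $(0,\infty)$ is called *locally integrable on hypersurfaces* if $g(r)\,r^{N-2}$ is integrable on $(0,1)$. Assume that $k'$ is locally integrable on hypersurfaces. For $r,\eta>0$ let $$\omega(r,\eta)=-\frac1{\sigma_N}\int_{\partial B(0,1)}\nabla W(re_1-\eta y)\cdot e_1\,d\sigma(y),$$ where $\sigma_N$ is the area of the unit sphere and $e_1$ the first canonical basis vector. Let $R>0$ and let $\delta_R$ be the uniform probability measure on $\{|x|=R\}$. Assume that $\delta_R$ is a steady state, i.e. $\omega(R,R)=0$, and that one of the following holds: (i) $k''(r)$ and $r^{-1}k'(r)$ are locally integrable on hypersurfaces, and $\partial_1\omega(R,R)>0$; (ii) $\Delta W<0$ in a punctured neighborhood of the origin, and $\Delta W$ is not locally integrable on hypersurfaces. A *radially symmetric solution* is a weakly-$*$ continuous curve $(\mu_t)_{t\ge0}$ of radially symmetric probability measures on $\mathbb R^N$ whose radial distributions $\hat\mu_t$ (the law of $|x|$ under $\mu_t$) satisfy $$\partial_t\hat\mu+\partial_r(\hat\mu\,\hat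 v)=0,\qquad \hat v(t,r)=\int\omega(r,\eta)\,d\hat\mu_t(\eta),$$ in the sense of distributions on $(0,\infty)\times(0,\infty)$, with all these integrals convergent. For $1<p<\infty$ it is an *$L^p$ radially symmetric solution* if every $\mu_t$ has a density in $L^p(\mathbb R^N)$ and, in addition, either $\nabla W\in \mathcal W^{1,q}(\mathbb R^N)$ with $\frac1p+\frac1q=1$, or all $\mu_t$, $t\ge0$, are supported in one fixed ball. Then no $L^p$ radially symmetric solution converges weakly-$*$ as measures to $\delta_R$ as $t\to\infty$. -/

import Mathlib

open Set Filter Topology MeasureTheory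
open scoped ContDiff ENNReal Gradient Laplacian

noncomputable section

namespace SphericalShell

/-- The Euclidean space `ℝ^N`. -/
abbrev Space (N : ℕ) : Type := EuclideanSpace ℝ (Fin N)

/-- The first vector of the canonical basis. -/
def e₁ (N : ℕ) [NeZero N] : Space N := EuclideanSpace.single (0 : Fin N) (1 : ℝ)

/-- The surface measure `dσ` on the unit sphere of `ℝ^N`. -/
def surf (N : ℕ) : Measure (Metric.sphere (0 : Space N) 1) :=
  (volume : Measure (Space N)).toSphere

/-- `σ_N`, the total area of the unit sphere of `ℝ^N`. -/
def area (N : ℕ) : ℝ := (surf N).real univ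

/-- The spherical shell `δ_R`: the uniform probability measure on the sphere of radius `R`. -/
def shell (N : ℕ) (R : ℝ) : Measure (Space N) :=
  ((surf N univ)⁻¹ • surf N).map (fun y : Metric.sphere (0 : Space N) 1 => R • (y : Space N))

/-- `ω(r,η) = -(1/σ_N) ∫_{∂B(0,1)} ∇W(r e₁ - η y) · e₁ dσ(y)`. -/
def omega {N : ℕ} [NeZero N] (W : Space N → ℝ) (r η : ℝ) : ℝ :=
  -(1 / area N) *
    ∫ y : Metric.sphere (0 : Space N) 1,
      inner ℝ (∇ W (r • e₁ N - η • (y : Space N))) (e₁ N) ∂(surf N)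

/-- A radial function on `ℝ^N` with profile `g` on `(0,∞)` is locally integrable on hypersurfaces:
`g(r) r^{N-2}` is integrable on `(0,1)` (used for `N ≥ 2` only). -/
def LocIntHypersurface (N : ℕ) (g : ℝ → ℝ) : Prop :=
  IntegrableOn (fun r => g r * r ^ (N - 2)) (Ioo 0 1)

/-- `∇W ∈ W^{1,q}(ℝ^N)`: the gradient is in `L^q` and each of its components has weak first
partial derivatives in `L^q`. -/
def GradMemSobolev {N : ℕ} (W : Space N → ℝ) (q : ℝ) : Prop :=
  MemLp (∇ W) (ENNReal.ofReal q) volume ∧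
  ∃ G : Fin N → Fin N → Space N → ℝ,
    (∀ i j, MemLp (G i j) (ENNReal.ofReal q) volume) ∧
    ∀ i j, ∀ φ : Space N → ℝ, ContDiff ℝ ∞ φ → HasCompactSupport φ →
      ∫ x, (∇ W x) i * fderiv ℝ φ x (EuclideanSpace.single j 1) = -∫ x, G i j x * φ x

/-- The radial distribution `μ̂` of a measure on `ℝ^N` (the law of `|x|`). -/
def radialPart {N : ℕ} (μ : Measure (Space N)) : Measure ℝ := μ.map (fun x => ‖x‖)

/-- Invariance under all linear isometries of `ℝ^N`. -/
def IsRadial {N : ℕ} (μ : Measure (Space N)) : Prop :=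
  ∀ U : Space N ≃ₗᵢ[ℝ] Space N, μ.map U = μ

/-- The radial velocity `v̂(r) = ∫ ω(r,η) dμ̂(η)`. -/
def radialVelocity {N : ℕ} [NeZero N] (W : Space N → ℝ) (μ : Measure (Space N)) (r : ℝ) : ℝ :=
  ∫ η, omega W r η ∂(radialPart μ)

/-- Global radially symmetric solutions: weakly-* continuous curves `t ↦ μ_t`, `t ≥ 0`, of radially
symmetric probability measures such that `∂_t μ̂ + ∂_r (μ̂ v̂) = 0` holds in the sense of
distributions on `(0,∞) × (0,∞)`, all integrals involved being convergent. -/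
structure IsRadialSolution {N : ℕ} [NeZero N] (W : Space N → ℝ) (μ : ℝ → Measure (Space N)) :
    Prop where
  prob : ∀ t, 0 ≤ t → IsProbabilityMeasure (μ t)
  radial : ∀ t, 0 ≤ t → IsRadial (μ t)
  continuous : ∀ f : BoundedContinuousFunction (Space N) ℝ,
    ContinuousOn (fun t => ∫ x, f x ∂(μ t)) (Ici 0)
  integrable_velocity : ∀ t, 0 < t → ∀ r, 0 < r →
    Integrable (fun η => omega W r η) (radialPart (μ t))
  conservation : ∀ φ : ℝ × ℝ → ℝ, ContDiff ℝ ∞ φ → HasCompactSupport φ →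
    tsupport φ ⊆ Ioi 0 ×ˢ Ioi 0 →
    (∀ t, 0 < t → Integrable
      (fun r => fderiv ℝ φ (t, r) (1, 0) + radialVelocity W (μ t) r * fderiv ℝ φ (t, r) (0, 1))
      (radialPart (μ t))) ∧
    IntegrableOn (fun t => ∫ r,
      (fderiv ℝ φ (t, r) (1, 0) + radialVelocity W (μ t) r * fderiv ℝ φ (t, r) (0, 1))
      ∂(radialPart (μ t))) (Ioi 0) ∧
    ∫ t in Ioi (0 : ℝ), ∫ r,
      (fderiv ℝ φ (t, r) (1, 0) + radialVelocity W (μ t) r * fderiv ℝ φ (t, r) (0, 1))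
      ∂(radialPart (μ t)) = 0

/-- `L^p` radially symmetric solutions (`1 < p < ∞`): every `μ_t` has a density in `L^p(ℝ^N)`, and
we are in one of the two settings in which `L^p` solutions are considered: either
`∇W ∈ W^{1,q}(ℝ^N)` with `q` the Hölder conjugate of `p`, or the potential is arbitrary at infinity
and the solution stays in a fixed ball.  Continuity in time with values in `L^p` and bounds on the
second moments are not required, so the class contains all solutions that have these properties. -/
structure IsLpRadialSolution {N : ℕ} [NeZero N] (W : Space N → ℝ) (p : ℝ)
    (μ : ℝ → Measure (Space N)) : Prop where
  solution : IsRadialSolution W μ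
  one_lt : 1 < p
  density : ∀ t, 0 ≤ t → ∃ f : Space N → ℝ, MemLp f (ENNReal.ofReal p) volume ∧
    μ t = volume.withDensity (fun x => ENNReal.ofReal (f x))
  setting : (∃ q : ℝ, p.HolderConjugate q ∧ GradMemSobolev W q) ∨
    ∃ ρ : ℝ, ∀ t, 0 ≤ t → μ t (Metric.closedBall 0 ρ)ᶜ = 0

/-- Weak-* convergence of measures as `t → ∞`. -/
def WeakStarTendsto {N : ℕ} (μ : ℝ → Measure (Space N)) (ν : Measure (Space N)) : Prop :=
  ∀ f : BoundedContinuousFunction (Space N) ℝ,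
    Tendsto (fun t => ∫ x, f x ∂(μ t)) atTop (𝓝 (∫ x, f x ∂ν))

end SphericalShell

end

/-! Multiplying the velocity kernel by r^(N-1) gives, up to a positive constant, the flux F(r,η)
through the sphere of radius r of the force created by the uniform mass on the sphere of radius η
(`exists_omega_eq_flux`). By the divergence theorem ∂_r F is r^(N-1) times the angular mean of -ΔW
(`hasDerivAt_flux`). Since ΔW may be singular at the origin, this is proved for truncated potentials
and passed to the limit.

Both alternatives lead to the same property, `FluxExpanding`: for r' ≤ r and η near R, F(r,η) -
F(r',η) ≥ c (r - r') - κ (|r - η| + |r' - η|), with c fixed and κ as small as desired. In case (ii)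
the truncated means of -ΔW are eventually at least one at (R,R) by Fatou's lemma, and further
truncation levels only increase the lower bound; no error term appears. In case (i) F is a C^1
truncated flux plus a remainder whose increments from the diagonal r = η are at most κ |r - η|. The
reason is geometric: a small circle about a point of the sphere of radius η crosses that sphere
transversally, so it meets a thin annulus around it in arcs of length proportional to the thickness
(`lintegral_annulus_le`). This works only for annuli containing the sphere of radius η, whence the
form of the error.

Suppose a solution converges to the shell. For large times the velocity points away from R on ε/4 ≤
|r - R| ≤ ε/2. The integral of a cutoff around R is then nonincreasing, yet tends to one; so all the
mass already lies within ε/2 of R. The bound on the far field needed here is where the two settings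
of L^p solutions enter.

Once the mass is confined, put z = r^N/N, so that dz/dr = r^(N-1) turns velocity into flux. The
derivative of the variance of z is a positive multiple of the covariance of z and V(r) = ∫ F(r,η)
dη, the integral being against the radial law. Written as a double integral of (z(r) - z(s)) (V(r) -
V(s)), it is bounded below by c (r - s)^2 with errors that Young's inequality absorbs into the
variance of r; hence it is nonnegative (`integral_mul_integral_le_of_mul_sub_ge`). The variance of z
is therefore nondecreasing, but it tends to zero, so it vanishes at a finite time. The measure is
then carried by a single sphere, which is impossible for a measure with a density. -/

namespace SphericalShell

/-! ### Polar coordinates and the law of one coordinate on the sphere -/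

/-- Integration in polar coordinates for nonnegative functions. -/
theorem lintegral_eq_lintegral_toSphere {E : Type*} [NormedAddCommGroup E] [NormedSpace ℝ E]
    [MeasurableSpace E] [BorelSpace E] [FiniteDimensional ℝ E] [Nontrivial E]
    (μ : Measure E) [μ.IsAddHaarMeasure] {f : E → ℝ≥0∞} (hf : Measurable f) :
    ∫⁻ x, f x ∂μ = ∫⁻ y, ∫⁻ r in Ioi (0 : ℝ),
      ENNReal.ofReal (r ^ (Module.finrank ℝ E - 1)) * f (r • (y : E)) ∂volume ∂μ.toSphere := by
  have h1 : ∫⁻ x, f x ∂μ = ∫⁻ x : ({(0 : E)}ᶜ : Set E), f x ∂(μ.comap (↑)) := by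
    rw [lintegral_subtype_comap (measurableSet_singleton _).compl, restrict_compl_singleton]
  have h2 := μ.measurePreserving_homeomorphUnitSphereProd.lintegral_comp_emb
    (Homeomorph.measurableEmbedding _)
    (fun p : Metric.sphere (0 : E) 1 × Ioi (0 : ℝ) => f ((p.2 : ℝ) • (p.1 : E)))
  have h3 : ∀ x : ({(0 : E)}ᶜ : Set E),
      (((homeomorphUnitSphereProd E x).2 : ℝ) • ((homeomorphUnitSphereProd E x).1 : E)) = x := by
    intro x
    have : ‖(x : E)‖ ≠ 0 := norm_ne_zero_iff.2 x.2
    simp [smul_smul, this]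
  simp only [h3] at h2
  rw [h1, h2, lintegral_prod]
  · refine lintegral_congr fun y => ?_
    rw [Measure.volumeIoiPow, lintegral_withDensity_eq_lintegral_mul₀]
    · exact lintegral_subtype_comap measurableSet_Ioi
        (fun r : ℝ => ENNReal.ofReal (r ^ (Module.finrank ℝ E - 1)) * f (r • (y : E)))
    · fun_prop
    · fun_prop
  · fun_prop

theorem lintegral_fun_norm {E : Type*} [NormedAddCommGroup E] [NormedSpace ℝ E]
    [MeasurableSpace E] [BorelSpace E] [FiniteDimensional ℝ E] [Nontrivial E]
    (μ : Measure E) [μ.IsAddHaarMeasure] {f : ℝ → ℝ≥0∞} (hf : Measurable f) :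
    ∫⁻ x, f ‖x‖ ∂μ = μ.toSphere univ * ∫⁻ r in Ioi (0 : ℝ),
      ENNReal.ofReal (r ^ (Module.finrank ℝ E - 1)) * f r := by
  rw [lintegral_eq_lintegral_toSphere μ (f := fun x => f ‖x‖) (hf.comp measurable_norm)]
  have : ∀ y : Metric.sphere (0 : E) 1, (∫⁻ r in Ioi (0 : ℝ),
      ENNReal.ofReal (r ^ (Module.finrank ℝ E - 1)) * f ‖r • (y : E)‖) =
      ∫⁻ r in Ioi (0 : ℝ), ENNReal.ofReal (r ^ (Module.finrank ℝ E - 1)) * f r := by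
    intro y
    refine setLIntegral_congr_fun measurableSet_Ioi fun r hr => ?_
    simp [norm_smul, abs_of_pos (mem_Ioi.1 hr)]
  simp only [this, lintegral_const]
  rw [mul_comm]

/-- Splitting off the first coordinate of `ℝ^{n+1}`, for functions of `x₀` and `|x|`. -/
theorem lintegral_fun_zero_norm (n : ℕ) {f : ℝ → ℝ → ℝ≥0∞} (hf : Measurable (Function.uncurry f)) :
    ∫⁻ x : Space (n + 1), f (x 0) ‖x‖ =
      ∫⁻ a : ℝ, ∫⁻ z : Space n, f a (√(a ^ 2 + ‖z‖ ^ 2)) := by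
  have hp := (PiLp.volume_preserving_toLp (Fin (n + 1))).comp
    ((volume_preserving_piFinSuccAbove (fun _ : Fin (n + 1) => ℝ) 0).symm.comp
    ((MeasurePreserving.id (volume : Measure ℝ)).prod (PiLp.volume_preserving_ofLp (Fin n))))
  have hm : Measurable fun x : Space (n + 1) => f (x 0) ‖x‖ :=
    hf.comp (by fun_prop : Measurable fun x : Space (n + 1) => (x 0, ‖x‖))
  rw [← hp.lintegral_comp hm, lintegral_prod]
  · refine lintegral_congr fun a => lintegral_congr fun z => ?_
    simp [EuclideanSpace.norm_eq, Fin.sum_univ_succ, Real.sq_sqrt, Finset.sum_nonneg, sq_nonneg]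
  · exact (hm.comp hp.measurable).aemeasurable

/-- The law of the first coordinate on the unit sphere of `ℝ^{n+2}`: up to a constant, it is the
law of `cos θ` under `sin^n θ dθ` on `(0,π)`. -/
theorem exists_lintegral_surf_eq (n : ℕ) : ∃ C : ℝ≥0∞, C ≠ 0 ∧ C ≠ ⊤ ∧
    ∀ F : ℝ → ℝ≥0∞, Measurable F →
      ∫⁻ y, F ((y : Space (n + 2)) 0) ∂surf (n + 2) =
        C * ∫⁻ θ in Ioo 0 Real.pi, ENNReal.ofReal (Real.sin θ ^ n) * F (Real.cos θ) := by
  refine ⟨(volume : Measure (Space (n + 1))).toSphere univ, ?_, measure_ne_top _ _, ?_⟩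
  · exact Measure.measure_univ_ne_zero.2 (Measure.toSphere_ne_zero _)
  intro F hF
  set S := (volume : Measure (Space (n + 1))).toSphere univ with hS
  -- The integral of F(x₀/|x|) over the unit ball is computed twice: in spherical coordinates, and
  -- by splitting off x₀ and using planar polar coordinates for the pair (x₀, |z|). Both results
  -- contain the radial factor `J`, which is positive and finite and cancels.
  let h : ℝ → ℝ≥0∞ := (Iio (1 : ℝ)).indicator 1
  have hh : Measurable h := measurable_one.indicator measurableSet_Iio
  let J : ℝ≥0∞ := ∫⁻ r in Ioi (0 : ℝ), ENNReal.ofReal (r ^ (n + 1)) * h r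
  have hJ : J = ∫⁻ r in Ioo (0 : ℝ) 1, ENNReal.ofReal (r ^ (n + 1)) := by
    have : (fun r : ℝ => ENNReal.ofReal (r ^ (n + 1)) * h r) =
        (Iio (1 : ℝ)).indicator fun r => ENNReal.ofReal (r ^ (n + 1)) := by
      funext r; by_cases hr : r < 1 <;> simp [h, hr]
    simp only [J]
    rw [this, setLIntegral_indicator measurableSet_Iio, inter_comm, Ioi_inter_Iio]
  have hJ0 : J ≠ 0 := by
    rw [hJ, ← pos_iff_ne_zero, setLIntegral_pos_iff (by fun_prop)]
    refine lt_of_lt_of_le ?_ (measure_mono (s := Ioo (0 : ℝ) 1) ?_)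
    · simp
    · intro r hr
      exact ⟨by simpa using pow_pos hr.1 _, hr⟩
  have hJt : J ≠ ⊤ := by
    rw [hJ]
    refine ne_top_of_le_ne_top (b := ∫⁻ r in Ioo (0 : ℝ) 1, 1) (by simp)
      (setLIntegral_mono measurable_const fun r hr => ?_)
    simpa using pow_le_one₀ hr.1.le hr.2.le
  have key : (∫⁻ y, F ((y : Space (n + 2)) 0) ∂surf (n + 2)) * J =
      (S * ∫⁻ θ in Ioo 0 Real.pi, ENNReal.ofReal (Real.sin θ ^ n) * F (Real.cos θ)) * J := by
    have hf : Measurable (Function.uncurry fun a ρ : ℝ => F (a / ρ) * h ρ) :=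
      (hF.comp (measurable_fst.div measurable_snd)).mul (hh.comp measurable_snd)
    have e1 : (∫⁻ y, F ((y : Space (n + 2)) 0) ∂surf (n + 2)) * J =
        ∫⁻ x : Space (n + 2), F (x 0 / ‖x‖) * h ‖x‖ := by
      have hm : Measurable fun x : Space (n + 2) => F (x 0 / ‖x‖) * h ‖x‖ :=
        hf.comp (by fun_prop : Measurable fun x : Space (n + 2) => (x 0, ‖x‖))
      rw [lintegral_eq_lintegral_toSphere volume hm, ← lintegral_mul_const'' _ (by fun_prop)]
      refine lintegral_congr fun y => ?_
      have hy : ‖(y : Space (n + 2))‖ = 1 := by simp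
      rw [← lintegral_const_mul _ (by fun_prop)]
      refine setLIntegral_congr_fun measurableSet_Ioi fun r hr => ?_
      have hr : 0 < r := hr
      simp only [norm_smul, hy, Real.norm_eq_abs, abs_of_pos hr, mul_one, PiLp.smul_apply,
        smul_eq_mul, mul_div_cancel_left₀ _ hr.ne', finrank_euclideanSpace, Fintype.card_fin]
      rw [show n + 2 - 1 = n + 1 by omega]
      ring
    have e2 : ∀ a : ℝ, ∫⁻ z : Space (n + 1), F (a / √(a ^ 2 + ‖z‖ ^ 2)) * h √(a ^ 2 + ‖z‖ ^ 2) =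
        S * ∫⁻ ρ, (Ioi (0 : ℝ)).indicator (fun ρ => ENNReal.ofReal (ρ ^ n) *
          (F (a / √(a ^ 2 + ρ ^ 2)) * h √(a ^ 2 + ρ ^ 2))) ρ := by
      intro a
      rw [lintegral_fun_norm volume
        (f := fun ρ => F (a / √(a ^ 2 + ρ ^ 2)) * h √(a ^ 2 + ρ ^ 2)) (by fun_prop),
        lintegral_indicator measurableSet_Ioi]
      simp [hS]
    let g : ℝ × ℝ → ℝ≥0∞ := fun p => (Ioi (0 : ℝ)).indicator (fun ρ => ENNReal.ofReal (ρ ^ n) *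
          (F (p.1 / √(p.1 ^ 2 + ρ ^ 2)) * h √(p.1 ^ 2 + ρ ^ 2))) p.2
    have hg : Measurable g := by
      have : g = {p : ℝ × ℝ | 0 < p.2}.indicator (fun p => ENNReal.ofReal (p.2 ^ n) *
          (F (p.1 / √(p.1 ^ 2 + p.2 ^ 2)) * h √(p.1 ^ 2 + p.2 ^ 2))) := by
        funext p; by_cases hp : 0 < p.2 <;> simp [g, hp]
      rw [this]
      exact Measurable.indicator (by fun_prop) (measurableSet_lt measurable_const measurable_snd)
    rw [e1, lintegral_fun_zero_norm (n + 1) hf]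
    simp only [e2]
    rw [lintegral_const_mul'' _ (hg.lintegral_prod_right' (ν := volume)).aemeasurable, mul_assoc]
    congr 1
    rw [← lintegral_prod g hg.aemeasurable]
    change ∫⁻ p, g p = _
    rw [← lintegral_comp_polarCoord_symm g]
    have e3 : ∀ p ∈ polarCoord.target, ENNReal.ofReal p.1 • g (polarCoord.symm p) =
        (univ ×ˢ Ioo 0 Real.pi : Set (ℝ × ℝ)).indicator (fun p => (ENNReal.ofReal (p.1 ^ (n + 1)) * h p.1) *
          (ENNReal.ofReal (Real.sin p.2 ^ n) * F (Real.cos p.2))) p := by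
      rintro ⟨r, θ⟩ ⟨hr, hθ⟩
      have hr : 0 < r := hr
      have hθ : θ ∈ Ioo (-Real.pi) Real.pi := hθ
      have hs : √((r * Real.cos θ) ^ 2 + (r * Real.sin θ) ^ 2) = r := by
        rw [mul_pow, mul_pow, ← mul_add, Real.cos_sq_add_sin_sq, mul_one, Real.sqrt_sq hr.le]
      by_cases h0 : 0 < θ
      · have hsin : 0 < Real.sin θ := Real.sin_pos_of_pos_of_lt_pi h0 hθ.2
        have hrs : 0 < r * Real.sin θ := by positivity
        simp only [g, polarCoord_symm_apply, mem_Ioi, hrs, indicator_of_mem, hs, mem_prod, mem_univ,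
          mem_Ioo, h0, hθ.2, and_self, smul_eq_mul, mul_div_cancel_left₀ _ hr.ne']
        rw [mul_pow, ENNReal.ofReal_mul (by positivity), pow_succ' r n,
          ENNReal.ofReal_mul hr.le]
        ring
      · have hsin : Real.sin θ ≤ 0 := Real.sin_nonpos_of_nonpos_of_neg_pi_le (not_lt.1 h0) hθ.1.le
        have hrs : ¬ 0 < r * Real.sin θ := not_lt.2 (mul_nonpos_of_nonneg_of_nonpos hr.le hsin)
        simp [g, h0, hrs]
    have ht : MeasurableSet polarCoord.target := measurableSet_Ioi.prod measurableSet_Ioo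
    rw [setLIntegral_congr_fun ht e3,
      setLIntegral_indicator (MeasurableSet.univ.prod measurableSet_Ioo)]
    have e4 : (univ ×ˢ Ioo 0 Real.pi : Set (ℝ × ℝ)) ∩ polarCoord.target =
        Ioi 0 ×ˢ Ioo 0 Real.pi := by
      ext ⟨r, θ⟩
      simp only [polarCoord_target, mem_inter_iff, mem_prod, mem_univ, true_and, mem_Ioo, mem_Ioi]
      constructor
      · rintro ⟨h1, h2, -⟩; exact ⟨h2, h1⟩
      · rintro ⟨h1, h2⟩; exact ⟨h2, h1, by linarith [Real.pi_pos], h2.2⟩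
    rw [e4, Measure.volume_eq_prod, ← Measure.prod_restrict,
      lintegral_prod_mul (f := fun r => ENNReal.ofReal (r ^ (n + 1)) * h r)
        (g := fun θ => ENNReal.ofReal (Real.sin θ ^ n) * F (Real.cos θ))
        (by fun_prop) (by fun_prop), mul_comm]
  exact (ENNReal.mul_left_inj hJ0 hJt).1 key

/-- The law of the coordinate is identified as a measure, so no integrability of `F` is required: in
the divergent case both sides take the default value zero. -/
theorem exists_integral_surf_eq (n : ℕ) : ∃ C : ℝ, 0 < C ∧
    ∀ F : ℝ → ℝ, Measurable F →
      ∫ y, F ((y : Space (n + 2)) 0) ∂surf (n + 2) =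
        C * ∫ θ in (0)..Real.pi, F (Real.cos θ) * Real.sin θ ^ n := by
  obtain ⟨C, hC0, hCt, hC⟩ := exists_lintegral_surf_eq n
  refine ⟨C.toReal, ENNReal.toReal_pos hC0 hCt, fun F hF => ?_⟩
  have hm : (surf (n + 2)).map (fun y : Metric.sphere (0 : Space (n + 2)) 1 => (y : Space (n + 2)) 0) =
      C • (((volume.restrict (Ioo 0 Real.pi)).withDensity
        fun θ => ((Real.sin θ ^ n).toNNReal : ℝ≥0∞)).map Real.cos) := by
    ext s hs
    have h1 := hC (s.indicator 1) (measurable_one.indicator hs)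
    rw [Measure.map_apply (by fun_prop) hs, Measure.smul_apply, Measure.map_apply (by fun_prop) hs,
      ← lintegral_indicator_one (by measurability), ← lintegral_indicator_one (by measurability),
      lintegral_withDensity_eq_lintegral_mul₀ (by fun_prop)
        (measurable_one.indicator (by measurability)).aemeasurable]
    exact h1
  have h2 : ∫ y, F ((y : Space (n + 2)) 0) ∂surf (n + 2) =
      ∫ u, F u ∂((surf (n + 2)).map (fun y : Metric.sphere (0 : Space (n + 2)) 1 => (y : Space (n + 2)) 0)) :=
    (integral_map (by fun_prop) hF.aestronglyMeasurable).symm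
  rw [h2, hm, integral_smul_measure, integral_map (by fun_prop) hF.aestronglyMeasurable,
    integral_withDensity_eq_integral_smul (by fun_prop), smul_eq_mul,
    intervalIntegral.integral_of_le Real.pi_pos.le, integral_Ioc_eq_integral_Ioo]
  congr 1
  refine setIntegral_congr_fun measurableSet_Ioo fun θ hθ => ?_
  have : 0 ≤ Real.sin θ ^ n := pow_nonneg (Real.sin_pos_of_mem_Ioo hθ).le _
  simp only [NNReal.smul_def, Real.coe_toNNReal _ this, smul_eq_mul]
  ring

end SphericalShell

/-! ### The flux and its radial derivative -/

namespace SphericalShell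

/-- The squared distance between two points at distances `r` and `η` from the origin, seen from the
origin under the angle `θ`. -/
noncomputable def sqDist (r η θ : ℝ) : ℝ := r ^ 2 + η ^ 2 - 2 * r * η * Real.cos θ

/-- The flux through the sphere of radius `r` of the force created by the uniform measure on the
sphere of radius `η`, up to a constant factor. The force is `-Q(|x|²) x`. -/
noncomputable def flux (N : ℕ) (Q : ℝ → ℝ) (r η : ℝ) : ℝ :=
  -∫ θ in (0)..Real.pi,
    r ^ (N - 1) * Q (sqDist r η θ) * (r - η * Real.cos θ) * Real.sin θ ^ (N - 2)

/-- The angular mean of a function of the squared distance. -/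
noncomputable def angMean (N : ℕ) (G : ℝ → ℝ) (r η : ℝ) : ℝ :=
  ∫ θ in (0)..Real.pi, G (sqDist r η θ) * Real.sin θ ^ (N - 2)

/-- The divergence of `Q(|x|²) x` as a function of `b = |x|²`. -/
noncomputable def divProfile (N : ℕ) (Q : ℝ → ℝ) (b : ℝ) : ℝ := 2 * b * deriv Q b + N * Q b

theorem sqDist_eq (r η θ : ℝ) :
    sqDist r η θ = (r - η * Real.cos θ) ^ 2 + (η * Real.sin θ) ^ 2 := by
  have := Real.sin_sq_add_cos_sq θ
  simp only [sqDist]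
  linear_combination (-η ^ 2) * this

theorem sq_sub_le_sqDist {r η : ℝ} (hr : 0 ≤ r) (hη : 0 ≤ η) (θ : ℝ) :
    (r - η) ^ 2 ≤ sqDist r η θ := by
  have := mul_le_mul_of_nonneg_left (Real.cos_le_one θ) (mul_nonneg hr hη)
  simp only [sqDist]
  nlinarith

theorem sqDist_le_sq_add {r η : ℝ} (hr : 0 ≤ r) (hη : 0 ≤ η) (θ : ℝ) :
    sqDist r η θ ≤ (r + η) ^ 2 := by
  have := mul_le_mul_of_nonneg_left (Real.neg_one_le_cos θ) (mul_nonneg hr hη)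
  simp only [sqDist]
  nlinarith

theorem abs_sub_mul_cos_le (r η θ : ℝ) : |r - η * Real.cos θ| ≤ √(sqDist r η θ) := by
  apply Real.abs_le_sqrt
  rw [sqDist_eq]
  nlinarith [sq_nonneg (η * Real.sin θ)]

theorem sqDist_pos {r η θ : ℝ} (hη : 0 < η) (hθ : θ ∈ Ioo 0 Real.pi) : 0 < sqDist r η θ := by
  have := Real.sin_pos_of_mem_Ioo hθ
  rw [sqDist_eq]
  positivity

theorem continuous_sqDist_angle (r η : ℝ) : Continuous (sqDist r η) := by
  unfold sqDist; fun_prop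

theorem hasDerivAt_sqDist_radius (r η θ : ℝ) :
    HasDerivAt (fun r => sqDist r η θ) (2 * (r - η * Real.cos θ)) r := by
  have := (((hasDerivAt_id r).pow 2).add_const (η ^ 2)).sub
    ((((hasDerivAt_id r).const_mul 2).mul_const η).mul_const (Real.cos θ))
  refine this.congr_deriv ?_
  simp
  ring

theorem hasDerivAt_sqDist_angle (r η θ : ℝ) :
    HasDerivAt (fun θ => sqDist r η θ) (2 * r * η * Real.sin θ) θ := by
  have := ((Real.hasDerivAt_cos θ).const_mul (2 * r * η)).const_sub (r ^ 2 + η ^ 2)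
  refine this.congr_deriv ?_
  ring

variable {N : ℕ} {Q : ℝ → ℝ}

theorem continuous_divProfile (hQ : ContDiff ℝ 1 Q) : Continuous (divProfile N Q) := by
  have := hQ.continuous
  have := hQ.continuous_deriv le_rfl
  unfold divProfile
  fun_prop

theorem continuous_angMean {G : ℝ → ℝ} (hG : Continuous G) :
    Continuous fun p : ℝ × ℝ => angMean N G p.1 p.2 := by
  unfold angMean
  apply intervalIntegral.continuous_parametric_intervalIntegral_of_continuous'
  unfold Function.uncurry sqDist
  fun_prop

theorem continuous_flux (hQ : Continuous Q) :
    Continuous fun p : ℝ × ℝ => flux N Q p.1 p.2 := by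
  unfold flux
  apply Continuous.neg
  apply intervalIntegral.continuous_parametric_intervalIntegral_of_continuous'
  unfold Function.uncurry sqDist
  fun_prop

/-- The flux through spheres grows at the rate given by the mean divergence. -/
theorem hasDerivAt_flux (hN : 2 ≤ N) (hQ : ContDiff ℝ 1 Q) (r η : ℝ) :
    HasDerivAt (fun r => flux N Q r η)
      (-(r ^ (N - 1) * angMean N (divProfile N Q) r η)) r := by
  obtain ⟨n, rfl⟩ : ∃ n, N = n + 2 := ⟨N - 2, by omega⟩
  have hQc := hQ.continuous
  have hQd := hQ.continuous_deriv le_rfl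
  have hQ' : ∀ b, HasDerivAt Q (deriv Q b) b := fun b =>
    (hQ.differentiable one_ne_zero b).hasDerivAt
  simp only [flux, angMean, show n + 2 - 1 = n + 1 by omega, show n + 2 - 2 = n by omega]
  let F : ℝ → ℝ → ℝ := fun r θ =>
    r ^ (n + 1) * Q (sqDist r η θ) * (r - η * Real.cos θ) * Real.sin θ ^ n
  let F' : ℝ → ℝ → ℝ := fun r θ =>
    (((n + 1 : ℝ) * r ^ n * Q (sqDist r η θ) +
        r ^ (n + 1) * (deriv Q (sqDist r η θ) * (2 * (r - η * Real.cos θ)))) *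
      (r - η * Real.cos θ) + r ^ (n + 1) * Q (sqDist r η θ)) * Real.sin θ ^ n
  have hF' : Continuous (Function.uncurry F') := by
    simp only [F', sqDist]; fun_prop
  have hder : ∀ r θ, HasDerivAt (fun r => F r θ) (F' r θ) r := by
    intro r θ
    have h1 := ((hasDerivAt_id r).pow (n + 1)).mul
      ((hQ' _).comp r (hasDerivAt_sqDist_radius r η θ))
    have h2 := (h1.mul ((hasDerivAt_id r).sub_const (η * Real.cos θ))).mul_const (Real.sin θ ^ n)
    refine h2.congr_deriv ?_
    simp [F']
  obtain ⟨B, hB⟩ := ((isCompact_closedBall r 1).prod (isCompact_Icc (a := 0) (b := Real.pi))).bddAbove_image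
    (f := fun p => ‖Function.uncurry F' p‖) hF'.norm.continuousOn
  have hmain := (intervalIntegral.hasDerivAt_integral_of_dominated_loc_of_deriv_le
    (μ := volume) (a := 0) (b := Real.pi) (F := F) (F' := F') (x₀ := r) (s := Metric.closedBall r 1)
    (bound := fun _ => B) (Metric.closedBall_mem_nhds r one_pos) ?_ ?_ ?_ ?_ ?_ ?_).2
  -- This integrand is the θ-derivative of η Q sin^(n+1), which vanishes at both poles. Adding r^n
  -- times it completes the radial derivative of the integrand to the full divergence: it is the
  -- tangential part, which integrates to zero over a sphere.
  · have hzero : ∫ θ in (0)..Real.pi, (η * (deriv Q (sqDist r η θ) * (2 * r * η * Real.sin θ)) *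
        Real.sin θ ^ (n + 1) + η * Q (sqDist r η θ) *
        (((n + 1 : ℕ) : ℝ) * Real.sin θ ^ n * Real.cos θ)) = 0 := by
      have : ∀ θ ∈ uIcc 0 Real.pi, HasDerivAt
          (fun θ => η * Q (sqDist r η θ) * Real.sin θ ^ (n + 1))
          (η * (deriv Q (sqDist r η θ) * (2 * r * η * Real.sin θ)) *
            Real.sin θ ^ (n + 1) + η * Q (sqDist r η θ) *
            (((n + 1 : ℕ) : ℝ) * Real.sin θ ^ n * Real.cos θ)) θ := by
        intro θ _
        have h1 := ((hQ' _).comp θ (hasDerivAt_sqDist_angle r η θ)).const_mul η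
        have h2 := (Real.hasDerivAt_sin θ).pow (n + 1)
        exact (h1.mul h2).congr_deriv (by simp)
      rw [intervalIntegral.integral_eq_sub_of_hasDerivAt this]
      · simp
      · apply Continuous.intervalIntegrable
        unfold sqDist; fun_prop
    refine hmain.neg.congr_deriv ?_
    rw [← intervalIntegral.integral_const_mul]
    congr 1
    have hz2 : ∫ θ in (0)..Real.pi, r ^ n * (η * (deriv Q (sqDist r η θ) * (2 * r * η * Real.sin θ)) *
        Real.sin θ ^ (n + 1) + η * Q (sqDist r η θ) *
        (((n + 1 : ℕ) : ℝ) * Real.sin θ ^ n * Real.cos θ)) = 0 := by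
      rw [intervalIntegral.integral_const_mul, hzero, mul_zero]
    have hadd := intervalIntegral.integral_add (μ := volume) (a := 0) (b := Real.pi)
      (f := F' r) (g := fun θ => r ^ n * (η * (deriv Q (sqDist r η θ) *
        (2 * r * η * Real.sin θ)) * Real.sin θ ^ (n + 1) + η * Q (sqDist r η θ) *
        (((n + 1 : ℕ) : ℝ) * Real.sin θ ^ n * Real.cos θ)))
      ((hF'.comp (by fun_prop : Continuous fun θ => (r, θ))).intervalIntegrable _ _)
      (Continuous.intervalIntegrable (by unfold sqDist; fun_prop) _ _)
    rw [hz2, add_zero] at hadd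
    rw [← hadd]
    refine intervalIntegral.integral_congr fun θ _ => ?_
    simp only [F', divProfile]
    have hc : Real.cos θ ^ 2 = 1 - Real.sin θ ^ 2 := Real.cos_sq' θ
    have hsd : sqDist r η θ = r ^ 2 + η ^ 2 - 2 * r * η * Real.cos θ := rfl
    generalize deriv Q (sqDist r η θ) = q'
    generalize Q (sqDist r η θ) = q
    rw [hsd]
    push_cast
    linear_combination (2 * r ^ (n + 1) * q' * η ^ 2 * Real.sin θ ^ n) * hc
  · refine Eventually.of_forall fun r => Continuous.aestronglyMeasurable ?_
    simp only [F, sqDist]; fun_prop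
  · apply Continuous.intervalIntegrable
    simp only [F, sqDist]; fun_prop
  · exact (hF'.comp (by fun_prop : Continuous fun θ => (r, θ))).aestronglyMeasurable
  · refine Eventually.of_forall fun θ hθ x hx => hB ⟨(x, θ), ⟨hx, ?_⟩, rfl⟩
    rw [uIoc_of_le Real.pi_pos.le] at hθ
    exact ⟨hθ.1.le, hθ.2⟩
  · exact intervalIntegrable_const
  · exact Eventually.of_forall fun θ _ x _ => hder x θ

theorem flux_sub_flux (hN : 2 ≤ N) (hQ : ContDiff ℝ 1 Q) (r r' η : ℝ) :
    flux N Q r η - flux N Q r' η =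
      -∫ ρ in r'..r, ρ ^ (N - 1) * angMean N (divProfile N Q) ρ η := by
  rw [← intervalIntegral.integral_neg, intervalIntegral.integral_eq_sub_of_hasDerivAt
    fun ρ _ => hasDerivAt_flux hN hQ ρ η]
  apply Continuous.intervalIntegrable
  have := (continuous_angMean (N := N) (continuous_divProfile (N := N) hQ)).comp
    (by fun_prop : Continuous fun ρ : ℝ => (ρ, η))
  simp only [Function.comp_def] at this
  fun_prop

end SphericalShell

/-! ### Truncation near the origin -/

namespace SphericalShell

/-- A truncation of `Q` near the origin, equal to `Q` where `2 ≤ n b`. -/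
noncomputable def trunc (Q : ℝ → ℝ) (n : ℕ) (b : ℝ) : ℝ := Real.smoothTransition (n * b - 1) * Q b

variable {N : ℕ} {Q : ℝ → ℝ} {n : ℕ}

theorem trunc_of_two_le {b : ℝ} (h : 2 ≤ n * b) : trunc Q n b = Q b := by
  rw [trunc, Real.smoothTransition.one_of_one_le (by linarith), one_mul]

theorem trunc_of_le_one {b : ℝ} (h : n * b ≤ 1) : trunc Q n b = 0 := by
  rw [trunc, Real.smoothTransition.zero_of_nonpos (by linarith), zero_mul]

theorem abs_trunc_le (b : ℝ) : |trunc Q n b| ≤ |Q b| := by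
  rw [trunc, abs_mul, abs_of_nonneg (Real.smoothTransition.nonneg _)]
  exact mul_le_of_le_one_left (abs_nonneg _) (Real.smoothTransition.le_one _)

theorem tendsto_natCast_mul_atTop {b : ℝ} (hb : 0 < b) :
    Tendsto (fun n : ℕ => (n : ℝ) * b) atTop atTop :=
  tendsto_natCast_atTop_atTop.atTop_mul_const hb

theorem contDiff_trunc {m : ℕ∞} (hQ : ContDiffOn ℝ m Q (Ioi 0)) (hn : 0 < n) :
    ContDiff ℝ m (trunc Q n) := by
  have hn' : (0 : ℝ) < n := Nat.cast_pos.2 hn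
  rw [contDiff_iff_contDiffAt]
  intro b
  rcases le_or_gt b 0 with hb | hb
  · have : trunc Q n =ᶠ[𝓝 b] fun _ => 0 := by
      filter_upwards [Iio_mem_nhds (show b < 1 / n by have : (0 : ℝ) < 1 / n := by positivity
                                                      linarith)] with x hx
      exact trunc_of_le_one (by rw [mul_comm]; exact ((lt_div_iff₀ hn').1 hx).le)
    exact contDiffAt_const.congr_of_eventuallyEq this
  · have h1 : ContDiff ℝ m fun b : ℝ => Real.smoothTransition (n * b - 1) :=
      Real.smoothTransition.contDiff.comp (by fun_prop)
    exact h1.contDiffAt.mul (hQ.contDiffAt (Ioi_mem_nhds hb))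

theorem continuous_trunc (hQ : ContinuousOn Q (Ioi 0)) (hn : 0 < n) : Continuous (trunc Q n) :=
  contDiff_zero.1 (contDiff_trunc (m := 0) (contDiffOn_zero.2 hQ) hn)

/-- The term produced by the cutoff has a nonnegative bounded coefficient in front of `Q`. Its sign
serves the case of negative Laplacian, its size the integrable case. -/
theorem divProfile_trunc (hQ : ContDiffOn ℝ 1 Q (Ioi 0)) {b : ℝ} (hb : 0 < b) :
    divProfile N (trunc Q n) b = Real.smoothTransition (n * b - 1) * divProfile N Q b +
      2 * (n * b * deriv Real.smoothTransition (n * b - 1)) * Q b := by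
  have h1 : HasDerivAt (fun b : ℝ => Real.smoothTransition (n * b - 1))
      (deriv Real.smoothTransition (n * b - 1) * n) b := by
    have h := (Real.smoothTransition.contDiff (n := 1)).differentiable one_ne_zero (n * b - 1)
    have h2 : HasDerivAt (fun b : ℝ => n * b - 1) (n : ℝ) b := by
      simpa using ((hasDerivAt_id b).const_mul (n : ℝ)).sub_const 1
    exact h.hasDerivAt.comp b h2
  have h2 : HasDerivAt Q (deriv Q b) b :=
    ((hQ.contDiffAt (Ioi_mem_nhds hb)).differentiableAt one_ne_zero).hasDerivAt
  have h3 : HasDerivAt (trunc Q n) _ b := h1.mul h2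
  rw [divProfile, h3.deriv, divProfile, trunc]
  ring

theorem divProfile_trunc_of_nonpos {b : ℝ} (hb : b ≤ 0) : divProfile N (trunc Q n) b = 0 := by
  have h0 : ∀ x : ℝ, n * x ≤ 1 → trunc Q n x = 0 := fun x => trunc_of_le_one
  have hd : deriv (trunc Q n) b = 0 := by
    have : trunc Q n =ᶠ[𝓝 b] fun _ => 0 := by
      have hc : Tendsto (fun x : ℝ => n * x) (𝓝 b) (𝓝 (n * b)) :=
        (continuous_const.mul continuous_id).tendsto b
      filter_upwards [hc (Iio_mem_nhds (show (n : ℝ) * b < 1 by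
        have := mul_nonpos_of_nonneg_of_nonpos (Nat.cast_nonneg (α := ℝ) n) hb
        linarith))] with x hx
      exact h0 x (le_of_lt hx)
    rw [this.deriv_eq]; simp
  rw [divProfile, hd, h0 b]
  · simp
  · have := mul_nonpos_of_nonneg_of_nonpos (Nat.cast_nonneg (α := ℝ) n) hb
    linarith

theorem deriv_smoothTransition_nonneg (x : ℝ) : 0 ≤ deriv Real.smoothTransition x :=
  Real.smoothTransition.monotone.deriv_nonneg

theorem deriv_smoothTransition_of_one_lt {x : ℝ} (hx : 1 < x) :
    deriv Real.smoothTransition x = 0 := by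
  have : Real.smoothTransition =ᶠ[𝓝 x] fun _ => 1 := by
    filter_upwards [Ioi_mem_nhds hx] with y hy
    exact Real.smoothTransition.one_of_one_le (le_of_lt hy)
  rw [this.deriv_eq]; simp

theorem deriv_smoothTransition_of_neg {x : ℝ} (hx : x < 0) :
    deriv Real.smoothTransition x = 0 := by
  have : Real.smoothTransition =ᶠ[𝓝 x] fun _ => 0 := by
    filter_upwards [Iio_mem_nhds hx] with y hy
    exact Real.smoothTransition.zero_of_nonpos (le_of_lt hy)
  rw [this.deriv_eq]; simp

theorem continuous_deriv_smoothTransition : Continuous (deriv Real.smoothTransition) :=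
  (Real.smoothTransition.contDiff (n := 1)).continuous_deriv le_rfl

theorem divProfile_trunc_of_two_lt (hQ : ContDiffOn ℝ 1 Q (Ioi 0)) {b : ℝ} (h : 2 < n * b) :
    divProfile N (trunc Q n) b = divProfile N Q b := by
  have hb : 0 < b := by
    by_contra hb
    have := mul_nonpos_of_nonneg_of_nonpos (Nat.cast_nonneg (α := ℝ) n) (not_lt.1 hb)
    linarith
  rw [divProfile_trunc hQ hb, deriv_smoothTransition_of_one_lt (by linarith),
    Real.smoothTransition.one_of_one_le (by linarith)]
  ring

/-- The truncation changes the divergence by at most a multiple of `|Q|`. -/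
theorem exists_abs_divProfile_trunc_le (N : ℕ) : ∃ C : ℝ, 0 ≤ C ∧
    ∀ Q : ℝ → ℝ, ContDiffOn ℝ 1 Q (Ioi 0) → ∀ n : ℕ, ∀ b, 0 < b →
      |divProfile N (trunc Q n) b| ≤ |divProfile N Q b| + C * |Q b| := by
  obtain ⟨B, hB⟩ := (isCompact_Icc (a := (0 : ℝ)) (b := 1)).bddAbove_image
    continuous_deriv_smoothTransition.continuousOn
  have hB0 : 0 ≤ B := (deriv_smoothTransition_nonneg 0).trans (hB ⟨0, by simp, rfl⟩)
  -- The derivative of the cutoff vanishes unless 1 ≤ n b ≤ 2, so the coefficient 2 n b S'(n b - 1)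
  -- is at most 2 · 2 · B.
  refine ⟨4 * B, by positivity, fun Q hQ n b hb => ?_⟩
  rw [divProfile_trunc hQ hb]
  refine (abs_add_le _ _).trans (add_le_add ?_ ?_)
  · rw [abs_mul, abs_of_nonneg (Real.smoothTransition.nonneg _)]
    exact mul_le_of_le_one_left (abs_nonneg _) (Real.smoothTransition.le_one _)
  · rw [abs_mul]
    refine mul_le_mul_of_nonneg_right ?_ (abs_nonneg _)
    have hnb : 0 ≤ n * b := by positivity
    rw [abs_of_nonneg (by have := deriv_smoothTransition_nonneg (n * b - 1); positivity)]
    by_cases h1 : n * b - 1 < 0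
    · rw [deriv_smoothTransition_of_neg h1]; simp; positivity
    by_cases h2 : 1 < n * b - 1
    · rw [deriv_smoothTransition_of_one_lt h2]; simp; positivity
    · have h3 := hB ⟨n * b - 1, ⟨not_lt.1 h1, not_lt.1 h2⟩, rfl⟩
      have h4 : n * b ≤ 2 := by linarith
      nlinarith [deriv_smoothTransition_nonneg (n * b - 1)]

theorem integrableOn_Ioo_of_continuousOn {g : ℝ → ℝ} {a b c : ℝ} (ha : 0 < a)
    (hg : ContinuousOn g (Ioo 0 c)) (hbc : b < c) (h : IntegrableOn g (Ioo 0 a)) :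
    IntegrableOn g (Ioo 0 b) := by
  have h2 : IntegrableOn g (Icc a b) :=
    (hg.mono fun x hx => ⟨ha.trans_le hx.1, hx.2.trans_lt hbc⟩).integrableOn_Icc
  refine (h.union h2).mono_set fun x hx => ?_
  rcases lt_or_ge x a with hxa | hxa
  · exact Or.inl ⟨hx.1, hxa⟩
  · exact Or.inr ⟨hxa, hx.2.le⟩

/-- Integrability of a radial profile on the sphere of radius `r` near one of its points amounts to
local integrability on hypersurfaces. -/
theorem integrableOn_chord_iff {f : ℝ → ℝ} (hf : ContinuousOn f (Ioi 0)) (n : ℕ) {r : ℝ}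
    (hr : 0 < r) :
    IntegrableOn (fun θ => f (2 * r * Real.sin (θ / 2)) * Real.sin θ ^ n) (Ioo 0 Real.pi) ↔
      IntegrableOn (fun s => f s * s ^ n) (Ioo 0 1) := by
  have hpi := Real.pi_pos
  have hc1 : ContinuousOn (fun s => f s * s ^ n) (Ioi 0) := hf.mul (by fun_prop)
  have hsin : ∀ θ ∈ Ioo 0 (2 * Real.pi), 0 < 2 * r * Real.sin (θ / 2) := fun θ hθ => by
    have := Real.sin_pos_of_pos_of_lt_pi (x := θ / 2) (by linarith [hθ.1]) (by linarith [hθ.2])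
    positivity
  have hc2 : ContinuousOn (fun θ => f (2 * r * Real.sin (θ / 2)) * Real.sin θ ^ n)
      (Ioo 0 (2 * Real.pi)) :=
    (hf.comp (f := fun θ => 2 * r * Real.sin (θ / 2)) (by fun_prop) hsin).mul (by fun_prop)
  -- The chord substitution s = 2 r sin(θ/2) is made on (0, π/2) only, where cos(θ/2) is bounded
  -- below, so that ds is comparable to dθ and sin θ to s. The rest of both ranges is away from the
  -- singularity, and the integrands are continuous there, also across θ = π.
  set a : ℝ := 2 * r * Real.sin (Real.pi / 2 / 2) with ha
  have ha0 : 0 < a := hsin _ ⟨by linarith, by linarith⟩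
  have h1 : IntegrableOn (fun s => f s * s ^ n) (Ioo 0 1) ↔
      IntegrableOn (fun s => f s * s ^ n) (Ioo 0 a) :=
    ⟨integrableOn_Ioo_of_continuousOn one_pos (hc1.mono Ioo_subset_Ioi_self) (lt_add_one _),
      integrableOn_Ioo_of_continuousOn ha0 (hc1.mono Ioo_subset_Ioi_self) (lt_add_one _)⟩
  have h2 : IntegrableOn (fun θ => f (2 * r * Real.sin (θ / 2)) * Real.sin θ ^ n)
        (Ioo 0 Real.pi) ↔
      IntegrableOn (fun θ => f (2 * r * Real.sin (θ / 2)) * Real.sin θ ^ n)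
        (Ioo 0 (Real.pi / 2)) :=
    ⟨fun h => h.mono_set (Ioo_subset_Ioo_right (by linarith)),
      integrableOn_Ioo_of_continuousOn (by linarith) hc2 (by linarith)⟩
  have hmono : StrictMonoOn (fun θ => 2 * r * Real.sin (θ / 2)) (Icc 0 (Real.pi / 2)) := by
    intro x hx y hy hxy
    have := Real.strictMonoOn_sin (a := x / 2) (b := y / 2)
      ⟨by linarith [hx.1], by linarith [hx.2]⟩ ⟨by linarith [hy.1], by linarith [hy.2]⟩
      (by linarith)
    exact mul_lt_mul_of_pos_left this (by positivity)
  have himg : (fun θ => 2 * r * Real.sin (θ / 2)) '' Ioo 0 (Real.pi / 2) = Ioo 0 a := by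
    have := ContinuousOn.image_Ioo_of_strictMonoOn (a := 0) (b := Real.pi / 2)
      (f := fun θ => 2 * r * Real.sin (θ / 2)) (by linarith) (by fun_prop) hmono
    simpa using this
  have hder : ∀ θ ∈ Ioo 0 (Real.pi / 2), HasDerivWithinAt (fun θ => 2 * r * Real.sin (θ / 2))
      (r * Real.cos (θ / 2)) (Ioo 0 (Real.pi / 2)) θ := by
    intro θ _
    have := ((Real.hasDerivAt_sin (θ / 2)).comp θ ((hasDerivAt_id θ).div_const 2)).const_mul (2 * r)
    exact (this.congr_deriv (by simp; ring)).hasDerivWithinAt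
  rw [h1, h2, ← himg, integrableOn_image_iff_integrableOn_abs_deriv_smul measurableSet_Ioo hder
    (hmono.injOn.mono Ioo_subset_Icc_self)]
  have hcos : ∀ θ ∈ Icc 0 (Real.pi / 2), 0 < Real.cos (θ / 2) := fun θ hθ =>
    Real.cos_pos_of_mem_Ioo ⟨by linarith [hθ.1], by linarith [hθ.2]⟩
  have hs : ∀ θ, Real.sin θ = 2 * Real.sin (θ / 2) * Real.cos (θ / 2) := fun θ => by
    rw [← Real.sin_two_mul]; congr 1; ring
  rw [← integrableOn_Icc_iff_integrableOn_Ioo, ← integrableOn_Icc_iff_integrableOn_Ioo]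
  constructor
  · intro h
    have := h.continuousOn_mul (g := fun θ => r ^ (n + 1) * Real.cos (θ / 2) / Real.cos (θ / 2) ^ n)
      (ContinuousOn.div (by fun_prop) (by fun_prop) fun θ hθ => (pow_pos (hcos θ hθ) _).ne')
      isCompact_Icc
    refine this.congr_fun (fun θ hθ => ?_) measurableSet_Icc
    have hc := hcos θ hθ
    simp only [smul_eq_mul]
    rw [abs_of_pos (by positivity), hs θ]
    simp only [mul_pow]
    field_simp
    ring
  · intro h
    have := h.continuousOn_mul (g := fun θ => Real.cos (θ / 2) ^ n / (r ^ (n + 1) * Real.cos (θ / 2)))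
      (ContinuousOn.div (by fun_prop) (by fun_prop) fun θ hθ => by
        have := hcos θ hθ; positivity)
      isCompact_Icc
    refine this.congr_fun (fun θ hθ => ?_) measurableSet_Icc
    have hc := hcos θ hθ
    simp only [smul_eq_mul]
    rw [abs_of_pos (by positivity), hs θ]
    simp only [mul_pow]
    field_simp
    ring

theorem sqDist_self (r θ : ℝ) : sqDist r r θ = (2 * r * Real.sin (θ / 2)) ^ 2 := by
  have : Real.cos θ = 1 - 2 * Real.sin (θ / 2) ^ 2 := by
    rw [← Real.cos_sq_add_sin_sq (θ / 2), show θ = 2 * (θ / 2) by ring, Real.cos_two_mul']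
    ring_nf
  rw [sqDist, this]; ring

/-- Only r = η is singular. There the distance is the chord s = 2 r sin(θ/2) and r - r cos θ =
s²/(2r), so the integrand behaves like s² Q(s²), one power of s better than the assumption. -/
theorem intervalIntegrable_flux (hQ : ContinuousOn Q (Ioi 0))
    (hint : IntegrableOn (fun s => s * Q (s ^ 2) * s ^ (N - 2)) (Ioo 0 1)) {r η : ℝ} (hr : 0 < r)
    (hη : 0 < η) : IntervalIntegrable (fun θ =>
      r ^ (N - 1) * Q (sqDist r η θ) * (r - η * Real.cos θ) * Real.sin θ ^ (N - 2))
      volume 0 Real.pi := by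
  rcases eq_or_ne r η with rfl | hne
  · rw [intervalIntegrable_iff_integrableOn_Ioo_of_le Real.pi_pos.le]
    have hc : ContinuousOn (fun s => s * (s * Q (s ^ 2))) (Ioi 0) :=
      continuousOn_id.mul (continuousOn_id.mul (hQ.comp (by fun_prop) fun s hs => mem_Ioi.2 (pow_pos (mem_Ioi.1 hs) 2)))
    have h1 : IntegrableOn (fun s => s * (s * Q (s ^ 2)) * s ^ (N - 2)) (Ioo 0 1) := by
      rw [← integrableOn_Icc_iff_integrableOn_Ioo] at hint ⊢
      refine (hint.continuousOn_mul continuousOn_id isCompact_Icc).congr_fun (fun s _ => ?_)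
        measurableSet_Icc
      simp only [id]; ring
    have h2 := ((integrableOn_chord_iff hc (N - 2) hr).2 h1).const_mul (r ^ (N - 1) / (2 * r))
    refine IntegrableOn.congr_fun h2 (fun θ _ => ?_) measurableSet_Ioo
    have h3 : r - r * Real.cos θ = (2 * r * Real.sin (θ / 2)) ^ 2 / (2 * r) := by
      rw [← sqDist_self, sqDist]; field_simp; ring
    simp only [sqDist_self, h3]
    field_simp
  · apply Continuous.intervalIntegrable
    have hpos : ∀ θ, 0 < sqDist r η θ := fun θ =>
      (by have := sub_ne_zero.2 hne; positivity : 0 < (r - η) ^ 2).trans_le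
        (sq_sub_le_sqDist hr.le hη.le θ)
    have : Continuous fun θ => Q (sqDist r η θ) :=
      hQ.comp_continuous (continuous_sqDist_angle r η) hpos
    exact ((continuous_const.mul this).mul (by fun_prop)).mul (by fun_prop)

theorem tendsto_flux_trunc (hQ : ContDiffOn ℝ 1 Q (Ioi 0))
    (hint : IntegrableOn (fun s => s * Q (s ^ 2) * s ^ (N - 2)) (Ioo 0 1)) {r η : ℝ} (hr : 0 < r)
    (hη : 0 < η) :
    Tendsto (fun n => flux N (trunc Q n) r η) atTop (𝓝 (flux N Q r η)) := by
  unfold flux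
  refine (intervalIntegral.tendsto_integral_filter_of_dominated_convergence
    (fun θ => |r ^ (N - 1) * Q (sqDist r η θ) * (r - η * Real.cos θ) * Real.sin θ ^ (N - 2)|)
    ?_ ?_ (intervalIntegrable_flux hQ.continuousOn hint hr hη).abs ?_).neg
  · filter_upwards [eventually_gt_atTop 0] with n hn
    have := continuous_trunc hQ.continuousOn hn
    apply Continuous.aestronglyMeasurable
    unfold sqDist; fun_prop
  · refine Eventually.of_forall fun n => Eventually.of_forall fun θ _ => ?_
    rw [Real.norm_eq_abs]
    simp only [abs_mul]
    have := abs_trunc_le (Q := Q) (n := n) (sqDist r η θ)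
    gcongr ?_ * _ * _
    exact mul_le_mul_of_nonneg_left this (abs_nonneg _)
  · have : ∀ᵐ θ : ℝ, θ ≠ Real.pi := by simp [ae_iff]
    filter_upwards [this] with θ hθ hθ'
    rw [uIoc_of_le Real.pi_pos.le] at hθ'
    have hb := sqDist_pos (r := r) hη ⟨hθ'.1, lt_of_le_of_ne hθ'.2 hθ⟩
    refine tendsto_const_nhds.congr' ?_
    filter_upwards [(tendsto_natCast_mul_atTop hb).eventually_ge_atTop 2] with n hn
    rw [trunc_of_two_le hn]

end SphericalShell

/-! ### Expansion of the flux when the Laplacian is not integrable on hypersurfaces -/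

namespace SphericalShell

/-- The flux is, up to small errors near the diagonal, strictly increasing in the radius near the
sphere of radius `R`. -/
def FluxExpanding (N : ℕ) (Q : ℝ → ℝ) (R : ℝ) : Prop :=
  ∃ c > 0, ∀ κ > 0, ∃ ε > 0, ε < R ∧ ∀ η ∈ Icc (R - ε) (R + ε), ∀ r ∈ Icc (R - ε) (R + ε),
    ∀ r' ∈ Icc (R - ε) (R + ε), r' ≤ r →
      c * (r - r') - κ * (|r - η| + |r' - η|) ≤ flux N Q r η - flux N Q r' η

variable {N : ℕ} {Q : ℝ → ℝ}

theorem continuousOn_divProfile (hQ : ContDiffOn ℝ 1 Q (Ioi 0)) :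
    ContinuousOn (divProfile N Q) (Ioi 0) := by
  have h1 := hQ.continuousOn
  have h2 : ContinuousOn (deriv Q) (Ioi 0) := hQ.continuousOn_deriv_of_isOpen isOpen_Ioi le_rfl
  unfold divProfile
  fun_prop

/-- If the divergence is negative near the origin and `Q(|x|²) x` is integrable on hypersurfaces,
then `Q` is nonpositive near the origin. -/
theorem nonpos_of_divProfile_neg (hN : 2 ≤ N) (hQ : ContDiffOn ℝ 1 Q (Ioi 0))
    (hint : IntegrableOn (fun s => s * Q (s ^ 2) * s ^ (N - 2)) (Ioo 0 1)) {b₀ : ℝ}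
    (hneg : ∀ b ∈ Ioo 0 b₀, divProfile N Q b < 0) : ∀ b ∈ Ioo 0 b₀, Q b ≤ 0 := by
  intro b hb
  by_contra hQb
  push Not at hQb
  let f : ℝ → ℝ := fun s => s ^ N * Q (s ^ 2)
  have hder : ∀ s, 0 < s → HasDerivAt f (s ^ (N - 1) * divProfile N Q (s ^ 2)) s := by
    intro s hs
    have h1 : HasDerivAt Q (deriv Q (s ^ 2)) (s ^ 2) :=
      ((hQ.contDiffAt (Ioi_mem_nhds (by positivity))).differentiableAt one_ne_zero).hasDerivAt
    have h2 : HasDerivAt (fun s => Q (s ^ 2)) _ s :=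
      HasDerivAt.comp (h₂ := Q) (h := fun s => s ^ 2) s h1 (hasDerivAt_pow 2 s)
    refine ((hasDerivAt_pow N s).mul h2).congr_deriv ?_
    obtain ⟨n, rfl⟩ : ∃ n, N = n + 1 := ⟨N - 1, by omega⟩
    simp only [divProfile, Nat.add_sub_cancel]
    push_cast
    ring
  have hb0 : 0 < √b := Real.sqrt_pos.2 hb.1
  have hanti : AntitoneOn f (Ioc 0 √b) := by
    refine antitoneOn_of_deriv_nonpos (convex_Ioc _ _)
      (fun s hs => (hder s hs.1).continuousAt.continuousWithinAt)
      (fun s hs => (hder s (interior_subset hs).1).differentiableAt.differentiableWithinAt)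
      fun s hs => ?_
    have hs' := interior_subset hs
    rw [(hder s hs'.1).deriv]
    refine mul_nonpos_of_nonneg_of_nonpos (pow_nonneg hs'.1.le _) (hneg _ ⟨pow_pos hs'.1 2, ?_⟩).le
    calc s ^ 2 ≤ √b ^ 2 := pow_le_pow_left₀ hs'.1.le hs'.2 2
      _ = b := Real.sq_sqrt hb.1.le
      _ < b₀ := hb.2
  have hfb : 0 < f √b := by
    simp only [f, Real.sq_sqrt hb.1.le]; positivity
  have hcont : ContinuousOn (fun s => s * Q (s ^ 2) * s ^ (N - 2)) (Ioi 0) :=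
    (continuousOn_id.mul (hQ.continuousOn.comp (by fun_prop)
      fun s hs => mem_Ioi.2 (pow_pos (mem_Ioi.1 hs) 2))).mul (by fun_prop)
  have hint2 : IntegrableOn (fun s => s * Q (s ^ 2) * s ^ (N - 2)) (Ioo 0 √b) :=
    integrableOn_Ioo_of_continuousOn one_pos (hcont.mono Ioo_subset_Ioi_self) (lt_add_one _) hint
  -- Since s^N Q(s²) decreases, a positive value at √b bounds it below all the way to the origin;
  -- then s^(N-1) Q(s²) dominates a multiple of 1/s, contradicting integrability.
  have hinv : IntegrableOn (fun s : ℝ => s⁻¹) (Ioo 0 √b) := by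
    refine Integrable.mono' (hint2.const_mul (f √b)⁻¹) (by fun_prop) ?_
    filter_upwards [ae_restrict_mem measurableSet_Ioo] with s hs
    have h1 := hanti ⟨hs.1, hs.2.le⟩ ⟨hb0, le_rfl⟩ hs.2.le
    have h2 : s * Q (s ^ 2) * s ^ (N - 2) = f s * s⁻¹ := by
      have := hs.1
      simp only [f]
      obtain ⟨n, rfl⟩ : ∃ n, N = n + 2 := ⟨N - 2, by omega⟩
      simp only [Nat.add_sub_cancel]
      field_simp
      ring
    have h3 : 0 < s⁻¹ := inv_pos.2 hs.1
    rw [h2, Real.norm_eq_abs, abs_of_pos h3, ← mul_assoc]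
    refine le_mul_of_one_le_left h3.le ?_
    rw [inv_mul_eq_div, one_le_div hfb]
    exact h1
  have := (intervalIntegrable_iff_integrableOn_Ioo_of_le hb0.le).2 hinv
  rw [intervalIntegrable_inv_iff] at this
  rcases this with h | h
  · exact hb0.ne h
  · exact h left_mem_uIcc

theorem pos_of_two_lt_mul {n : ℕ} {b : ℝ} (h : 2 < n * b) : 0 < n := by
  rcases Nat.eq_zero_or_pos n with rfl | hn
  · simp at h; linarith
  · exact hn

/-- Near the origin, raising the truncation level multiplies a negative divergence by a larger
factor, and the term with the derivative of the cutoff has the sign of `Q`, which is nonpositive.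
For b ≥ b₀ both truncations are inactive. The right-hand side is continuous and does not depend on
`m`. -/
theorem divProfile_trunc_le (hQ : ContDiffOn ℝ 1 Q (Ioi 0)) {b₀ : ℝ}
    (hneg : ∀ b ∈ Ioo 0 b₀, divProfile N Q b < 0) (hQneg : ∀ b ∈ Ioo 0 b₀, Q b ≤ 0) {n m : ℕ}
    (hnm : n ≤ m) (hn : 2 < n * b₀) (b : ℝ) :
    divProfile N (trunc Q m) b ≤ trunc (divProfile N Q) n b := by
  have hnm' : (n : ℝ) ≤ m := Nat.cast_le.2 hnm
  rcases le_or_gt b 0 with hb | hb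
  · rw [divProfile_trunc_of_nonpos hb, trunc_of_le_one]
    have := mul_nonpos_of_nonneg_of_nonpos (Nat.cast_nonneg (α := ℝ) n) hb
    linarith
  rcases lt_or_ge b b₀ with hb' | hb'
  · rw [divProfile_trunc hQ hb, trunc]
    have h1 := hneg b ⟨hb, hb'⟩
    have h2 := hQneg b ⟨hb, hb'⟩
    have h3 : Real.smoothTransition (n * b - 1) ≤ Real.smoothTransition (m * b - 1) :=
      Real.smoothTransition.monotone (by gcongr)
    have h4 : 2 * (m * b * deriv Real.smoothTransition (m * b - 1)) * Q b ≤ 0 := by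
      have := deriv_smoothTransition_nonneg (m * b - 1)
      exact mul_nonpos_of_nonneg_of_nonpos (by positivity) h2
    nlinarith
  · have h1 : 2 < n * b := hn.trans_le (by gcongr)
    have h2 : 2 < m * b := h1.trans_le (by gcongr)
    rw [divProfile_trunc_of_two_lt hQ h2, trunc_of_two_le h1.le]

/-- Otherwise the truncated means stay above -1 and Fatou's lemma makes θ ↦ G sin^(N-2) θ integrable
along the sphere of radius `R`, which by the chord substitution is integrability on hypersurfaces.
-/
theorem exists_one_le_neg_angMean {G : ℝ → ℝ} (hG : ContinuousOn G (Ioi 0)) {b₀ : ℝ} (hb₀ : 0 < b₀)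
    (hneg : ∀ b ∈ Ioo 0 b₀, G b < 0)
    (hnon : ¬ IntegrableOn (fun s => G (s ^ 2) * s ^ (N - 2)) (Ioo 0 1)) {R : ℝ} (hR : 0 < R) :
    ∃ n : ℕ, 2 < n * b₀ ∧ 1 ≤ -angMean N (trunc G n) R R := by
  by_contra! hcon
  apply hnon
  have hG2 : ContinuousOn (fun s => G (s ^ 2)) (Ioi 0) :=
    hG.comp (by fun_prop) fun s hs => mem_Ioi.2 (pow_pos (mem_Ioi.1 hs) 2)
  rw [← integrableOn_chord_iff hG2 (N - 2) hR]
  simp only [← sqDist_self]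
  obtain ⟨B, hB⟩ := (isCompact_Icc (a := b₀) (b := (R + R) ^ 2)).bddAbove_image
    (f := fun b => |G b|) ((hG.mono fun b hb => hb₀.trans_le hb.1).abs)
  have hev : ∀ᶠ n : ℕ in atTop, 2 < n * b₀ :=
    (tendsto_natCast_mul_atTop hb₀).eventually_gt_atTop 2
  let u : ℕ → ℝ → ℝ := fun n θ => trunc G n (sqDist R R θ) * Real.sin θ ^ (N - 2)
  have hpos : ∀ θ ∈ Ioo 0 Real.pi, 0 < sqDist R R θ := fun θ hθ => sqDist_pos hR hθ
  have hmeas : AEStronglyMeasurable (fun θ => G (sqDist R R θ) * Real.sin θ ^ (N - 2))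
      (volume.restrict (Ioo 0 Real.pi)) :=
    ((hG.comp (continuous_sqDist_angle R R).continuousOn hpos).mul
      (by fun_prop)).aestronglyMeasurable measurableSet_Ioo
  have huc : ∀ n : ℕ, 0 < n → Continuous (u n) := by
    intro n hn0
    exact ((continuous_trunc hG hn0).comp (continuous_sqDist_angle R R)).mul (by fun_prop)
  -- `G` can be positive only where b ≥ b₀, and there it is bounded by `B` on the range of squared
  -- distances; so a bound on the mean of -u also bounds the mean of |u|.
  have hbound : ∀ n : ℕ, 2 < n * b₀ → ∀ θ ∈ Ioo 0 Real.pi, |u n θ| ≤ -u n θ + 2 * |B| := by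
    intro n hn θ hθ
    have hs0 : 0 ≤ Real.sin θ ^ (N - 2) := pow_nonneg (Real.sin_pos_of_mem_Ioo hθ).le _
    have hs1 : Real.sin θ ^ (N - 2) ≤ 1 := pow_le_one₀ (Real.sin_pos_of_mem_Ioo hθ).le (Real.sin_le_one θ)
    rcases lt_or_ge (sqDist R R θ) b₀ with h | h
    · have h1 : u n θ ≤ 0 := by
        refine mul_nonpos_of_nonpos_of_nonneg ?_ hs0
        exact mul_nonpos_of_nonneg_of_nonpos (Real.smoothTransition.nonneg _)
          (hneg _ ⟨hpos θ hθ, h⟩).le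
      rw [abs_of_nonpos h1]
      linarith [abs_nonneg B]
    · have h1 : |u n θ| ≤ |B| := by
        rw [abs_mul, abs_of_nonneg hs0]
        have h2 := hB ⟨sqDist R R θ, ⟨h, sqDist_le_sq_add hR.le hR.le θ⟩, rfl⟩
        calc |trunc G n (sqDist R R θ)| * Real.sin θ ^ (N - 2) ≤ |G (sqDist R R θ)| * 1 :=
              mul_le_mul (abs_trunc_le _) hs1 hs0 (abs_nonneg _)
          _ ≤ |B| := by rw [mul_one]; exact h2.trans (le_abs_self B)
      linarith [neg_abs_le (u n θ), le_abs_self (u n θ)]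
  refine ⟨hmeas, ?_⟩
  have hfatou : ∫⁻ θ in Ioo 0 Real.pi, ‖G (sqDist R R θ) * Real.sin θ ^ (N - 2)‖ₑ ≤
      ENNReal.ofReal (1 + 2 * |B| * Real.pi) := by
    calc ∫⁻ θ in Ioo 0 Real.pi, ‖G (sqDist R R θ) * Real.sin θ ^ (N - 2)‖ₑ
        = ∫⁻ θ in Ioo 0 Real.pi, liminf (fun n => ‖u n θ‖ₑ) atTop := by
          refine setLIntegral_congr_fun measurableSet_Ioo fun θ hθ => ?_
          refine (Tendsto.liminf_eq (tendsto_const_nhds.congr' ?_)).symm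
          filter_upwards [(tendsto_natCast_mul_atTop (hpos θ hθ)).eventually_ge_atTop 2] with n hn
          simp only [u, trunc_of_two_le hn]
      _ ≤ liminf (fun n => ∫⁻ θ in Ioo 0 Real.pi, ‖u n θ‖ₑ) atTop := by
          refine lintegral_liminf_le fun n => ?_
          rcases Nat.eq_zero_or_pos n with rfl | h
          · simp [u, trunc_of_le_one]
          · exact (huc n h).measurable.enorm
      _ ≤ _ := by
          refine liminf_le_of_frequently_le' (Eventually.frequently ?_)
          filter_upwards [hev] with n hn
          have hi : IntegrableOn (u n) (Ioo 0 Real.pi) :=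
            (huc n (pos_of_two_lt_mul hn)).continuousOn.integrableOn_Icc.mono_set Ioo_subset_Icc_self
          rw [← ofReal_integral_norm_eq_lintegral_enorm hi]
          refine ENNReal.ofReal_le_ofReal ?_
          have hc := hcon n hn
          rw [angMean, intervalIntegral.integral_of_le Real.pi_pos.le,
            integral_Ioc_eq_integral_Ioo] at hc
          calc ∫ θ in Ioo 0 Real.pi, ‖u n θ‖ ≤ ∫ θ in Ioo 0 Real.pi, (-u n θ + 2 * |B|) :=
                setIntegral_mono_on hi.norm (hi.neg.add (integrableOn_const (by simp)))
                  measurableSet_Ioo (hbound n hn)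
            _ = -(∫ θ in Ioo 0 Real.pi, u n θ) + 2 * |B| * Real.pi := by
                rw [integral_add (f := fun θ => -u n θ) hi.neg (integrableOn_const (by simp)), integral_neg]
                simp [Real.pi_pos.le]; ring
            _ ≤ 1 + 2 * |B| * Real.pi := by gcongr
  exact hfatou.trans_lt ENNReal.ofReal_lt_top

theorem continuous_pow_mul_angMean {G : ℝ → ℝ} (hG : Continuous G) (η : ℝ) :
    Continuous fun ρ => ρ ^ (N - 1) * angMean N G ρ η :=
  (continuous_pow _).mul ((continuous_angMean hG).comp (by fun_prop : Continuous fun ρ : ℝ => (ρ, η)))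

/-- Expansion when the divergence is negative and not integrable on hypersurfaces. -/
theorem fluxExpanding_of_not_integrable (hN : 2 ≤ N) (hQ : ContDiffOn ℝ 1 Q (Ioi 0))
    (hint : IntegrableOn (fun s => s * Q (s ^ 2) * s ^ (N - 2)) (Ioo 0 1)) {b₀ : ℝ} (hb₀ : 0 < b₀)
    (hneg : ∀ b ∈ Ioo 0 b₀, divProfile N Q b < 0)
    (hnon : ¬ IntegrableOn (fun s => divProfile N Q (s ^ 2) * s ^ (N - 2)) (Ioo 0 1))
    {R : ℝ} (hR : 0 < R) : FluxExpanding N Q R := by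
  have hG := continuousOn_divProfile (N := N) hQ
  have hQneg := nonpos_of_divProfile_neg hN hQ hint hneg
  obtain ⟨n, hn, hn1⟩ := exists_one_le_neg_angMean hG hb₀ hneg hnon hR
  have hn0 := pos_of_two_lt_mul hn
  have hTc := continuous_trunc hG hn0
  have hnhds : ∀ᶠ p : ℝ × ℝ in 𝓝 (R, R),
      1 / 2 < -angMean N (trunc (divProfile N Q) n) p.1 p.2 :=
    ((continuous_angMean (N := N) hTc).neg.tendsto (R, R)).eventually
      (lt_mem_nhds (by rw [Pi.neg_apply]; linarith))
  obtain ⟨ε₀, hε₀, hball⟩ := Metric.nhds_basis_closedBall.eventually_iff.1 hnhds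
  refine ⟨(R / 2) ^ (N - 1) * (1 / 2), by positivity, fun κ hκ =>
    ⟨min ε₀ (R / 2), by positivity, lt_of_le_of_lt (min_le_right _ _) (by linarith), ?_⟩⟩
  intro η hη r hr r' hr' hrr
  have hle1 := min_le_left ε₀ (R / 2)
  have hle2 := min_le_right ε₀ (R / 2)
  have hpos : ∀ x ∈ Icc (R - min ε₀ (R / 2)) (R + min ε₀ (R / 2)), R / 2 ≤ x := fun x hx => by
    linarith [hx.1]
  -- The constant is the lower bound of ρ^(N-1) times that of the mean at level `n`. Being the same
  -- for every m ≥ n, it survives the limit in `m`.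
  have key : ∀ᶠ m in atTop, (R / 2) ^ (N - 1) * (1 / 2) * (r - r') ≤
      flux N (trunc Q m) r η - flux N (trunc Q m) r' η := by
    filter_upwards [eventually_ge_atTop n] with m hm
    have hm1 : ContDiff ℝ 1 (trunc Q m) := contDiff_trunc hQ (hn0.trans_le hm)
    have hdc := continuous_divProfile (N := N) hm1
    rw [flux_sub_flux hN hm1, ← intervalIntegral.integral_neg]
    have : ∫ ρ in r'..r, (R / 2) ^ (N - 1) * (1 / 2) = (R / 2) ^ (N - 1) * (1 / 2) * (r - r') := by
      simp; ring
    rw [← this]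
    refine intervalIntegral.integral_mono_on hrr (by simp)
      ((continuous_pow_mul_angMean hdc η).neg.intervalIntegrable _ _) fun ρ hρ => ?_
    have hρ' : ρ ∈ Icc (R - min ε₀ (R / 2)) (R + min ε₀ (R / 2)) :=
      ⟨hr'.1.trans hρ.1, hρ.2.trans hr.2⟩
    have h1 : 1 / 2 ≤ -angMean N (trunc (divProfile N Q) n) ρ η := by
      have : (ρ, η) ∈ Metric.closedBall (R, R) ε₀ := by
        rw [Metric.mem_closedBall, Prod.dist_eq]
        refine max_le ?_ ?_ <;> simp only [Real.dist_eq, abs_le]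
        · exact ⟨by linarith [hρ'.1], by linarith [hρ'.2]⟩
        · exact ⟨by linarith [hη.1], by linarith [hη.2]⟩
      have h := hball this
      simp only at h
      exact h.le
    have h2 : angMean N (divProfile N (trunc Q m)) ρ η ≤
        angMean N (trunc (divProfile N Q) n) ρ η := by
      refine intervalIntegral.integral_mono_on Real.pi_pos.le
        ((hdc.comp (continuous_sqDist_angle ρ η)).mul (by fun_prop) |>.intervalIntegrable _ _)
        ((hTc.comp (continuous_sqDist_angle ρ η)).mul (by fun_prop) |>.intervalIntegrable _ _)
        fun θ hθ => ?_
      refine mul_le_mul_of_nonneg_right (divProfile_trunc_le hQ hneg hQneg hm hn _) ?_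
      exact pow_nonneg (Real.sin_nonneg_of_mem_Icc hθ) _
    have h3 : (R / 2) ^ (N - 1) ≤ ρ ^ (N - 1) := pow_le_pow_left₀ (by positivity) (hpos ρ hρ') _
    rw [← mul_neg]
    exact mul_le_mul h3 (h1.trans (neg_le_neg h2)) (by norm_num)
      (pow_nonneg (by linarith [hpos ρ hρ']) _)
  have hlim := (tendsto_flux_trunc hQ hint (by linarith [hpos r hr] : 0 < r)
    (by linarith [hpos η hη] : 0 < η)).sub
    (tendsto_flux_trunc hQ hint (by linarith [hpos r' hr'] : 0 < r')
      (by linarith [hpos η hη] : 0 < η))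
  have := ge_of_tendsto hlim key
  have h4 : 0 ≤ κ * (|r - η| + |r' - η|) := by positivity
  linarith

end SphericalShell

/-! ### Thin annuli and small circles centred on the sphere -/

namespace SphericalShell

/-- Between the two angles the cosine stays in [-1/2, 1/2], so the sine is at least 1/2 and the mean
value theorem applies. -/
theorem abs_sub_le_of_abs_cos_add_le {β w φ ψ : ℝ} (hβ0 : 0 ≤ β) (hβ : β ≤ 1 / 4) (hw : w ≤ 1 / 4)
    (hφ : φ ∈ Ioo 0 Real.pi) (hψ : ψ ∈ Ioo 0 Real.pi) (h1 : |Real.cos φ + β| ≤ w)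
    (h2 : |Real.cos ψ + β| ≤ w) : |φ - ψ| ≤ 4 * w := by
  wlog h : φ ≤ ψ generalizing φ ψ
  · rw [abs_sub_comm]
    exact this hψ hφ h2 h1 (le_of_not_ge h)
  rw [abs_le] at h1 h2
  have hanti := Real.strictAntiOn_cos.antitoneOn
  have key : (1 / 2) * (ψ - φ) ≤ -Real.cos ψ - -Real.cos φ := by
    refine Convex.mul_sub_le_image_sub_of_le_deriv (f := fun x => -Real.cos x) (convex_Icc φ ψ)
      (by fun_prop) (by fun_prop) (fun x hx => ?_) φ (left_mem_Icc.2 h) ψ (right_mem_Icc.2 h) h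
    rw [interior_Icc] at hx
    have hx0 : x ∈ Ioo 0 Real.pi := ⟨hφ.1.trans hx.1, hx.2.trans hψ.2⟩
    have h3 := hanti ⟨hφ.1.le, hφ.2.le⟩ ⟨hx0.1.le, hx0.2.le⟩ hx.1.le
    have h4 := hanti ⟨hx0.1.le, hx0.2.le⟩ ⟨hψ.1.le, hψ.2.le⟩ hx.2.le
    have h5 := Real.sin_pos_of_mem_Ioo hx0
    have h6 := Real.sin_sq_add_cos_sq x
    have h7 : deriv (fun x => -Real.cos x) x = Real.sin x := by simp
    rw [h7]
    have h8 : Real.cos x ^ 2 ≤ 1 / 4 := by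
      rw [show (1 / 4 : ℝ) = (1 / 2) ^ 2 by norm_num, sq_le_sq, abs_of_pos (by norm_num : (0 : ℝ) < 1 / 2), abs_le]
      constructor <;> linarith
    nlinarith
  rw [abs_of_nonpos (by linarith)]
  linarith

/-- The directions making an almost right angle with a given direction in the plane. -/
theorem volume_cos_band_le {β w : ℝ} (hβ0 : 0 ≤ β) (hβ : β ≤ 1 / 4) (hw0 : 0 ≤ w) :
    volume {φ : ℝ | φ ∈ Ioo (-Real.pi) Real.pi ∧ |Real.cos φ + β| ≤ w} ≤
      ENNReal.ofReal (8 * Real.pi * w) := by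
  have hpi := Real.pi_gt_three
  rcases lt_or_ge w (1 / 4) with hw | hw
  · let S : Set ℝ := {φ | φ ∈ Ioo 0 Real.pi ∧ |Real.cos φ + β| ≤ w}
    let T : Set ℝ := {φ | -φ ∈ S}
    have hsub : {φ : ℝ | φ ∈ Ioo (-Real.pi) Real.pi ∧ |Real.cos φ + β| ≤ w} ⊆ S ∪ T := by
      rintro φ ⟨hφ, h⟩
      rcases lt_trichotomy φ 0 with h0 | rfl | h0
      · right
        exact ⟨⟨by linarith, by linarith [hφ.1]⟩, by rwa [Real.cos_neg]⟩
      · rw [Real.cos_zero, abs_of_nonneg (by linarith)] at h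
        linarith
      · exact Or.inl ⟨⟨h0, hφ.2⟩, h⟩
    have hS : volume S ≤ ENNReal.ofReal (4 * w) := by
      refine (Real.volume_le_diam S).trans (Metric.ediam_le fun x hx y hy => ?_)
      rw [edist_dist, Real.dist_eq]
      exact ENNReal.ofReal_le_ofReal
        (abs_sub_le_of_abs_cos_add_le hβ0 hβ hw.le hx.1 hy.1 hx.2 hy.2)
    have hT : volume T ≤ ENNReal.ofReal (4 * w) := by
      refine (Real.volume_le_diam T).trans (Metric.ediam_le fun x hx y hy => ?_)
      rw [edist_dist, Real.dist_eq, show |x - y| = |(-x) - (-y)| by rw [← abs_neg]; congr 1; ring]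
      exact ENNReal.ofReal_le_ofReal
        (abs_sub_le_of_abs_cos_add_le hβ0 hβ hw.le hx.1 hy.1 hx.2 hy.2)
    calc _ ≤ volume S + volume T := (measure_mono hsub).trans (measure_union_le _ _)
      _ ≤ ENNReal.ofReal (4 * w) + ENNReal.ofReal (4 * w) := add_le_add hS hT
      _ = ENNReal.ofReal (8 * w) := by
        rw [← ENNReal.ofReal_add (by positivity) (by positivity)]; congr 1; ring
      _ ≤ _ := ENNReal.ofReal_le_ofReal (by nlinarith)
  -- For a wide band the whole circle, of length 2π ≤ 8πw, is already a good enough bound.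
  · calc _ ≤ volume (Ioo (-Real.pi) Real.pi) := measure_mono fun φ h => h.1
      _ = ENNReal.ofReal (2 * Real.pi) := by rw [Real.volume_Ioo]; congr 1; ring
      _ ≤ _ := ENNReal.ofReal_le_ofReal (by nlinarith)

/-- On the circle of radius `s` about a point at distance `η`, the law of cosines reads ρ² - η² = 2
η s (cos φ + s/(2η)). Being in the annulus confines cos φ + s/(2η) to a band of width of order A/s,
and s ≤ η/2 keeps the circle transversal to the sphere. -/
theorem volume_arc_le {η s A : ℝ} (hη : 0 < η) (hs : 0 < s) (hsη : s ≤ η / 2) (hA : 0 ≤ A)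
    (hAη : A ≤ η / 2) :
    volume {φ : ℝ | φ ∈ Ioo (-Real.pi) Real.pi ∧
      |√((s * Real.cos φ + η) ^ 2 + (s * Real.sin φ) ^ 2) - η| ≤ A} ≤
      ENNReal.ofReal (12 * Real.pi * A / s) := by
  have h := volume_cos_band_le (β := s / (2 * η)) (w := 3 * A / (2 * s)) (by positivity)
    (by rw [div_le_iff₀ (by positivity)]; linarith) (by positivity)
  refine (measure_mono ?_).trans (h.trans_eq ?_)
  · rintro φ ⟨hφ, h1⟩
    refine ⟨hφ, ?_⟩
    set ρ := √((s * Real.cos φ + η) ^ 2 + (s * Real.sin φ) ^ 2) with hρ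
    have hsq : ρ ^ 2 = η ^ 2 + 2 * η * s * Real.cos φ + s ^ 2 := by
      rw [hρ, Real.sq_sqrt (by positivity)]
      linear_combination s ^ 2 * Real.sin_sq_add_cos_sq φ
    have h2 : |ρ ^ 2 - η ^ 2| ≤ 3 * η * A := by
      have h0 : 0 ≤ ρ := Real.sqrt_nonneg _
      have h3 : ρ + η ≤ 3 * η := by linarith [(abs_le.1 h1).2]
      calc |ρ ^ 2 - η ^ 2| = |ρ - η| * (ρ + η) := by
            rw [show ρ ^ 2 - η ^ 2 = (ρ - η) * (ρ + η) by ring, abs_mul,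
              abs_of_nonneg (by positivity : 0 ≤ ρ + η)]
        _ ≤ A * (3 * η) := mul_le_mul h1 h3 (by positivity) hA
        _ = 3 * η * A := by ring
    have h4 : Real.cos φ + s / (2 * η) = (ρ ^ 2 - η ^ 2) / (2 * η * s) := by
      rw [hsq]; field_simp; ring
    rw [h4, abs_div, abs_of_pos (by positivity : 0 < 2 * η * s), div_le_div_iff₀ (by positivity) (by positivity)]
    nlinarith
  · congr 1; field_simp; ring

/-- Integrals over a thin annulus around the sphere of radius `η` of functions concentrated near one
of its points are controlled by the thickness of the annulus and hypersurface integrals. -/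
theorem lintegral_annulus_le (n : ℕ) {F : ℝ → ℝ≥0∞} (hF : Measurable F) {η A : ℝ} (hη : 0 < η)
    (hF0 : ∀ s, η / 2 < s → F s = 0) (hA : 0 ≤ A) (hAη : A ≤ η / 2) :
    ∫⁻ ρ in Icc (η - A) (η + A), ∫⁻ θ in Ioo 0 Real.pi,
      F (√(sqDist ρ η θ)) * ENNReal.ofReal (Real.sin θ ^ n) ≤
    ENNReal.ofReal ((2 / η) ^ (n + 1) * (12 * Real.pi * A)) *
      ∫⁻ s in Ioi 0, F s * ENNReal.ofReal (s ^ n) := by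
  let f : ℝ × ℝ → ℝ≥0∞ := fun p => F (√((p.1 - η) ^ 2 + p.2 ^ 2)) * ENNReal.ofReal (|p.2| ^ n) *
    {q : ℝ × ℝ | |√(q.1 ^ 2 + q.2 ^ 2) - η| ≤ A}.indicator 1 p
  have hset : MeasurableSet {q : ℝ × ℝ | |√(q.1 ^ 2 + q.2 ^ 2) - η| ≤ A} :=
    measurableSet_le (by fun_prop) measurable_const
  have hf : Measurable f := by
    refine Measurable.mul (by fun_prop) (measurable_one.indicator hset)
  -- As 2ρ/η ≥ 1 on the annulus, the factor (2ρ/η)^(n+1) may be inserted: it supplies the polar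
  -- Jacobian ρ and turns sin θ into the Cartesian coordinate ρ sin θ.
  have hlow : ∀ p ∈ Icc (η - A) (η + A) ×ˢ Ioo 0 Real.pi,
      F (√(sqDist p.1 η p.2)) * ENNReal.ofReal (Real.sin p.2 ^ n) ≤
      ENNReal.ofReal ((2 / η) ^ (n + 1)) * (ENNReal.ofReal p.1 • f (polarCoord.symm p)) := by
    rintro ⟨ρ, θ⟩ ⟨hρ, hθ⟩
    have hρ1 : η / 2 ≤ ρ := by linarith [hρ.1]
    have hρ0 : 0 < ρ := by linarith
    have hsin := Real.sin_pos_of_mem_Ioo hθ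
    have h1 : √((ρ * Real.cos θ) ^ 2 + (ρ * Real.sin θ) ^ 2) = ρ := by
      rw [mul_pow, mul_pow, ← mul_add, Real.cos_sq_add_sin_sq, mul_one, Real.sqrt_sq hρ0.le]
    have h2 : (ρ * Real.cos θ - η) ^ 2 + (ρ * Real.sin θ) ^ 2 = sqDist ρ η θ := by
      rw [sqDist]; linear_combination ρ ^ 2 * Real.sin_sq_add_cos_sq θ
    have h3 : (ρ * Real.cos θ, ρ * Real.sin θ) ∈ {q : ℝ × ℝ | |√(q.1 ^ 2 + q.2 ^ 2) - η| ≤ A} := by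
      simp only [mem_ofPred_eq, h1, abs_le]
      exact ⟨by linarith [hρ.1], by linarith [hρ.2]⟩
    simp only [f, polarCoord_symm_apply, h2, indicator_of_mem h3, Pi.one_apply, mul_one, smul_eq_mul]
    rw [abs_of_pos (by positivity : 0 < ρ * Real.sin θ),
      show ∀ a b c d : ℝ≥0∞, a * (b * (c * d)) = c * (a * b * d) by intros; ring,
      ← ENNReal.ofReal_mul (by positivity), ← ENNReal.ofReal_mul (by positivity)]
    gcongr
    rw [mul_pow, show (2 / η) ^ (n + 1) * ρ * (ρ ^ n * Real.sin θ ^ n) =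
      ((2 / η) * ρ) ^ (n + 1) * Real.sin θ ^ n by ring]
    refine le_mul_of_one_le_left (by positivity) (one_le_pow₀ ?_)
    rw [div_mul_eq_mul_div, one_le_div hη]; linarith
  have hmeas1 : Measurable fun p : ℝ × ℝ =>
      F (√(sqDist p.1 η p.2)) * ENNReal.ofReal (Real.sin p.2 ^ n) := by
    unfold sqDist; fun_prop
  have hmeas2 : MeasurableSet (Icc (η - A) (η + A) ×ˢ Ioo 0 Real.pi) :=
    measurableSet_Icc.prod measurableSet_Ioo
  have hsub : Icc (η - A) (η + A) ×ˢ Ioo 0 Real.pi ⊆ polarCoord.target := by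
    rintro ⟨ρ, θ⟩ ⟨hρ, hθ⟩
    exact ⟨show 0 < ρ by linarith [hρ.1], show -Real.pi < θ by linarith [hθ.1, Real.pi_pos], hθ.2⟩
  have e1 : ∫⁻ ρ in Icc (η - A) (η + A), ∫⁻ θ in Ioo 0 Real.pi,
      F (√(sqDist ρ η θ)) * ENNReal.ofReal (Real.sin θ ^ n) =
      ∫⁻ p in Icc (η - A) (η + A) ×ˢ Ioo 0 Real.pi,
        F (√(sqDist p.1 η p.2)) * ENNReal.ofReal (Real.sin p.2 ^ n) := by
    rw [Measure.volume_eq_prod, ← Measure.prod_restrict, lintegral_prod _ hmeas1.aemeasurable]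
  -- Polar coordinates are recentred at the point (η, 0), the location of the singularity.
  have e2 : ∫⁻ p, f p = ∫⁻ s in Ioi 0, ∫⁻ φ in Ioo (-Real.pi) Real.pi,
      ENNReal.ofReal s * f (s * Real.cos φ + η, s * Real.sin φ) := by
    rw [← lintegral_add_right_eq_self f ((η, 0) : ℝ × ℝ),
      ← lintegral_comp_polarCoord_symm, polarCoord_target, Measure.volume_eq_prod,
      ← Measure.prod_restrict, lintegral_prod]
    · simp
    · refine Measurable.aemeasurable ?_
      refine (measurable_fst.ennreal_ofReal).smul (hf.comp ?_)
      exact (continuous_polarCoord_symm.measurable).add_const _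
  -- The arc bound 12πA/s cancels the Jacobian `s`, leaving the thickness times a hypersurface
  -- integral.
  have e3 : ∀ s ∈ Ioi (0 : ℝ), ∫⁻ φ in Ioo (-Real.pi) Real.pi,
      ENNReal.ofReal s * f (s * Real.cos φ + η, s * Real.sin φ) ≤
      ENNReal.ofReal (12 * Real.pi * A) * (F s * ENNReal.ofReal (s ^ n)) := by
    intro s hs
    have hs : 0 < s := hs
    rcases lt_or_ge (η / 2) s with h | h
    · have : ∀ φ, f (s * Real.cos φ + η, s * Real.sin φ) = 0 := by
        intro φ
        have h1 : √((s * Real.cos φ) ^ 2 + (s * Real.sin φ) ^ 2) = s := by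
          rw [mul_pow, mul_pow, ← mul_add, Real.cos_sq_add_sin_sq, mul_one, Real.sqrt_sq hs.le]
        simp [f, h1, hF0 s h]
      simp [this]
    let E : Set ℝ := {φ : ℝ | |√((s * Real.cos φ + η) ^ 2 + (s * Real.sin φ) ^ 2) - η| ≤ A}
    have hE : MeasurableSet E := measurableSet_le (by fun_prop) measurable_const
    calc ∫⁻ φ in Ioo (-Real.pi) Real.pi, ENNReal.ofReal s * f (s * Real.cos φ + η, s * Real.sin φ)
        ≤ ∫⁻ φ in Ioo (-Real.pi) Real.pi,
          (ENNReal.ofReal s * (F s * ENNReal.ofReal (s ^ n))) * E.indicator 1 φ := by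
          refine lintegral_mono fun φ => ?_
          have h1 : √((s * Real.cos φ) ^ 2 + (s * Real.sin φ) ^ 2) = s := by
            rw [mul_pow, mul_pow, ← mul_add, Real.cos_sq_add_sin_sq, mul_one, Real.sqrt_sq hs.le]
          have h2 : |s * Real.sin φ| ≤ s := by
            rw [abs_mul, abs_of_pos hs]
            exact mul_le_of_le_one_right hs.le (Real.abs_sin_le_one φ)
          simp only [f, add_sub_cancel_right, h1]
          rw [mul_assoc (ENNReal.ofReal s)]
          gcongr
          simp only [indicator, E, mem_ofPred_eq]
          exact le_rfl
      _ = (ENNReal.ofReal s * (F s * ENNReal.ofReal (s ^ n))) *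
          volume (E ∩ Ioo (-Real.pi) Real.pi) := by
          rw [lintegral_const_mul _ (measurable_one.indicator hE), lintegral_indicator_one hE,
            Measure.restrict_apply hE]
      _ ≤ (ENNReal.ofReal s * (F s * ENNReal.ofReal (s ^ n))) *
          ENNReal.ofReal (12 * Real.pi * A / s) := by
          gcongr
          refine (measure_mono ?_).trans (volume_arc_le hη hs h hA hAη)
          exact fun φ hφ => ⟨hφ.2, hφ.1⟩
      _ = _ := by
          rw [show ∀ a b c : ℝ≥0∞, a * b * c = a * c * b by intros; ring,
            ← ENNReal.ofReal_mul hs.le]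
          congr 2
          field_simp
  calc _ = _ := e1
    _ ≤ ∫⁻ p in Icc (η - A) (η + A) ×ˢ Ioo 0 Real.pi,
        ENNReal.ofReal ((2 / η) ^ (n + 1)) * (ENNReal.ofReal p.1 • f (polarCoord.symm p)) :=
        setLIntegral_mono' hmeas2 hlow
    _ ≤ ∫⁻ p in polarCoord.target,
        ENNReal.ofReal ((2 / η) ^ (n + 1)) * (ENNReal.ofReal p.1 • f (polarCoord.symm p)) :=
        lintegral_mono_set hsub
    _ = ENNReal.ofReal ((2 / η) ^ (n + 1)) * ∫⁻ p, f p := by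
        rw [lintegral_const_mul' _ _ ENNReal.ofReal_ne_top, lintegral_comp_polarCoord_symm]
    _ ≤ ENNReal.ofReal ((2 / η) ^ (n + 1)) * ∫⁻ s in Ioi 0,
        ENNReal.ofReal (12 * Real.pi * A) * (F s * ENNReal.ofReal (s ^ n)) := by
        rw [e2]
        refine mul_le_mul' le_rfl ?_
        exact setLIntegral_mono' measurableSet_Ioi e3
    _ = _ := by
        rw [lintegral_const_mul' _ _ ENNReal.ofReal_ne_top, ← mul_assoc,
          ← ENNReal.ofReal_mul (by positivity)]

end SphericalShell

/-! ### Expansion of the flux when the Laplacian is integrable on hypersurfaces -/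

namespace SphericalShell

variable {N : ℕ} {Q : ℝ → ℝ}

theorem enorm_angMean_sub_le {G H : ℝ → ℝ} (hG : Continuous G) (hH : Continuous H)
    {F : ℝ → ℝ≥0∞} (hF : ∀ b, 0 < b → ‖G b - H b‖ₑ ≤ F √b) {η : ℝ} (hη : 0 < η) (ρ : ℝ) :
    ‖angMean N G ρ η - angMean N H ρ η‖ₑ ≤
      ∫⁻ θ in Ioo 0 Real.pi, F (√(sqDist ρ η θ)) * ENNReal.ofReal (Real.sin θ ^ (N - 2)) := by
  have h1 : angMean N G ρ η - angMean N H ρ η = ∫ θ in Ioo 0 Real.pi,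
      (G (sqDist ρ η θ) - H (sqDist ρ η θ)) * Real.sin θ ^ (N - 2) := by
    rw [angMean, angMean, ← intervalIntegral.integral_sub,
      intervalIntegral.integral_of_le Real.pi_pos.le, integral_Ioc_eq_integral_Ioo]
    · simp only [sub_mul]
    · exact ((hG.comp (continuous_sqDist_angle ρ η)).mul (by fun_prop)).intervalIntegrable _ _
    · exact ((hH.comp (continuous_sqDist_angle ρ η)).mul (by fun_prop)).intervalIntegrable _ _
  rw [h1]
  refine (enorm_integral_le_lintegral_enorm _).trans
    (setLIntegral_mono' measurableSet_Ioo fun θ hθ => ?_)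
  rw [enorm_mul, Real.enorm_of_nonneg (pow_nonneg (Real.sin_pos_of_mem_Ioo hθ).le _)]
  gcongr
  exact hF _ (sqDist_pos hη hθ)

/-- The difference of two fluxes is Lipschitz at the diagonal, with a constant given by the
hypersurface integral of the difference of the divergences. -/
theorem enorm_flux_sub_le (hN : 2 ≤ N) {P Q : ℝ → ℝ} (hP : ContDiff ℝ 1 P) (hQ : ContDiff ℝ 1 Q)
    {F : ℝ → ℝ≥0∞} (hFm : Measurable F) {η r : ℝ} (hη : 0 < η) (hF0 : ∀ s, η / 2 < s → F s = 0)
    (hF : ∀ b, 0 < b → ‖divProfile N P b - divProfile N Q b‖ₑ ≤ F √b) (hr : |r - η| ≤ η / 2) :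
    ‖(flux N P r η - flux N Q r η) - (flux N P η η - flux N Q η η)‖ₑ ≤
      ENNReal.ofReal (3 ^ (N - 1) * (12 * Real.pi) * |r - η|) *
        ∫⁻ s in Ioi 0, F s * ENNReal.ofReal (s ^ (N - 2)) := by
  set A := |r - η| with hA
  have hA0 : 0 ≤ A := abs_nonneg _
  have hcP := continuous_divProfile (N := N) hP
  have hcQ := continuous_divProfile (N := N) hQ
  have h1 : (flux N P r η - flux N Q r η) - (flux N P η η - flux N Q η η) =
      -∫ ρ in η..r, ρ ^ (N - 1) *
        (angMean N (divProfile N P) ρ η - angMean N (divProfile N Q) ρ η) := by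
    have e1 := flux_sub_flux hN hP r η η
    have e2 := flux_sub_flux hN hQ r η η
    simp only [mul_sub]
    rw [intervalIntegral.integral_sub
      ((continuous_pow_mul_angMean hcP η).intervalIntegrable _ _)
      ((continuous_pow_mul_angMean hcQ η).intervalIntegrable _ _)]
    linarith
  have hsub : uIoc η r ⊆ Icc (η - A) (η + A) := by
    intro ρ hρ
    rcases mem_uIoc.1 hρ with h | h
    · have : A = r - η := abs_of_nonneg (by linarith [h.1, h.2])
      exact ⟨by linarith [h.1], by linarith [h.2]⟩
    · have : A = -(r - η) := abs_of_nonpos (by linarith [h.1, h.2])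
      exact ⟨by linarith [h.1], by linarith [h.2]⟩
  have h2 : ‖∫ ρ in η..r, ρ ^ (N - 1) *
        (angMean N (divProfile N P) ρ η - angMean N (divProfile N Q) ρ η)‖ₑ =
      ‖∫ ρ in uIoc η r, ρ ^ (N - 1) *
        (angMean N (divProfile N P) ρ η - angMean N (divProfile N Q) ρ η)‖ₑ := by
    rw [← ofReal_norm, ← ofReal_norm, intervalIntegral.norm_intervalIntegral_eq]
  rw [h1, enorm_neg, h2]
  calc ‖∫ ρ in uIoc η r, ρ ^ (N - 1) *
        (angMean N (divProfile N P) ρ η - angMean N (divProfile N Q) ρ η)‖ₑ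
      ≤ ∫⁻ ρ in uIoc η r, ‖ρ ^ (N - 1) *
        (angMean N (divProfile N P) ρ η - angMean N (divProfile N Q) ρ η)‖ₑ :=
        enorm_integral_le_lintegral_enorm _
    _ ≤ ∫⁻ ρ in Icc (η - A) (η + A), ‖ρ ^ (N - 1) *
        (angMean N (divProfile N P) ρ η - angMean N (divProfile N Q) ρ η)‖ₑ :=
        lintegral_mono_set hsub
    _ ≤ ∫⁻ ρ in Icc (η - A) (η + A), ENNReal.ofReal ((3 * η / 2) ^ (N - 1)) *
        ∫⁻ θ in Ioo 0 Real.pi, F (√(sqDist ρ η θ)) * ENNReal.ofReal (Real.sin θ ^ (N - 2)) := by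
        refine setLIntegral_mono' measurableSet_Icc fun ρ hρ => ?_
        have hρ0 : 0 ≤ ρ := by linarith [hρ.1]
        rw [enorm_mul, Real.enorm_of_nonneg (by positivity)]
        refine mul_le_mul' (ENNReal.ofReal_le_ofReal ?_) (enorm_angMean_sub_le hcP hcQ hF hη ρ)
        exact pow_le_pow_left₀ hρ0 (by linarith [hρ.2]) _
    _ ≤ ENNReal.ofReal ((3 * η / 2) ^ (N - 1)) *
        (ENNReal.ofReal ((2 / η) ^ (N - 2 + 1) * (12 * Real.pi * A)) *
          ∫⁻ s in Ioi 0, F s * ENNReal.ofReal (s ^ (N - 2))) := by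
        rw [lintegral_const_mul' _ _ ENNReal.ofReal_ne_top]
        exact mul_le_mul' le_rfl (lintegral_annulus_le (N - 2) hFm hη hF0 hA0 hr)
    _ = _ := by
        rw [← mul_assoc, ← ENNReal.ofReal_mul (by positivity)]
        congr 2
        rw [show N - 2 + 1 = N - 1 by omega, ← mul_assoc, ← mul_pow,
          show 3 * η / 2 * (2 / η) = 3 by field_simp]
        ring

/-- If the divergence and `Q` are integrable on hypersurfaces, then the flux differs from the fluxes
of the truncations by functions with small Lipschitz constants at the diagonal. -/
theorem exists_abs_flux_sub_trunc_le (hN : 2 ≤ N) (hQ : ContDiffOn ℝ 1 Q (Ioi 0))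
    (hQm : Measurable Q)
    (hint : IntegrableOn (fun s => s * Q (s ^ 2) * s ^ (N - 2)) (Ioo 0 1))
    (hintQ : IntegrableOn (fun s => Q (s ^ 2) * s ^ (N - 2)) (Ioo 0 1))
    (hintG : IntegrableOn (fun s => divProfile N Q (s ^ 2) * s ^ (N - 2)) (Ioo 0 1))
    {R κ : ℝ} (hR : 0 < R) (hκ : 0 < κ) :
    ∃ n : ℕ, 0 < n ∧ ∀ η, R / 2 ≤ η → ∀ r, |r - η| ≤ R / 4 →
      |(flux N Q r η - flux N (trunc Q n) r η) - (flux N Q η η - flux N (trunc Q n) η η)| ≤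
        κ * |r - η| := by
  obtain ⟨C, hC0, hC⟩ := exists_abs_divProfile_trunc_le N
  have hGm : Measurable (divProfile N Q) := by
    have := measurable_deriv Q
    unfold divProfile; fun_prop
  -- Two truncation levels are compared, each with divergence at most |div| + C |Q|; this is the
  -- factor 2.
  let h : ℝ → ℝ := fun s => 2 * (|divProfile N Q (s ^ 2)| + C * |Q (s ^ 2)|)
  have hm : Measurable h :=
    (((hGm.comp (measurable_id.pow_const 2)).abs).add
      ((hQm.comp (measurable_id.pow_const 2)).abs.const_mul C)).const_mul 2
  have hh0 : ∀ s, 0 ≤ h s := fun s => by positivity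
  let F : ℕ → ℝ → ℝ≥0∞ := fun n => {s : ℝ | 0 < s ∧ n * s ^ 2 ≤ 2}.indicator
    fun s => ENNReal.ofReal (h s)
  have hset : ∀ n : ℕ, MeasurableSet {s : ℝ | 0 < s ∧ n * s ^ 2 ≤ 2} := fun n =>
    (measurableSet_lt measurable_const measurable_id).inter
      (measurableSet_le (f := fun s : ℝ => n * s ^ 2) (by fun_prop) measurable_const)
  have hFm : ∀ n, Measurable (F n) := fun n => hm.ennreal_ofReal.indicator (hset n)
  have hhint : IntegrableOn (fun s => h s * s ^ (N - 2)) (Ioo 0 1) := by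
    refine IntegrableOn.congr_fun ((hintG.abs.add (hintQ.abs.const_mul C)).const_mul 2)
      (fun s hs => ?_) measurableSet_Ioo
    have : 0 ≤ s ^ (N - 2) := pow_nonneg hs.1.le _
    simp only [h, Pi.add_apply, abs_mul, abs_of_nonneg this]
    ring
  -- The majorant is one fixed integrable function restricted to s ≤ √(2/n), so absolute continuity
  -- of the integral applies.
  have hτ : Tendsto (fun n : ℕ => ∫⁻ s in Ioi 0, F n s * ENNReal.ofReal (s ^ (N - 2))) atTop (𝓝 0) := by
    have hfin : ∫⁻ s in Ioo 0 1, ‖h s * s ^ (N - 2)‖ₑ ≠ ⊤ := hhint.2.ne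
    have hsm : Tendsto (fun n : ℕ => (volume.restrict (Ioo (0 : ℝ) 1)) {s : ℝ | 0 < s ∧ n * s ^ 2 ≤ 2})
        atTop (𝓝 0) := by
      have hle : ∀ n : ℕ, 0 < n → (volume.restrict (Ioo (0 : ℝ) 1)) {s : ℝ | 0 < s ∧ n * s ^ 2 ≤ 2} ≤
          ENNReal.ofReal √(2 / n) := by
        intro n hn
        have hn' : (0 : ℝ) < n := Nat.cast_pos.2 hn
        refine (Measure.restrict_apply_le _ _).trans ?_
        refine (measure_mono (t := Icc 0 √(2 / n)) fun s hs => ⟨hs.1.le, ?_⟩).trans_eq (by simp)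
        refine Real.le_sqrt_of_sq_le ?_
        rw [le_div_iff₀ hn', mul_comm]
        exact hs.2
      have hlim : Tendsto (fun n : ℕ => ENNReal.ofReal √(2 / n)) atTop (𝓝 0) := by
        have h1 : Tendsto (fun n : ℕ => √((2 : ℝ) / n)) atTop (𝓝 √0) :=
          (tendsto_const_div_atTop_nhds_zero_nat 2).sqrt
        simpa using ENNReal.tendsto_ofReal h1
      exact tendsto_of_tendsto_of_tendsto_of_le_of_le' tendsto_const_nhds hlim
        (Eventually.of_forall fun _ => zero_le) ((eventually_gt_atTop 0).mono hle)
    refine (tendsto_setLIntegral_zero hfin hsm).congr' ?_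
    filter_upwards [eventually_gt_atTop 2] with n hn
    have hn' : (2 : ℝ) < n := by exact_mod_cast hn
    have hsub : {s : ℝ | 0 < s ∧ n * s ^ 2 ≤ 2} ⊆ Ioo 0 1 := by
      rintro s ⟨hs, hs2⟩
      refine ⟨hs, ?_⟩
      by_contra h1
      have : 1 ≤ s ^ 2 := one_le_pow₀ (not_lt.1 h1)
      nlinarith
    have hsub2 : {s : ℝ | 0 < s ∧ n * s ^ 2 ≤ 2} ⊆ Ioi 0 := fun s hs => hs.1
    rw [Measure.restrict_restrict (hset n), inter_eq_left.2 hsub]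
    have : ∀ s, F n s * ENNReal.ofReal (s ^ (N - 2)) = {s : ℝ | 0 < s ∧ n * s ^ 2 ≤ 2}.indicator
        (fun s => ‖h s * s ^ (N - 2)‖ₑ) s := by
      intro s
      by_cases hs : s ∈ {s : ℝ | 0 < s ∧ n * s ^ 2 ≤ 2}
      · have h1 : 0 ≤ s ^ (N - 2) := pow_nonneg hs.1.le _
        simp only [F, indicator_of_mem hs]
        rw [Real.enorm_of_nonneg (mul_nonneg (hh0 s) h1), ENNReal.ofReal_mul (hh0 s)]
      · simp only [F, indicator_of_notMem hs, zero_mul]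
    simp only [this]
    rw [setLIntegral_indicator (hset n), inter_eq_left.2 hsub2]
  have hconst : 0 < κ / (3 ^ (N - 1) * (12 * Real.pi)) := by have := Real.pi_pos; positivity
  have hev1 := hτ.eventually (gt_mem_nhds (ENNReal.ofReal_pos.2 hconst))
  -- With n R² > 32 the radius √(2/n) is below R/4 ≤ η/2, as the annulus estimate demands.
  have hev2 := (tendsto_natCast_mul_atTop (by positivity : 0 < R ^ 2)).eventually_gt_atTop 32
  obtain ⟨n, hn1, hn2, hn0⟩ := (hev1.and (hev2.and (eventually_gt_atTop 0))).exists
  refine ⟨n, hn0, fun η hη r hr => ?_⟩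
  have hη0 : 0 < η := by linarith
  have hr0 : 0 < r := by linarith [(abs_le.1 hr).1]
  have hF0 : ∀ s, η / 2 < s → F n s = 0 := by
    intro s hs
    refine indicator_of_notMem ?_ _
    rintro ⟨-, h2⟩
    have h3 : (R / 4) ^ 2 ≤ s ^ 2 := pow_le_pow_left₀ (by positivity) (by linarith) 2
    have h4 := mul_le_mul_of_nonneg_left h3 (Nat.cast_nonneg (α := ℝ) n)
    nlinarith
  have hbd : ∀ m, n ≤ m → ∀ b, 0 < b →
      ‖divProfile N (trunc Q m) b - divProfile N (trunc Q n) b‖ₑ ≤ F n √b := by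
    intro m hm b hb
    by_cases h2 : 2 < n * b
    · have h3 : 2 < m * b := h2.trans_le (by gcongr)
      rw [divProfile_trunc_of_two_lt hQ h2, divProfile_trunc_of_two_lt hQ h3]
      simp
    · have hmem : √b ∈ {s : ℝ | 0 < s ∧ n * s ^ 2 ≤ 2} :=
        ⟨Real.sqrt_pos.2 hb, by rw [Real.sq_sqrt hb.le]; exact not_lt.1 h2⟩
      simp only [F, indicator_of_mem hmem, h, Real.sq_sqrt hb.le]
      rw [← ofReal_norm, Real.norm_eq_abs]
      refine ENNReal.ofReal_le_ofReal ((abs_sub _ _).trans ?_)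
      linarith [hC Q hQ m b hb, hC Q hQ n b hb]
  -- The Lipschitz estimate is available only for C^1 profiles; it is applied to the levels m ≥ n,
  -- with a constant independent of `m`, and then `m` tends to infinity.
  have hlim : Tendsto (fun m => |(flux N (trunc Q m) r η - flux N (trunc Q n) r η) -
      (flux N (trunc Q m) η η - flux N (trunc Q n) η η)|) atTop
      (𝓝 |(flux N Q r η - flux N (trunc Q n) r η) - (flux N Q η η - flux N (trunc Q n) η η)|) :=
    (((tendsto_flux_trunc hQ hint hr0 hη0).sub_const _).sub
      ((tendsto_flux_trunc hQ hint hη0 hη0).sub_const _)).abs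
  refine le_of_tendsto hlim ?_
  filter_upwards [eventually_ge_atTop n] with m hm
  have h1 := enorm_flux_sub_le hN (contDiff_trunc hQ (hn0.trans_le hm)) (contDiff_trunc hQ hn0)
    (hFm n) hη0 hF0 (hbd m hm) (hr.trans (by linarith))
  have h2 := h1.trans (mul_le_mul' le_rfl hn1.le)
  rw [← ENNReal.ofReal_mul (by have := Real.pi_pos; positivity), ← ofReal_norm, Real.norm_eq_abs,
    ENNReal.ofReal_le_ofReal_iff (by have := Real.pi_pos; positivity)] at h2
  refine h2.trans_eq ?_
  have := Real.pi_pos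
  field_simp

/-- Expansion when the divergence is integrable on hypersurfaces and the flux has a positive
derivative. -/
theorem fluxExpanding_of_integrable (hN : 2 ≤ N) (hQ : ContDiffOn ℝ 1 Q (Ioi 0))
    (hQm : Measurable Q)
    (hint : IntegrableOn (fun s => s * Q (s ^ 2) * s ^ (N - 2)) (Ioo 0 1))
    (hintQ : IntegrableOn (fun s => Q (s ^ 2) * s ^ (N - 2)) (Ioo 0 1))
    (hintG : IntegrableOn (fun s => divProfile N Q (s ^ 2) * s ^ (N - 2)) (Ioo 0 1))
    {R D : ℝ} (hR : 0 < R) (hD : 0 < D) (hder : HasDerivAt (fun r => flux N Q r R) D R) :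
    FluxExpanding N Q R := by
  refine ⟨D / 2, by positivity, fun κ hκ => ?_⟩
  -- The remainder constant must be at most κ for the final error, and at most D/4 so that the
  -- truncated flux keeps most of the derivative `D`.
  obtain ⟨n, hn, hlip⟩ := exists_abs_flux_sub_trunc_le hN hQ hQm hint hintQ hintG hR
    (lt_min hκ (by positivity : 0 < D / 4))
  have hT : ContDiff ℝ 1 (trunc Q n) := contDiff_trunc hQ hn
  have hdc := continuous_divProfile (N := N) hT
  set g : ℝ → ℝ → ℝ := fun r η => -(r ^ (N - 1) * angMean N (divProfile N (trunc Q n)) r η) with hg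
  have hgc : Continuous fun p : ℝ × ℝ => g p.1 p.2 := by
    have := continuous_angMean (N := N) hdc
    simp only [hg]; fun_prop
  -- At `R` the remainder has derivative D - g(R,R), and its increments are at most D/4 times |r -
  -- R|.
  have hDn : D - D / 4 ≤ g R R := by
    have h1 : HasDerivAt (fun r => flux N Q r R - flux N (trunc Q n) r R) (D - g R R) R :=
      hder.sub (hasDerivAt_flux hN hT R R)
    have h2 := h1.le_of_lip' (C := D / 4) (by positivity) (by
      filter_upwards [Metric.closedBall_mem_nhds R (by positivity : 0 < R / 4)] with r hr
      rw [Metric.mem_closedBall, Real.dist_eq] at hr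
      refine (hlip R (by linarith) r hr).trans ?_
      rw [Real.norm_eq_abs]
      gcongr
      exact min_le_right _ _)
    rw [Real.norm_eq_abs] at h2
    linarith [(abs_le.1 h2).2]
  have hnhds : ∀ᶠ p : ℝ × ℝ in 𝓝 (R, R), D / 2 < g p.1 p.2 :=
    (hgc.tendsto (R, R)).eventually (lt_mem_nhds (by linarith))
  obtain ⟨ε₀, hε₀, hball⟩ := Metric.nhds_basis_closedBall.eventually_iff.1 hnhds
  refine ⟨min ε₀ (R / 8), by positivity, lt_of_le_of_lt (min_le_right _ _) (by linarith), ?_⟩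
  intro η hη r hr r' hr' hrr
  have hle1 := min_le_left ε₀ (R / 8)
  have hle2 := min_le_right ε₀ (R / 8)
  have hclose : ∀ x ∈ Icc (R - min ε₀ (R / 8)) (R + min ε₀ (R / 8)), |x - η| ≤ R / 4 :=
    fun x hx => abs_le.2 ⟨by linarith [hx.1, hη.2], by linarith [hx.2, hη.1]⟩
  have hη2 : R / 2 ≤ η := by linarith [hη.1]
  have h1 : D / 2 * (r - r') ≤ flux N (trunc Q n) r η - flux N (trunc Q n) r' η := by
    rw [flux_sub_flux hN hT, ← intervalIntegral.integral_neg]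
    have : ∫ ρ in r'..r, D / 2 = D / 2 * (r - r') := by simp; ring
    rw [← this]
    refine intervalIntegral.integral_mono_on hrr (by simp)
      ((continuous_pow_mul_angMean hdc η).neg.intervalIntegrable _ _) fun ρ hρ => ?_
    have hmem : (ρ, η) ∈ Metric.closedBall (R, R) ε₀ := by
      rw [Metric.mem_closedBall, Prod.dist_eq]
      refine max_le ?_ ?_ <;> simp only [Real.dist_eq, abs_le]
      · exact ⟨by linarith [hρ.1, hr'.1], by linarith [hρ.2, hr.2]⟩
      · exact ⟨by linarith [hη.1], by linarith [hη.2]⟩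
    have h := hball hmem
    simp only [hg] at h
    exact h.le
  have h2 := (hlip η hη2 r (hclose r hr)).trans
    (mul_le_mul_of_nonneg_right (min_le_left κ (D / 4)) (abs_nonneg _))
  have h3 := (hlip η hη2 r' (hclose r' hr')).trans
    (mul_le_mul_of_nonneg_right (min_le_left κ (D / 4)) (abs_nonneg _))
  linarith [(abs_le.1 h2).1, (abs_le.1 h3).2]

end SphericalShell

/-! ### From the radial potential to the flux -/

namespace SphericalShell

/-- The function `Q` such that `∇W(x) = Q(|x|²) x` for the radial potential `W` with profile `k`. -/
noncomputable def forceProfile (k : ℝ → ℝ) (b : ℝ) : ℝ := deriv k √b / √b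

variable {N : ℕ} {W : Space N → ℝ} {k : ℝ → ℝ}

theorem measurable_forceProfile (k : ℝ → ℝ) : Measurable (forceProfile k) := by
  have := measurable_deriv k
  unfold forceProfile
  fun_prop

theorem mul_forceProfile_sq {s : ℝ} (hs : 0 < s) : s * forceProfile k (s ^ 2) = deriv k s := by
  rw [forceProfile, Real.sqrt_sq hs.le]
  field_simp

theorem norm_e₁ [NeZero N] : ‖e₁ N‖ = 1 := by simp [e₁]

theorem contDiffOn_profile [NeZero N] (hWk : ∀ x, x ≠ 0 → W x = k ‖x‖) (hW : ContDiffOn ℝ 3 W {0}ᶜ) :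
    ContDiffOn ℝ 3 k (Ioi 0) := by
  have h1 : ContDiffOn ℝ 3 (fun s : ℝ => W (s • e₁ N)) (Ioi 0) := by
    refine hW.comp (t := {0}ᶜ) (by fun_prop) fun s hs => ?_
    have : e₁ N ≠ 0 := by rw [← norm_ne_zero_iff, norm_e₁]; norm_num
    exact smul_ne_zero (ne_of_gt hs) this
  refine h1.congr fun s hs => ?_
  have hs : 0 < s := hs
  have : e₁ N ≠ 0 := by rw [← norm_ne_zero_iff, norm_e₁]; norm_num
  rw [hWk _ (smul_ne_zero hs.ne' this), norm_smul, norm_e₁, Real.norm_eq_abs, abs_of_pos hs, mul_one]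

theorem contDiffOn_deriv_profile (hk : ContDiffOn ℝ 3 k (Ioi 0)) :
    ContDiffOn ℝ 2 (deriv k) (Ioi 0) :=
  hk.deriv_of_isOpen isOpen_Ioi (by norm_num)

theorem contDiffOn_forceProfile (hk : ContDiffOn ℝ 3 k (Ioi 0)) :
    ContDiffOn ℝ 1 (forceProfile k) (Ioi 0) := by
  have hs : ContDiffOn ℝ 1 (fun b : ℝ => √b) (Ioi 0) :=
    contDiffOn_id.sqrt fun b hb => ne_of_gt hb
  have h1 : ContDiffOn ℝ 1 (fun b : ℝ => deriv k √b) (Ioi 0) :=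
    ((contDiffOn_deriv_profile hk).of_le (by norm_num)).comp hs fun b hb => Real.sqrt_pos.2 hb
  exact h1.div hs fun b hb => (Real.sqrt_pos.2 hb).ne'

theorem hasFDerivAt_radial (hWk : ∀ x, x ≠ 0 → W x = k ‖x‖) (hk : ContDiffOn ℝ 3 k (Ioi 0))
    {x : Space N} (hx : x ≠ 0) :
    HasFDerivAt W (forceProfile k (‖x‖ ^ 2) • innerSL ℝ x) x := by
  have hn : 0 < ‖x‖ := norm_pos_iff.2 hx
  have h1 : HasDerivAt k (deriv k ‖x‖) √(‖x‖ ^ 2) := by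
    rw [Real.sqrt_sq hn.le]
    exact ((hk.contDiffAt (Ioi_mem_nhds hn)).differentiableAt (by norm_num)).hasDerivAt
  have h2 := h1.comp (‖x‖ ^ 2) (Real.hasDerivAt_sqrt (by positivity))
  have h3 := h2.comp_hasFDerivAt x (hasStrictFDerivAt_norm_sq x).hasFDerivAt
  have h4 : W =ᶠ[𝓝 x] ((k ∘ fun b => √b) ∘ fun x : Space N => ‖x‖ ^ 2) := by
    filter_upwards [isOpen_ne.mem_nhds hx] with y hy
    simp [hWk y hy, Real.sqrt_sq]
  refine (h3.congr_of_eventuallyEq h4).congr_fderiv ?_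
  ext v
  simp [forceProfile, Real.sqrt_sq hn.le]
  field_simp

theorem gradient_radial (hWk : ∀ x, x ≠ 0 → W x = k ‖x‖) (hk : ContDiffOn ℝ 3 k (Ioi 0))
    {x : Space N} (hx : x ≠ 0) : ∇ W x = forceProfile k (‖x‖ ^ 2) • x := by
  refine HasGradientAt.gradient ?_
  rw [hasGradientAt_iff_hasFDerivAt]
  refine (hasFDerivAt_radial hWk hk hx).congr_fderiv ?_
  ext v
  simp

theorem laplacian_radial (hWk : ∀ x, x ≠ 0 → W x = k ‖x‖) (hk : ContDiffOn ℝ 3 k (Ioi 0))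
    {x : Space N} (hx : x ≠ 0) : (Δ W) x = divProfile N (forceProfile k) (‖x‖ ^ 2) := by
  set Q := forceProfile k with hQdef
  have hn : 0 < ‖x‖ := norm_pos_iff.2 hx
  have hQ := contDiffOn_forceProfile hk
  have h1 : HasDerivAt Q (deriv Q (‖x‖ ^ 2)) (‖x‖ ^ 2) :=
    ((hQ.contDiffAt (Ioi_mem_nhds (by positivity))).differentiableAt one_ne_zero).hasDerivAt
  have h2 : HasFDerivAt (fun x : Space N => Q (‖x‖ ^ 2)) _ x :=
    HasDerivAt.comp_hasFDerivAt (h₂ := Q) (f := fun x : Space N => ‖x‖ ^ 2) x h1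
      (hasStrictFDerivAt_norm_sq x).hasFDerivAt
  have h3 := h2.smul (innerSL ℝ (E := Space N)).hasFDerivAt
  have h4 : fderiv ℝ W =ᶠ[𝓝 x] fun x => Q (‖x‖ ^ 2) • innerSL ℝ x := by
    filter_upwards [isOpen_ne.mem_nhds hx] with y hy
    exact (hasFDerivAt_radial hWk hk hy).fderiv
  rw [InnerProductSpace.laplacian_eq_iteratedFDeriv_orthonormalBasis W (EuclideanSpace.basisFun (Fin N) ℝ)]
  simp only [iteratedFDeriv_two_apply]
  have h5 : ∀ v : Space N, fderiv ℝ (fderiv ℝ W) x v v =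
      2 * deriv Q (‖x‖ ^ 2) * inner ℝ x v ^ 2 + Q (‖x‖ ^ 2) * ‖v‖ ^ 2 := by
    intro v
    rw [h4.fderiv_eq, HasFDerivAt.fderiv (f := fun x => Q (‖x‖ ^ 2) • innerSL ℝ x) h3]
    change Q (‖x‖ ^ 2) * inner ℝ v v + deriv Q (‖x‖ ^ 2) * (2 • inner ℝ x v) * inner ℝ x v = _
    rw [real_inner_self_eq_norm_sq, two_smul]
    ring
  have h6 : ∀ i, inner ℝ x (EuclideanSpace.basisFun (Fin N) ℝ i) = x i := fun i => by
    simp [EuclideanSpace.inner_single_right]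
  simp only [Matrix.cons_val_zero, Matrix.cons_val_one, h5, divProfile, h6,
    OrthonormalBasis.norm_eq_one, Finset.sum_add_distrib, ← Finset.mul_sum]
  rw [EuclideanSpace.real_norm_sq_eq]
  simp
  ring

/-- The point y = e₁ is the only one at which r e₁ - η y can vanish for r > 0 and η ≥ 0, and the
profile gives no information on the gradient at the origin. -/
theorem surf_zero_eq_one_null (n : ℕ) :
    ∀ᵐ y : Metric.sphere (0 : Space (n + 2)) 1 ∂surf (n + 2), (y : Space (n + 2)) 0 ≠ 1 := by
  obtain ⟨C, -, -, hC⟩ := exists_lintegral_surf_eq n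
  have h1 := hC (({1} : Set ℝ).indicator 1) (measurable_one.indicator (measurableSet_singleton 1))
  have h2 : ∫⁻ θ in Ioo 0 Real.pi, ENNReal.ofReal (Real.sin θ ^ n) *
      ({1} : Set ℝ).indicator 1 (Real.cos θ) = 0 := by
    rw [setLIntegral_congr_fun (g := fun _ => 0) measurableSet_Ioo]
    · simp
    · intro θ hθ
      have : Real.cos θ ≠ 1 := by
        have := Real.strictAntiOn_cos ⟨le_rfl, Real.pi_pos.le⟩ ⟨hθ.1.le, hθ.2.le⟩ hθ.1
        rw [Real.cos_zero] at this
        exact this.ne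
      simp [this]
  rw [h2, mul_zero, lintegral_eq_zero_iff] at h1
  · filter_upwards [h1] with y hy hy1
    simp [hy1] at hy
  · exact (measurable_one.indicator (measurableSet_singleton 1)).comp (by fun_prop)

theorem area_pos (n : ℕ) : 0 < area (n + 2) := by
  rw [area, surf, measureReal_def, ENNReal.toReal_pos_iff]
  refine ⟨pos_iff_ne_zero.2 ?_, measure_lt_top _ _⟩
  exact Measure.measure_univ_ne_zero.2 (Measure.toSphere_ne_zero _)

/-- The radial velocity kernel is a positive multiple of the flux, divided by `r^{N-1}`. -/
theorem exists_omega_eq_flux [NeZero N] (hN : 2 ≤ N) (hWk : ∀ x, x ≠ 0 → W x = k ‖x‖)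
    (hk : ContDiffOn ℝ 3 k (Ioi 0)) : ∃ A : ℝ, 0 < A ∧ ∀ r, 0 < r → ∀ η, 0 ≤ η →
      r ^ (N - 1) * omega W r η = A * flux N (forceProfile k) r η := by
  obtain ⟨n, rfl⟩ : ∃ n, N = n + 2 := ⟨N - 2, by omega⟩
  obtain ⟨C, hC0, hC⟩ := exists_integral_surf_eq n
  refine ⟨C / area (n + 2), div_pos hC0 (area_pos n), fun r hr η hη => ?_⟩
  set Q := forceProfile k with hQdef
  have hQm : Measurable Q := measurable_forceProfile k
  have h1 : ∫ y : Metric.sphere (0 : Space (n + 2)) 1,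
      inner ℝ (∇ W (r • e₁ (n + 2) - η • (y : Space (n + 2)))) (e₁ (n + 2)) ∂(surf (n + 2)) =
      ∫ y, (fun u => Q (r ^ 2 + η ^ 2 - 2 * r * η * u) * (r - η * u)) ((y : Space (n + 2)) 0)
        ∂(surf (n + 2)) := by
    refine integral_congr_ae ?_
    filter_upwards [surf_zero_eq_one_null n] with y hy
    have hy1 : ‖(y : Space (n + 2))‖ = 1 := by simp
    have he : inner ℝ (y : Space (n + 2)) (e₁ (n + 2)) = (y : Space (n + 2)) 0 := by
      simp [e₁, EuclideanSpace.inner_single_right]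
    have he' : inner ℝ (e₁ (n + 2)) (y : Space (n + 2)) = (y : Space (n + 2)) 0 := by
      rw [real_inner_comm, he]
    have hee : inner ℝ (e₁ (n + 2)) (e₁ (n + 2)) = (1 : ℝ) := by
      rw [real_inner_self_eq_norm_sq, norm_e₁, one_pow]
    have hnorm : ‖r • e₁ (n + 2) - η • (y : Space (n + 2))‖ ^ 2 =
        r ^ 2 + η ^ 2 - 2 * r * η * (y : Space (n + 2)) 0 := by
      rw [norm_sub_sq_real, norm_smul, norm_smul, hy1, norm_e₁, inner_smul_left, inner_smul_right,
        he']
      simp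
      ring
    have hx : r • e₁ (n + 2) - η • (y : Space (n + 2)) ≠ 0 := by
      intro h
      apply hy
      have h2 : r • e₁ (n + 2) = η • (y : Space (n + 2)) := sub_eq_zero.1 h
      have h3 : r = η := by
        have := congrArg norm h2
        rwa [norm_smul, norm_smul, hy1, norm_e₁, mul_one, mul_one, Real.norm_of_nonneg hr.le,
          Real.norm_of_nonneg hη] at this
      have h4 := congrArg (fun z => inner ℝ z (e₁ (n + 2))) h2
      simp only [inner_smul_left, he, hee, ← h3] at h4
      have h5 : r * 1 = r * (y : Space (n + 2)) 0 := h4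
      exact (mul_left_cancel₀ hr.ne' h5).symm
    rw [gradient_radial hWk hk hx, hnorm, inner_smul_left, inner_sub_left, inner_smul_left,
      inner_smul_left, he, hee]
    simp [hQdef]
  have h2 := h1.trans (hC (fun u => Q (r ^ 2 + η ^ 2 - 2 * r * η * u) * (r - η * u)) (by fun_prop))
  rw [omega, h2, flux]
  simp only [show n + 2 - 1 = n + 1 by omega, show n + 2 - 2 = n by omega, sqDist, mul_assoc,
    intervalIntegral.integral_const_mul]
  field_simp

/-- Integrability of the force on hypersurfaces in terms of `Q`. -/
theorem integrableOn_forceProfile (hk' : LocIntHypersurface N (deriv k)) :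
    IntegrableOn (fun s => s * forceProfile k (s ^ 2) * s ^ (N - 2)) (Ioo 0 1) :=
  IntegrableOn.congr_fun hk' (fun s hs => by simp only [mul_forceProfile_sq hs.1]) measurableSet_Ioo

theorem deriv_deriv_profile (hk : ContDiffOn ℝ 3 k (Ioi 0)) {s : ℝ} (hs : 0 < s) :
    divProfile N (forceProfile k) (s ^ 2) =
      deriv (deriv k) s + (N - 1) * forceProfile k (s ^ 2) := by
  set Q := forceProfile k with hQdef
  have h1 : HasDerivAt Q (deriv Q (s ^ 2)) (s ^ 2) :=
    (((contDiffOn_forceProfile hk).contDiffAt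
      (Ioi_mem_nhds (by positivity))).differentiableAt one_ne_zero).hasDerivAt
  have h2 : HasDerivAt (fun s => Q (s ^ 2)) _ s :=
    HasDerivAt.comp (h₂ := Q) (h := fun s => s ^ 2) s h1 (hasDerivAt_pow 2 s)
  have h3 := (hasDerivAt_id s).mul h2
  have h4 : deriv k =ᶠ[𝓝 s] (id * fun s => Q (s ^ 2)) := by
    filter_upwards [Ioi_mem_nhds hs] with x hx
    exact (mul_forceProfile_sq hx).symm
  rw [h4.deriv_eq, h3.deriv, divProfile]
  simp
  ring

/-- Under either alternative, the flux expands near the sphere of radius `R`. -/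
theorem fluxExpanding_of_alternative [NeZero N] (hN : 2 ≤ N) (hWk : ∀ x, x ≠ 0 → W x = k ‖x‖)
    (hk : ContDiffOn ℝ 3 k (Ioi 0)) (hk' : LocIntHypersurface N (deriv k)) {R : ℝ} (hR : 0 < R)
    (hC0 : omega W R R = 0)
    (h : (LocIntHypersurface N (deriv (deriv k)) ∧
        LocIntHypersurface N (fun r => r⁻¹ * deriv k r) ∧
        0 < deriv (fun r => omega W r R) R) ∨
      ((∀ᶠ x in 𝓝[≠] (0 : Space N), (Δ W) x < 0) ∧
        ¬ LocIntHypersurface N (fun r => (Δ W) (r • e₁ N)))) :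
    FluxExpanding N (forceProfile k) R := by
  have hQ := contDiffOn_forceProfile hk
  have hint := integrableOn_forceProfile hk'
  have he : e₁ N ≠ 0 := by rw [← norm_ne_zero_iff, norm_e₁]; norm_num
  have hns : ∀ s : ℝ, 0 < s → ‖s • e₁ N‖ = s := fun s hs => by
    rw [norm_smul, norm_e₁, mul_one, Real.norm_of_nonneg hs.le]
  rcases h with ⟨h1, h2, h3⟩ | ⟨h1, h2⟩
  · have hintQ : IntegrableOn (fun s => forceProfile k (s ^ 2) * s ^ (N - 2)) (Ioo 0 1) :=
      IntegrableOn.congr_fun h2 (fun s hs => by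
        have := hs.1
        simp only [← mul_forceProfile_sq (k := k) hs.1]; field_simp) measurableSet_Ioo
    have hintG : IntegrableOn (fun s => divProfile N (forceProfile k) (s ^ 2) * s ^ (N - 2))
        (Ioo 0 1) :=
      IntegrableOn.congr_fun (Integrable.add h1 (hintQ.const_mul ((N : ℝ) - 1))) (fun s hs => by
        simp only [Pi.add_apply, deriv_deriv_profile hk hs.1]; ring) measurableSet_Ioo
    obtain ⟨A, hA, hAω⟩ := exists_omega_eq_flux hN hWk hk
    -- Differentiability is contained in the positivity assumption, since `deriv` is zero where
    -- there is no derivative.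
    have hd := (differentiableAt_of_deriv_ne_zero h3.ne').hasDerivAt
    have hd2 := ((hasDerivAt_pow (N - 1) R).mul hd).div_const A
    -- The term in which r^(N-1) is differentiated drops out because ω(R,R) = 0.
    have hd3 : HasDerivAt (fun r => flux N (forceProfile k) r R)
        (R ^ (N - 1) * deriv (fun r => omega W r R) R / A) R := by
      refine (hd2.congr_deriv ?_).congr_of_eventuallyEq ?_
      · rw [hC0]; ring
      · filter_upwards [Ioi_mem_nhds hR] with r hr
        simp only [Pi.mul_apply, hAω r hr R hR.le]
        field_simp
    exact fluxExpanding_of_integrable hN hQ (measurable_forceProfile k) hint hintQ hintG hR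
      (by positivity) hd3
  · rw [eventually_nhdsWithin_iff, Metric.eventually_nhds_iff] at h1
    obtain ⟨δ, hδ, h1⟩ := h1
    -- Profiles are functions of the squared distance, hence δ².
    refine fluxExpanding_of_not_integrable hN hQ hint (b₀ := δ ^ 2) (by positivity) ?_ ?_ hR
    · intro b hb
      have hb0 : 0 < √b := Real.sqrt_pos.2 hb.1
      have := h1 (y := √b • e₁ N) (by
        rw [dist_zero_right, hns _ hb0]; exact (Real.sqrt_lt' hδ).2 hb.2) (smul_ne_zero hb0.ne' he)
      rwa [laplacian_radial hWk hk (smul_ne_zero hb0.ne' he), hns _ hb0, Real.sq_sqrt hb.1.le] at this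
    · intro hcon
      exact h2 (IntegrableOn.congr_fun hcon (fun s hs => by
        simp only [laplacian_radial hWk hk (smul_ne_zero hs.1.ne' he), hns s hs.1]) measurableSet_Ioo)

end SphericalShell

/-! ### Smooth step functions and localization in time -/

namespace SphericalShell

/-- A smooth approximation of the indicator function of `(a, b]`. -/
noncomputable def stepFun (a b : ℝ) (n : ℕ) (t : ℝ) : ℝ :=
  Real.smoothTransition (n * (t - a)) - Real.smoothTransition (n * (t - b))

variable {a b : ℝ} {n : ℕ}

theorem contDiff_stepFun (a b : ℝ) (n : ℕ) : ContDiff ℝ ∞ (stepFun a b n) := by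
  have h : ∀ c : ℝ, ContDiff ℝ ∞ fun t : ℝ => Real.smoothTransition (n * (t - c)) := fun c =>
    Real.smoothTransition.contDiff.comp (by fun_prop)
  exact (h a).sub (h b)

theorem stepFun_nonneg (hab : a ≤ b) (t : ℝ) : 0 ≤ stepFun a b n t :=
  sub_nonneg.2 (Real.smoothTransition.monotone (by gcongr))

theorem stepFun_le_one (t : ℝ) : stepFun a b n t ≤ 1 := by
  have h1 := Real.smoothTransition.le_one (n * (t - a))
  have h2 := Real.smoothTransition.nonneg (n * (t - b))
  rw [stepFun]; linarith

theorem stepFun_of_le (hab : a ≤ b) {t : ℝ} (ht : t ≤ a) : stepFun a b n t = 0 := by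
  have hn : (0 : ℝ) ≤ n := Nat.cast_nonneg n
  rw [stepFun, Real.smoothTransition.zero_of_nonpos (by nlinarith),
    Real.smoothTransition.zero_of_nonpos (by nlinarith), sub_zero]

theorem stepFun_of_ge (hab : a ≤ b) (hn : 0 < n) {t : ℝ} (ht : b + 1 ≤ t) : stepFun a b n t = 0 := by
  have hn : (1 : ℝ) ≤ n := Nat.one_le_cast.2 hn
  rw [stepFun, Real.smoothTransition.one_of_one_le (by nlinarith),
    Real.smoothTransition.one_of_one_le (by nlinarith), sub_self]

theorem hasDerivAt_smoothTransition_scaled (a : ℝ) (n : ℕ) (t : ℝ) :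
    HasDerivAt (fun t : ℝ => Real.smoothTransition (n * (t - a)))
      (n * deriv Real.smoothTransition (n * (t - a))) t := by
  have h := (Real.smoothTransition.contDiff (n := 1)).differentiable one_ne_zero (n * (t - a))
  have h2 : HasDerivAt (fun t : ℝ => n * (t - a)) (n : ℝ) t := by
    simpa using ((hasDerivAt_id t).sub_const a).const_mul (n : ℝ)
  exact (h.hasDerivAt.comp t h2).congr_deriv (mul_comm _ _)

theorem deriv_stepFun (a b : ℝ) (n : ℕ) (t : ℝ) : deriv (stepFun a b n) t =
    n * deriv Real.smoothTransition (n * (t - a)) - n * deriv Real.smoothTransition (n * (t - b)) :=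
  ((hasDerivAt_smoothTransition_scaled a n t).sub (hasDerivAt_smoothTransition_scaled b n t)).deriv

theorem continuous_kernel (a : ℝ) (n : ℕ) :
    Continuous fun t : ℝ => n * deriv Real.smoothTransition (n * (t - a)) := by
  have := continuous_deriv_smoothTransition
  fun_prop

theorem kernel_eq_zero (hn : 0 < n) {t : ℝ} (ht : t ∉ Icc a (a + 1 / n)) :
    n * deriv Real.smoothTransition (n * (t - a)) = 0 := by
  have hn : (0 : ℝ) < n := Nat.cast_pos.2 hn
  rcases lt_or_ge t a with h | h
  · rw [deriv_smoothTransition_of_neg (by nlinarith), mul_zero]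
  · have h2 : a + 1 / n < t := by
      by_contra h2
      exact ht ⟨h, not_lt.1 h2⟩
    have h3 : 1 / n < t - a := by linarith
    rw [div_lt_iff₀ hn] at h3
    rw [deriv_smoothTransition_of_one_lt (by linarith), mul_zero]

theorem setIntegral_kernel (ha : 0 < a) (hn : 0 < n) (M : ℝ → ℝ) :
    ∫ t in Ioi 0, n * deriv Real.smoothTransition (n * (t - a)) * M t =
      ∫ t in a..(a + 1 / n), n * deriv Real.smoothTransition (n * (t - a)) * M t := by
  have hn' : (0 : ℝ) < n := Nat.cast_pos.2 hn
  have h1 : 0 < 1 / (n : ℝ) := by positivity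
  rw [intervalIntegral.integral_of_le (by linarith), ← integral_Icc_eq_integral_Ioc]
  refine setIntegral_eq_of_subset_of_forall_sdiff_eq_zero measurableSet_Ioi
    (fun t ht => ha.trans_le ht.1) fun t ht => ?_
  rw [kernel_eq_zero hn ht.2, zero_mul]

/-- The kernels are nonnegative, of mass one and carried by [a, a + 1/n]: an approximate identity at
`a`. -/
theorem tendsto_integral_kernel (ha : 0 < a) {M : ℝ → ℝ} (hM : ContinuousOn M (Ioi 0)) :
    Tendsto (fun n : ℕ => ∫ t in Ioi 0, n * deriv Real.smoothTransition (n * (t - a)) * M t) atTop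
      (𝓝 (M a)) := by
  rw [Metric.tendsto_atTop']
  intro ε hε
  have hMa : ContinuousAt M a := hM.continuousAt (Ioi_mem_nhds ha)
  obtain ⟨δ, hδ, hMδ⟩ := Metric.continuousAt_iff.1 hMa (ε / 2) (by positivity)
  obtain ⟨m, hm⟩ := exists_nat_one_div_lt hδ
  refine ⟨m + 1, fun n hn => ?_⟩
  have hn0 : 0 < n := by omega
  have hn' : (0 : ℝ) < n := Nat.cast_pos.2 hn0
  have h1 : 0 < 1 / (n : ℝ) := by positivity
  have h1n : 1 / (n : ℝ) < δ := by
    refine lt_trans ?_ hm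
    refine one_div_lt_one_div_of_lt (by positivity) ?_
    exact_mod_cast hn
  have hker := continuous_kernel a n
  have hone : ∫ t in a..(a + 1 / n), n * deriv Real.smoothTransition (n * (t - a)) = 1 := by
    rw [intervalIntegral.integral_eq_sub_of_hasDerivAt
      (fun t _ => hasDerivAt_smoothTransition_scaled a n t) (hker.intervalIntegrable _ _)]
    rw [show (n : ℝ) * (a + 1 / n - a) = 1 by field_simp; ring]
    simp
  have hMc : ContinuousOn M (uIcc a (a + 1 / n)) := by
    rw [uIcc_of_le (by linarith)]
    exact hM.mono fun t ht => ha.trans_le ht.1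
  rw [setIntegral_kernel ha hn0, dist_eq_norm]
  have h2 : (∫ t in a..(a + 1 / n), n * deriv Real.smoothTransition (n * (t - a)) * M t) - M a =
      ∫ t in a..(a + 1 / n), n * deriv Real.smoothTransition (n * (t - a)) * (M t - M a) := by
    have he : ∀ t, n * deriv Real.smoothTransition (n * (t - a)) * (M t - M a) =
        n * deriv Real.smoothTransition (n * (t - a)) * M t -
          n * deriv Real.smoothTransition (n * (t - a)) * M a := fun t => mul_sub _ _ _
    simp only [he]
    rw [intervalIntegral.integral_sub, intervalIntegral.integral_mul_const, hone, one_mul]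
    · exact (hker.continuousOn.mul hMc).intervalIntegrable
    · exact (hker.mul continuous_const).intervalIntegrable _ _
  rw [h2]
  calc ‖∫ t in a..(a + 1 / n), n * deriv Real.smoothTransition (n * (t - a)) * (M t - M a)‖
      ≤ ∫ t in a..(a + 1 / n), n * deriv Real.smoothTransition (n * (t - a)) * (ε / 2) := by
        refine intervalIntegral.norm_integral_le_of_norm_le (by linarith) ?_
          ((hker.mul continuous_const).intervalIntegrable _ _)
        refine Eventually.of_forall fun t ht => ?_
        have hk := deriv_smoothTransition_nonneg (n * (t - a))
        rw [norm_mul, Real.norm_of_nonneg (by positivity)]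
        gcongr
        rw [← dist_eq_norm]
        refine (hMδ ?_).le
        rw [Real.dist_eq, abs_of_nonneg (by linarith [ht.1])]
        linarith [ht.2]
    _ = ε / 2 := by rw [intervalIntegral.integral_mul_const, hone, one_mul]
    _ < ε := by linarith

theorem tendsto_integral_deriv_stepFun (ha : 0 < a) (hb : 0 < b) {M : ℝ → ℝ}
    (hM : ContinuousOn M (Ioi 0)) :
    Tendsto (fun n : ℕ => ∫ t in Ioi 0, deriv (stepFun a b n) t * M t) atTop (𝓝 (M a - M b)) := by
  refine ((tendsto_integral_kernel ha hM).sub (tendsto_integral_kernel hb hM)).congr' ?_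
  filter_upwards [eventually_gt_atTop 0] with n hn
  have hn' : (0 : ℝ) < n := Nat.cast_pos.2 hn
  have hint : ∀ c : ℝ, 0 < c → IntegrableOn
      (fun t => n * deriv Real.smoothTransition (n * (t - c)) * M t) (Ioi 0) := by
    intro c hc
    have h1 : IntegrableOn (fun t => n * deriv Real.smoothTransition (n * (t - c)) * M t)
        (Icc c (c + 1 / n)) :=
      ((continuous_kernel c n).continuousOn.mul
        (hM.mono fun t ht => hc.trans_le ht.1)).integrableOn_Icc
    refine h1.of_forall_sdiff_eq_zero measurableSet_Ioi fun t ht => ?_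
    rw [kernel_eq_zero hn ht.2, zero_mul]
  rw [← integral_sub (hint a ha) (hint b hb)]
  simp only [deriv_stepFun, sub_mul]

theorem tendsto_stepFun (hab : a ≤ b) {t : ℝ} :
    Tendsto (fun n => stepFun a b n t) atTop (𝓝 ((Ioc a b).indicator 1 t)) := by
  have h : ∀ c : ℝ, Tendsto (fun n : ℕ => Real.smoothTransition (n * (t - c))) atTop
      (𝓝 ((Ioi c).indicator 1 t)) := by
    intro c
    by_cases hc : c < t
    · rw [indicator_of_mem (mem_Ioi.2 hc), Pi.one_apply]
      refine tendsto_const_nhds.congr' ?_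
      filter_upwards [(tendsto_natCast_mul_atTop (sub_pos.2 hc)).eventually_ge_atTop 1] with n hn
      rw [Real.smoothTransition.one_of_one_le hn]
    · rw [indicator_of_notMem (by simpa using hc)]
      refine tendsto_const_nhds.congr fun n => ?_
      rw [Real.smoothTransition.zero_of_nonpos]
      exact mul_nonpos_of_nonneg_of_nonpos (Nat.cast_nonneg n) (sub_nonpos.2 (not_lt.1 hc))
  have he : (Ioc a b).indicator (1 : ℝ → ℝ) t = (Ioi a).indicator 1 t - (Ioi b).indicator 1 t := by
    by_cases h1 : a < t <;> by_cases h2 : b < t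
    · simp [h1, h2]
    · simp [h1, h2, not_lt.1 h2]
    · exact absurd (hab.trans_lt h2) h1
    · simp [h1, h2]
  rw [he]
  exact (h a).sub (h b)

theorem tendsto_integral_stepFun_mul (ha : 0 < a) (hab : a ≤ b) {L : ℝ → ℝ}
    (hL : IntegrableOn L (Ioc a (b + 1))) :
    Tendsto (fun n : ℕ => ∫ t in Ioi 0, stepFun a b n t * L t) atTop (𝓝 (∫ t in a..b, L t)) := by
  have hlim : Tendsto (fun n : ℕ => ∫ t in Ioc a (b + 1), stepFun a b n t * L t) atTop
      (𝓝 (∫ t in Ioc a (b + 1), (Ioc a b).indicator 1 t * L t)) := by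
    refine tendsto_integral_of_dominated_convergence (fun t => |L t|) (fun n => ?_) hL.abs
      (fun n => Eventually.of_forall fun t => ?_)
      (Eventually.of_forall fun t => (tendsto_stepFun hab).mul_const _)
    · exact (contDiff_stepFun a b n).continuous.aestronglyMeasurable.mul hL.1
    · rw [norm_mul, Real.norm_of_nonneg (stepFun_nonneg hab t)]
      exact mul_le_of_le_one_left (norm_nonneg _) (stepFun_le_one t)
  have he : ∫ t in Ioc a (b + 1), (Ioc a b).indicator 1 t * L t = ∫ t in a..b, L t := by
    rw [intervalIntegral.integral_of_le hab]
    have : (fun t => (Ioc a b).indicator 1 t * L t) = (Ioc a b).indicator L := by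
      funext t; by_cases h : t ∈ Ioc a b <;> simp [h]
    rw [this, setIntegral_indicator measurableSet_Ioc,
      inter_eq_right.2 (Ioc_subset_Ioc_right (by linarith))]
  rw [he] at hlim
  refine hlim.congr' ?_
  filter_upwards [eventually_gt_atTop 0] with n hn
  refine (setIntegral_eq_of_subset_of_forall_sdiff_eq_zero measurableSet_Ioi
    (fun t ht => ha.trans ht.1) fun t ht => ?_).symm
  rcases le_or_gt t a with h | h
  · rw [stepFun_of_le hab h, zero_mul]
  · have : b + 1 ≤ t := by
      by_contra h2
      exact ht.2 ⟨h, (not_le.1 h2).le⟩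
    rw [stepFun_of_ge hab hn this, zero_mul]

end SphericalShell

/-! ### Bounded force away from the origin for Sobolev gradients -/

namespace SphericalShell

variable {N : ℕ} {W : Space N → ℝ} {k : ℝ → ℝ}

/-- The closed spherical shell with radii `a` and `b`. -/
def shellSet (N : ℕ) (a b : ℝ) : Set (Space N) := {x | ‖x‖ ∈ Icc a b}

theorem measurableSet_shellSet (a b : ℝ) : MeasurableSet (shellSet N a b) :=
  measurable_norm measurableSet_Icc

theorem isCompact_shellSet (a b : ℝ) : IsCompact (shellSet N a b) := by
  refine (isCompact_closedBall (0 : Space N) b).of_isClosed_subset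
    (isClosed_Icc.preimage continuous_norm) fun x hx => ?_
  simpa using hx.2

theorem volume_shellSet_ne_top (a b : ℝ) : volume (shellSet N a b) ≠ ⊤ :=
  (isCompact_shellSet a b).measure_ne_top

theorem setIntegral_shellSet [Nontrivial (Space N)] {a b : ℝ} (ha : 0 < a) (hab : a ≤ b)
    (f : ℝ → ℝ) : ∫ x in shellSet N a b, f ‖x‖ =
      N * volume.real (Metric.ball (0 : Space N) 1) * ∫ s in a..b, s ^ (N - 1) * f s := by
  have h1 : ∫ x in shellSet N a b, f ‖x‖ = ∫ x : Space N, (Icc a b).indicator f ‖x‖ := by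
    rw [← integral_indicator (measurableSet_shellSet a b)]
    rfl
  rw [h1, integral_fun_norm_addHaar, finrank_euclideanSpace, Fintype.card_fin, nsmul_eq_mul,
    smul_eq_mul, ← mul_assoc]
  congr 1
  rw [intervalIntegral.integral_of_le hab, ← integral_Icc_eq_integral_Ioc]
  have h2 : (fun y : ℝ => y ^ (N - 1) • (Icc a b).indicator f y) =
      (Icc a b).indicator fun y => y ^ (N - 1) * f y := by
    funext y
    by_cases hy : y ∈ Icc a b <;> simp [hy]
  have h3 : Icc a b ⊆ Ioi 0 := fun y hy => ha.trans_le hy.1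
  rw [h2, setIntegral_indicator measurableSet_Icc, inter_eq_right.2 h3]

theorem volume_shellSet_le [Nontrivial (Space N)] {a b : ℝ} (ha : 0 < a) (hab : a ≤ b) :
    volume.real (shellSet N a b) ≤
      N * volume.real (Metric.ball (0 : Space N) 1) * ((b - a) * b ^ (N - 1)) := by
  have h := setIntegral_shellSet (N := N) ha hab fun _ => 1
  rw [setIntegral_const, smul_eq_mul, mul_one] at h
  rw [h]
  gcongr
  have h2 : ∫ s in a..b, s ^ (N - 1) * 1 ≤ ∫ s in a..b, b ^ (N - 1) := by
    refine intervalIntegral.integral_mono_on hab (by apply Continuous.intervalIntegrable; fun_prop)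
      (by simp) fun s hs => ?_
    rw [mul_one]
    exact pow_le_pow_left₀ (ha.le.trans hs.1) hs.2 _
  simpa using h2

/-- The inequality t ≤ 1 + t^q is used in place of Hölder's: a bound linear in the volume is all
that is needed, because volumes of shells of bounded width grow like s^(N-1). -/
theorem setIntegral_norm_le_of_memLp {E : Type*} [NormedAddCommGroup E] {f : Space N → E} {q : ℝ}
    (hq : 1 ≤ q) (hf : MemLp f (ENNReal.ofReal q) volume) {A : Set (Space N)}
    (hA : volume A ≠ ⊤) : IntegrableOn f A ∧
      ∫ x in A, ‖f x‖ ≤ volume.real A + ∫ x, ‖f x‖ ^ q := by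
  have hq0 : 0 < q := by linarith
  have h1 : Integrable (fun x => ‖f x‖ ^ q) volume := by
    have := hf.integrable_norm_rpow (by simpa using hq0) ENNReal.ofReal_ne_top
    rwa [ENNReal.toReal_ofReal hq0.le] at this
  have hle : ∀ x, ‖f x‖ ≤ 1 + ‖f x‖ ^ q := by
    intro x
    rcases le_total ‖f x‖ 1 with h | h
    · have : 0 ≤ ‖f x‖ ^ q := by positivity
      linarith
    · have := Real.rpow_le_rpow_of_exponent_le h hq
      rw [Real.rpow_one] at this
      linarith
  have h2 : IntegrableOn (fun x => 1 + ‖f x‖ ^ q) A :=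
    (integrableOn_const hA).add h1.integrableOn
  have h3 : IntegrableOn f A :=
    h2.mono' hf.1.restrict (Eventually.of_forall hle)
  refine ⟨h3, ?_⟩
  calc ∫ x in A, ‖f x‖ ≤ ∫ x in A, (1 + ‖f x‖ ^ q) :=
        integral_mono h3.norm h2 hle
    _ = volume.real A + ∫ x in A, ‖f x‖ ^ q := by
        rw [integral_add (integrable_const_iff.2 (Or.inr ⟨by simpa using hA.lt_top⟩))
          h1.integrableOn]
        simp
    _ ≤ _ := by
        refine add_le_add_right ?_ _
        exact setIntegral_le_integral h1 (Eventually.of_forall fun x => by positivity)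

theorem contDiff_stepFun_norm {a b : ℝ} (ha : 0 < a) (hab : a ≤ b) (n : ℕ) :
    ContDiff ℝ ∞ fun x : Space N => stepFun a b n ‖x‖ := by
  rw [contDiff_iff_contDiffAt]
  intro x
  by_cases hx : x = 0
  · have : (fun x : Space N => stepFun a b n ‖x‖) =ᶠ[𝓝 x] fun _ => 0 := by
      filter_upwards [Metric.ball_mem_nhds x ha] with y hy
      rw [hx, mem_ball_zero_iff] at hy
      exact stepFun_of_le hab hy.le
    exact contDiffAt_const.congr_of_eventuallyEq this
  · exact (contDiff_stepFun a b n).contDiffAt.comp x (contDiffAt_norm ℝ hx)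

theorem hasCompactSupport_stepFun_norm {a b : ℝ} {n : ℕ} (hab : a ≤ b) (hn : 0 < n) :
    HasCompactSupport fun x : Space N => stepFun a b n ‖x‖ := by
  refine HasCompactSupport.intro (isCompact_shellSet a (b + 1)) fun x hx => ?_
  rcases le_or_gt ‖x‖ a with h | h
  · exact stepFun_of_le hab h
  · refine stepFun_of_ge hab hn ?_
    by_contra h2
    exact hx ⟨h.le, (not_le.1 h2).le⟩

theorem continuousOn_pow_mul_deriv (hk : ContDiffOn ℝ 3 k (Ioi 0)) :
    ContinuousOn (fun s => s ^ (N - 1) * deriv k s) (Ioi 0) :=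
  (continuous_pow _).continuousOn.mul (contDiffOn_deriv_profile hk).continuousOn

/-- For potentials with gradient in a Sobolev space, the variation of the radial flux is controlled by
the weak Laplacian. -/
theorem abs_pow_mul_deriv_sub_le [Nontrivial (Space N)] (hWk : ∀ x, x ≠ 0 → W x = k ‖x‖)
    (hk : ContDiffOn ℝ 3 k (Ioi 0)) {q : ℝ} (hq : 1 ≤ q)
    (hmem : MemLp (∇ W) (ENNReal.ofReal q) volume) {G : Fin N → Fin N → Space N → ℝ}
    (hG : ∀ i j, MemLp (G i j) (ENNReal.ofReal q) volume)
    (hweak : ∀ i j, ∀ φ : Space N → ℝ, ContDiff ℝ ∞ φ → HasCompactSupport φ →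
      ∫ x, (∇ W x) i * fderiv ℝ φ x (EuclideanSpace.single j 1) = -∫ x, G i j x * φ x)
    {a b : ℝ} (ha : 0 < a) (hab : a ≤ b) :
    N * volume.real (Metric.ball (0 : Space N) 1) *
        |a ^ (N - 1) * deriv k a - b ^ (N - 1) * deriv k b| ≤
      N * volume.real (shellSet N a (b + 1)) + ∑ i, ∫ x, ‖G i i x‖ ^ q := by
  set c := N * volume.real (Metric.ball (0 : Space N) 1) with hc
  have hq' : 1 ≤ ENNReal.ofReal q := by simpa using hq
  have hM := continuousOn_pow_mul_deriv (N := N) hk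
  have hlim : Tendsto (fun n : ℕ => |c * ∫ t in Ioi 0, deriv (stepFun a b n) t *
      (t ^ (N - 1) * deriv k t)|) atTop
      (𝓝 |c * (a ^ (N - 1) * deriv k a - b ^ (N - 1) * deriv k b)|) :=
    ((tendsto_integral_deriv_stepFun ha (ha.trans_le hab) hM).const_mul c).abs
  have hc0 : 0 ≤ c := by positivity
  rw [← abs_of_nonneg hc0, ← abs_mul]
  refine le_of_tendsto hlim ?_
  filter_upwards [eventually_gt_atTop 0] with n hn
  set φ : Space N → ℝ := fun x => stepFun a b n ‖x‖ with hφ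
  have hφs : ContDiff ℝ ∞ φ := contDiff_stepFun_norm ha hab n
  have hφc : HasCompactSupport φ := hasCompactSupport_stepFun_norm hab hn
  have hφr : ∀ x : Space N, x ≠ 0 →
      HasFDerivAt φ (forceProfile (stepFun a b n) (‖x‖ ^ 2) • innerSL ℝ x) x := fun x hx =>
    hasFDerivAt_radial (fun _ _ => rfl) ((contDiff_stepFun a b n).of_le (by norm_cast)).contDiffOn hx
  have hint : ∀ i, Integrable (fun x => (∇ W x) i * fderiv ℝ φ x (EuclideanSpace.single i 1)) := by
    intro i
    have h1 : MemLp (fun x => (∇ W x) i) (ENNReal.ofReal q) volume :=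
      (EuclideanSpace.proj (𝕜 := ℝ) i).comp_memLp' hmem
    have h2 := (h1.locallyIntegrable hq').integrable_smul_left_of_hasCompactSupport
      (g := fun x => fderiv ℝ φ x (EuclideanSpace.single i 1))
      ((hφs.continuous_fderiv (by simp)).clm_apply continuous_const)
      (hφc.fderiv_apply ℝ _)
    refine h2.congr (Eventually.of_forall fun x => ?_)
    simp [mul_comm]
  -- Tested against a radial step, ∇W · ∇φ is the product of the two profile derivatives, which in
  -- polar coordinates is t^(N-1) k'(t) against the derivative of the step; as the step sharpens,
  -- its values at `a` and `b` are recovered.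
  have hsum : ∑ i, ∫ x, (∇ W x) i * fderiv ℝ φ x (EuclideanSpace.single i 1) =
      c * ∫ t in Ioi 0, deriv (stepFun a b n) t * (t ^ (N - 1) * deriv k t) := by
    rw [← integral_finsetSum _ fun i _ => hint i]
    have h1 : ∫ x, ∑ i, (∇ W x) i * fderiv ℝ φ x (EuclideanSpace.single i 1) =
        ∫ x : Space N, (fun s => deriv (stepFun a b n) s * deriv k s) ‖x‖ := by
      refine integral_congr_ae ?_
      filter_upwards [Measure.ae_ne volume (0 : Space N)] with x hx
      have hn0 : 0 < ‖x‖ := norm_pos_iff.2 hx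
      rw [(hφr x hx).fderiv, gradient_radial hWk hk hx]
      have h2 : ∀ i, (forceProfile k (‖x‖ ^ 2) • x) i *
          (forceProfile (stepFun a b n) (‖x‖ ^ 2) • innerSL ℝ x) (EuclideanSpace.single i 1) =
          forceProfile k (‖x‖ ^ 2) * forceProfile (stepFun a b n) (‖x‖ ^ 2) * x i ^ 2 := by
        intro i
        simp [EuclideanSpace.inner_single_right]
        ring
      simp only [h2]
      rw [← Finset.mul_sum, ← EuclideanSpace.real_norm_sq_eq, ← mul_forceProfile_sq (k := k) hn0,
        ← mul_forceProfile_sq (k := stepFun a b n) hn0]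
      ring
    rw [h1, integral_fun_norm_addHaar volume (fun s => deriv (stepFun a b n) s * deriv k s),
      finrank_euclideanSpace, Fintype.card_fin, nsmul_eq_mul,
      smul_eq_mul, ← mul_assoc, hc]
    congr 1
    refine integral_congr_ae (Eventually.of_forall fun t => ?_)
    simp only [smul_eq_mul]; ring
  rw [← hsum]
  simp only [hweak _ _ φ hφs hφc]
  calc |∑ i, -∫ x, G i i x * φ x| ≤ ∑ i, |-∫ x, G i i x * φ x| := Finset.abs_sum_le_sum_abs _ _
    _ ≤ ∑ i, (volume.real (shellSet N a (b + 1)) + ∫ x, ‖G i i x‖ ^ q) := by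
        refine Finset.sum_le_sum fun i _ => ?_
        obtain ⟨h1, h2⟩ := setIntegral_norm_le_of_memLp hq (hG i i)
          (volume_shellSet_ne_top a (b + 1))
        refine le_trans ?_ h2
        rw [abs_neg, ← Real.norm_eq_abs]
        have h3 : ∫ x, G i i x * φ x = ∫ x in shellSet N a (b + 1), G i i x * φ x := by
          symm
          refine setIntegral_eq_integral_of_forall_compl_eq_zero fun x hx => ?_
          rcases le_or_gt ‖x‖ a with h | h
          · simp [hφ, stepFun_of_le hab h]
          · have : b + 1 ≤ ‖x‖ := by
              by_contra h2
              exact hx ⟨h.le, (not_le.1 h2).le⟩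
            simp [hφ, stepFun_of_ge hab hn this]
        rw [h3]
        refine norm_integral_le_of_norm_le h1.norm (Eventually.of_forall fun x => ?_)
        rw [norm_mul, Real.norm_of_nonneg (stepFun_nonneg hab _)]
        exact mul_le_of_le_one_right (norm_nonneg _) (stepFun_le_one _)
    _ = _ := by simp [Finset.sum_add_distrib]

/-- A radial potential with gradient in a Sobolev space `W^{1,q}` has a bounded force away from the
origin. -/
theorem exists_abs_deriv_le_of_gradMemSobolev (hN : 2 ≤ N) (hWk : ∀ x, x ≠ 0 → W x = k ‖x‖)
    (hk : ContDiffOn ℝ 3 k (Ioi 0)) {q : ℝ} (hq : 1 ≤ q) (h : GradMemSobolev W q) {ε : ℝ}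
    (hε : 0 < ε) : ∃ C, ∀ s, ε ≤ s → |deriv k s| ≤ C := by
  obtain ⟨hmem, G, hG, hweak⟩ := h
  have : NeZero N := ⟨by omega⟩
  have : Nontrivial (Space N) := inferInstance
  set c := N * volume.real (Metric.ball (0 : Space N) 1) with hc
  have hc0 : 0 < c := by
    have h1 : 0 < volume.real (Metric.ball (0 : Space N) 1) :=
      ENNReal.toReal_pos (Metric.measure_ball_pos _ _ one_pos).ne' measure_ball_lt_top.ne
    have h2 : (0 : ℝ) < N := by positivity
    positivity
  set K₁ := ∑ i, ∫ x, ‖G i i x‖ ^ q with hK₁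
  set K₂ := ∫ x, ‖∇ W x‖ ^ q with hK₂
  have hK₁0 : 0 ≤ K₁ := Finset.sum_nonneg fun i _ => integral_nonneg fun x => by positivity
  have hK₂0 : 0 ≤ K₂ := integral_nonneg fun x => by positivity
  have hM := continuousOn_pow_mul_deriv (N := N) hk
  -- Shells of width at most 3 beyond `s` have volume at most 3c(s+3)^(N-1). This is counted N times
  -- for the diagonal weak derivatives and once for the gradient. Division by s^(N-1) is harmless
  -- since (s+3)/s ≤ (ε+3)/ε.
  refine ⟨((N + 1) * (c * 3 * ((ε + 3) / ε) ^ (N - 1)) + (K₁ + K₂) / ε ^ (N - 1)) / c,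
    fun s hs => ?_⟩
  have hs0 : 0 < s := hε.trans_le hs
  -- a radius at which the flux is not larger than its mean
  obtain ⟨b, hb, hbmin⟩ := (isCompact_Icc (a := s + 1) (b := s + 2)).exists_isMinOn
    (nonempty_Icc.2 (by linarith)) (f := fun s => |s ^ (N - 1) * deriv k s|)
    ((hM.mono fun t ht => hs0.trans (by linarith [ht.1])).abs)
  have hvol : ∀ a b, s ≤ a → a ≤ b → b ≤ s + 3 →
      volume.real (shellSet N a b) ≤ c * 3 * (s + 3) ^ (N - 1) := by
    intro a b h1 h2 h3
    refine (volume_shellSet_le (hs0.trans_le h1) h2).trans ?_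
    rw [mul_assoc c]
    have hb0 : 0 ≤ b := by linarith
    gcongr
    linarith
  have h1 : c * |b ^ (N - 1) * deriv k b| ≤ c * 3 * (s + 3) ^ (N - 1) + K₂ := by
    have e1 := (setIntegral_norm_le_of_memLp hq hmem (volume_shellSet_ne_top (s + 1) (s + 2))).2
    have e2 : ∫ x in shellSet N (s + 1) (s + 2), ‖∇ W x‖ =
        ∫ x in shellSet N (s + 1) (s + 2), (fun t => |deriv k t|) ‖x‖ := by
      refine setIntegral_congr_fun (measurableSet_shellSet _ _) fun x hx => ?_
      have hx0 : 0 < ‖x‖ := by linarith [hx.1]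
      simp only
      rw [gradient_radial hWk hk (norm_pos_iff.1 hx0), norm_smul, ← mul_forceProfile_sq hx0,
        abs_mul, abs_of_pos hx0, Real.norm_eq_abs, mul_comm]
    rw [e2, setIntegral_shellSet (by linarith) (by linarith) fun t => |deriv k t|] at e1
    have e3 : |b ^ (N - 1) * deriv k b| ≤ ∫ t in (s + 1)..(s + 2), t ^ (N - 1) * |deriv k t| := by
      have hci : ContinuousOn (fun t => t ^ (N - 1) * |deriv k t|) (uIcc (s + 1) (s + 2)) := by
        rw [uIcc_of_le (by linarith)]
        exact (continuous_pow _).continuousOn.mul (((contDiffOn_deriv_profile hk).continuousOn.mono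
          fun t ht => hs0.trans (by linarith [ht.1])).abs)
      have : ∫ t in (s + 1)..(s + 2), |b ^ (N - 1) * deriv k b| ≤
          ∫ t in (s + 1)..(s + 2), t ^ (N - 1) * |deriv k t| := by
        refine intervalIntegral.integral_mono_on (by linarith) (by simp) hci.intervalIntegrable
          fun t ht => ?_
        have h2 : |b ^ (N - 1) * deriv k b| ≤ |t ^ (N - 1) * deriv k t| := hbmin ht
        have ht0 : 0 ≤ t := by linarith [ht.1]
        rwa [abs_mul (t ^ (N - 1)), abs_of_nonneg (by positivity : 0 ≤ t ^ (N - 1))] at h2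
      simpa [show s + 2 - (s + 1) = (1 : ℝ) by ring] using this
    have e4 := hvol (s + 1) (s + 2) (by linarith) (by linarith) (by linarith)
    calc c * |b ^ (N - 1) * deriv k b| ≤ c * ∫ t in (s + 1)..(s + 2), t ^ (N - 1) * |deriv k t| := by
          gcongr
      _ ≤ _ := by linarith
  have h2 := abs_pow_mul_deriv_sub_le hWk hk hq hmem hG hweak hs0 (by linarith [hb.1] : s ≤ b)
  have h3 := hvol s (b + 1) le_rfl (by linarith [hb.1]) (by linarith [hb.2])
  have h4 : c * (s ^ (N - 1) * |deriv k s|) ≤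
      (N + 1) * (c * 3 * (s + 3) ^ (N - 1)) + (K₁ + K₂) := by
    have e1 : s ^ (N - 1) * |deriv k s| ≤
        |s ^ (N - 1) * deriv k s - b ^ (N - 1) * deriv k b| + |b ^ (N - 1) * deriv k b| := by
      have := abs_add_le (s ^ (N - 1) * deriv k s - b ^ (N - 1) * deriv k b) (b ^ (N - 1) * deriv k b)
      rwa [sub_add_cancel, abs_mul (s ^ (N - 1)), abs_of_pos (by positivity : 0 < s ^ (N - 1))] at this
    have e2 := mul_le_mul_of_nonneg_left e1 hc0.le
    have e3 : (N : ℝ) * volume.real (shellSet N s (b + 1)) ≤ N * (c * 3 * (s + 3) ^ (N - 1)) := by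
      gcongr
    rw [mul_add] at e2
    linarith
  rw [le_div_iff₀ hc0, mul_comm]
  have hsp : 0 < s ^ (N - 1) := by positivity
  have h5 : c * |deriv k s| ≤
      ((N + 1) * (c * 3 * (s + 3) ^ (N - 1)) + (K₁ + K₂)) / s ^ (N - 1) := by
    rw [le_div_iff₀ hsp]
    linarith
  refine h5.trans ?_
  rw [add_div]
  refine add_le_add ?_ ?_
  · rw [mul_div_assoc, mul_div_assoc, ← div_pow]
    gcongr ?_ * (?_ * ?_ ^ _)
    rw [div_le_div_iff₀ hs0 hε]
    nlinarith
  · gcongr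

end SphericalShell

/-! ### The continuity equation in integrated form -/

namespace SphericalShell

variable {N : ℕ} {a b : ℝ}

theorem isProbabilityMeasure_radialPart (μ : Measure (Space N)) [IsProbabilityMeasure μ] :
    IsProbabilityMeasure (radialPart μ) :=
  Measure.isProbabilityMeasure_map measurable_norm.aemeasurable

theorem integral_radialPart (μ : Measure (Space N)) {f : ℝ → ℝ} (hf : Continuous f) :
    ∫ r, f r ∂(radialPart μ) = ∫ x, f ‖x‖ ∂μ :=
  integral_map measurable_norm.aemeasurable hf.aestronglyMeasurable

theorem exists_boundedContinuous_norm {f : ℝ → ℝ} (hf : Continuous f) {C : ℝ}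
    (hC : ∀ r, |f r| ≤ C) :
    ∃ F : BoundedContinuousFunction (Space N) ℝ, ∀ x, F x = f ‖x‖ :=
  ⟨BoundedContinuousFunction.ofNormedAddCommGroup (fun x => f ‖x‖) (hf.comp continuous_norm) C
    fun x => hC ‖x‖, fun _ => rfl⟩

theorem tsupport_stepFun_subset (hab : a ≤ b) {n : ℕ} (hn : 0 < n) :
    tsupport (stepFun a b n) ⊆ Icc a (b + 1) := by
  refine closure_minimal (fun t ht => ?_) isClosed_Icc
  refine ⟨?_, ?_⟩
  · by_contra h
    exact ht (stepFun_of_le hab (not_le.1 h).le)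
  · by_contra h
    exact ht (stepFun_of_ge hab hn (not_le.1 h).le)

theorem hasCompactSupport_stepFun (hab : a ≤ b) {n : ℕ} (hn : 0 < n) :
    HasCompactSupport (stepFun a b n) :=
  isCompact_Icc.of_isClosed_subset (isClosed_tsupport _) (tsupport_stepFun_subset hab hn)

variable [NeZero N] {W : Space N → ℝ} {μ : ℝ → Measure (Space N)}

namespace IsRadialSolution

theorem continuousOn_integral (hμ : IsRadialSolution W μ) {f : ℝ → ℝ} (hf : Continuous f) {C : ℝ}
    (hC : ∀ r, |f r| ≤ C) : ContinuousOn (fun t => ∫ r, f r ∂(radialPart (μ t))) (Ici 0) := by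
  obtain ⟨F, hF⟩ := exists_boundedContinuous_norm (N := N) hf hC
  simp only [integral_radialPart _ hf, ← hF]
  exact hμ.continuous F

theorem conservation_mul (hμ : IsRadialSolution W μ) {α β : ℝ → ℝ} (hα : ContDiff ℝ ∞ α)
    (hαc : HasCompactSupport α) (hα0 : tsupport α ⊆ Ioi 0) (hβ : ContDiff ℝ ∞ β)
    (hβc : HasCompactSupport β) (hβ0 : tsupport β ⊆ Ioi 0) :
    (∀ t, 0 < t → Integrable
      (fun r => deriv α t * β r + radialVelocity W (μ t) r * (α t * deriv β r))
      (radialPart (μ t))) ∧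
    IntegrableOn (fun t => ∫ r, (deriv α t * β r + radialVelocity W (μ t) r * (α t * deriv β r))
      ∂(radialPart (μ t))) (Ioi 0) ∧
    ∫ t in Ioi (0 : ℝ), ∫ r, (deriv α t * β r + radialVelocity W (μ t) r * (α t * deriv β r))
      ∂(radialPart (μ t)) = 0 := by
  set φ : ℝ × ℝ → ℝ := fun p => α p.1 * β p.2 with hφ
  have hφs : ContDiff ℝ ∞ φ := (hα.comp contDiff_fst).mul (hβ.comp contDiff_snd)
  have hsub : tsupport φ ⊆ tsupport α ×ˢ tsupport β := by
    refine closure_minimal (fun p hp => ?_) ((isClosed_tsupport α).prod (isClosed_tsupport β))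
    exact ⟨subset_tsupport _ (left_ne_zero_of_mul hp), subset_tsupport _ (right_ne_zero_of_mul hp)⟩
  have hφc : HasCompactSupport φ :=
    (hαc.isCompact.prod hβc.isCompact).of_isClosed_subset (isClosed_tsupport _) hsub
  have hd : ∀ t r, HasFDerivAt φ
      (α t • (deriv β r • ContinuousLinearMap.snd ℝ ℝ ℝ) +
        β r • (deriv α t • ContinuousLinearMap.fst ℝ ℝ ℝ)) (t, r) := by
    intro t r
    have h1 : HasFDerivAt (fun p : ℝ × ℝ => α p.1) (deriv α t • ContinuousLinearMap.fst ℝ ℝ ℝ)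
        (t, r) :=
      (((hα.differentiable (by simp)) t).hasDerivAt).comp_hasFDerivAt (t, r) hasFDerivAt_fst
    have h2 : HasFDerivAt (fun p : ℝ × ℝ => β p.2) (deriv β r • ContinuousLinearMap.snd ℝ ℝ ℝ)
        (t, r) :=
      (((hβ.differentiable (by simp)) r).hasDerivAt).comp_hasFDerivAt (t, r) hasFDerivAt_snd
    exact h1.mul h2
  have h1 : ∀ t r, fderiv ℝ φ (t, r) (1, 0) = deriv α t * β r := fun t r => by
    rw [(hd t r).fderiv]; simp [mul_comm]
  have h2 : ∀ t r, fderiv ℝ φ (t, r) (0, 1) = α t * deriv β r := fun t r => by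
    rw [(hd t r).fderiv]; simp
  have h := hμ.conservation φ hφs hφc (hsub.trans (prod_mono hα0 hβ0))
  simpa only [h1, h2] using h

variable {β : ℝ → ℝ}

theorem integrable_of_hasCompactSupport (hμ : IsRadialSolution W μ) (hβ : Continuous β)
    (hβc : HasCompactSupport β) {t : ℝ} (ht : 0 ≤ t) : Integrable β (radialPart (μ t)) := by
  have := hμ.prob t ht
  have := isProbabilityMeasure_radialPart (μ t)
  exact hβ.integrable_of_hasCompactSupport hβc

/-- The equation is tested with α(t)β(r), where α does not vanish at the given time; the integrable
term α'β is subtracted and α(t) divided out. -/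
theorem integrable_velocity_mul_deriv (hμ : IsRadialSolution W μ) (hβ : ContDiff ℝ ∞ β)
    (hβc : HasCompactSupport β) (hβ0 : tsupport β ⊆ Ioi 0) {t : ℝ} (ht : 0 < t) :
    Integrable (fun r => radialVelocity W (μ t) r * deriv β r) (radialPart (μ t)) := by
  have hle : t / 2 ≤ t := by linarith
  have hα0 : tsupport (stepFun (t / 2) t 1) ⊆ Ioi 0 :=
    (tsupport_stepFun_subset hle one_pos).trans fun s hs => (by linarith [hs.1] : (0 : ℝ) < s)
  have h := (hμ.conservation_mul (contDiff_stepFun (t / 2) t 1)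
    (hasCompactSupport_stepFun hle one_pos) hα0 hβ hβc hβ0).1 t ht
  have hne : stepFun (t / 2) t 1 t ≠ 0 := by
    have : 0 < Real.smoothTransition ((1 : ℕ) * (t - t / 2)) :=
      Real.smoothTransition.pos_of_pos (by push_cast; linarith)
    rw [stepFun, sub_self, mul_zero, Real.smoothTransition.zero, sub_zero]
    exact this.ne'
  have h2 := ((h.sub ((hμ.integrable_of_hasCompactSupport hβ.continuous hβc ht.le).const_mul
    (deriv (stepFun (t / 2) t 1) t))).const_mul (stepFun (t / 2) t 1 t)⁻¹)
  refine h2.congr (Eventually.of_forall fun r => ?_)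
  simp only [Pi.sub_apply]
  field_simp
  ring

theorem integral_conservation (hμ : IsRadialSolution W μ) (hβ : ContDiff ℝ ∞ β)
    (hβc : HasCompactSupport β) (hβ0 : tsupport β ⊆ Ioi 0) (α : ℝ → ℝ) {t : ℝ} (ht : 0 < t) :
    ∫ r, (deriv α t * β r + radialVelocity W (μ t) r * (α t * deriv β r)) ∂(radialPart (μ t)) =
      deriv α t * ∫ r, β r ∂(radialPart (μ t)) +
        α t * ∫ r, radialVelocity W (μ t) r * deriv β r ∂(radialPart (μ t)) := by
  have he : ∀ r, radialVelocity W (μ t) r * (α t * deriv β r) =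
      α t * (radialVelocity W (μ t) r * deriv β r) := fun r => by ring
  simp only [he]
  rw [integral_add ((hμ.integrable_of_hasCompactSupport hβ.continuous hβc ht.le).const_mul _)
    ((hμ.integrable_velocity_mul_deriv hβ hβc hβ0 ht).const_mul _), integral_const_mul,
    integral_const_mul]

theorem conservation_stepFun (hμ : IsRadialSolution W μ) (hβ : ContDiff ℝ ∞ β)
    (hβc : HasCompactSupport β) (hβ0 : tsupport β ⊆ Ioi 0) (ha : 0 < a) (hab : a ≤ b) {n : ℕ}
    (hn : 0 < n) :
    IntegrableOn (fun t => stepFun a b n t *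
      ∫ r, radialVelocity W (μ t) r * deriv β r ∂(radialPart (μ t))) (Ioi 0) ∧
    (∫ t in Ioi 0, deriv (stepFun a b n) t * ∫ r, β r ∂(radialPart (μ t))) +
      ∫ t in Ioi 0, stepFun a b n t *
        ∫ r, radialVelocity W (μ t) r * deriv β r ∂(radialPart (μ t)) = 0 := by
  have hts := tsupport_stepFun_subset hab hn
  have hα0 : tsupport (stepFun a b n) ⊆ Ioi 0 := hts.trans fun s hs => ha.trans_le hs.1
  obtain ⟨-, h1, h2⟩ := hμ.conservation_mul (contDiff_stepFun a b n)
    (hasCompactSupport_stepFun hab hn) hα0 hβ hβc hβ0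
  have he := fun t (ht : t ∈ Ioi (0 : ℝ)) =>
    hμ.integral_conservation hβ hβc hβ0 (stepFun a b n) ht
  rw [integrableOn_congr_fun he measurableSet_Ioi] at h1
  rw [setIntegral_congr_fun measurableSet_Ioi he] at h2
  obtain ⟨C, hC⟩ := hβc.exists_bound_of_continuous hβ.continuous
  have hM : ContinuousOn (fun t => ∫ r, β r ∂(radialPart (μ t))) (Ioi 0) :=
    (hμ.continuousOn_integral hβ.continuous hC).mono Ioi_subset_Ici_self
  have h3 : IntegrableOn (fun t => deriv (stepFun a b n) t * ∫ r, β r ∂(radialPart (μ t)))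
      (Ioi 0) := by
    have h4 : IntegrableOn (fun t => deriv (stepFun a b n) t * ∫ r, β r ∂(radialPart (μ t)))
        (Icc a (b + 1)) :=
      (((contDiff_stepFun a b n).continuous_deriv (by simp)).continuousOn.mul
        (hM.mono fun t ht => ha.trans_le ht.1)).integrableOn_Icc
    refine h4.of_forall_sdiff_eq_zero measurableSet_Ioi fun t ht => ?_
    have : deriv (stepFun a b n) t = 0 := by
      by_contra hne
      exact ht.2 (hts (tsupport_deriv_subset (subset_tsupport _ hne)))
    rw [this, zero_mul]
  have h4 : IntegrableOn (fun t => stepFun a b n t *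
      ∫ r, radialVelocity W (μ t) r * deriv β r ∂(radialPart (μ t))) (Ioi 0) := by
    refine (h1.sub h3).congr (Eventually.of_forall fun t => ?_)
    simp
  refine ⟨h4, ?_⟩
  rw [← integral_add h3 h4]
  exact h2

theorem integrableOn_velocity (hμ : IsRadialSolution W μ) (hβ : ContDiff ℝ ∞ β)
    (hβc : HasCompactSupport β) (hβ0 : tsupport β ⊆ Ioi 0) (ha : 0 < a) (b : ℝ) :
    IntegrableOn (fun t => ∫ r, radialVelocity W (μ t) r * deriv β r ∂(radialPart (μ t)))
      (Ioc a b) := by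
  rcases le_or_gt b a with hab | hab
  · rw [Ioc_eq_empty (not_lt.2 hab)]
    exact integrableOn_empty
  -- A step that starts at a/2 with 1/n < a/2 has reached the value one by time `a`, so on (a, b] it
  -- disappears from the integrand.
  obtain ⟨n, hn⟩ := exists_nat_gt (1 / (a / 2))
  have ha2 : 0 < a / 2 := by positivity
  rw [div_lt_iff₀ ha2] at hn
  have hn0 : 0 < n := by
    rw [Nat.pos_iff_ne_zero]
    rintro rfl
    norm_num at hn
  have hn' : (0 : ℝ) < n := Nat.cast_pos.2 hn0
  have h := (hμ.conservation_stepFun hβ hβc hβ0 ha2 (by linarith : a / 2 ≤ b) hn0).1.mono_set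
    (fun t (ht : t ∈ Ioc a b) => ha.trans ht.1)
  refine h.congr_fun (fun t ht => ?_) measurableSet_Ioc
  have : stepFun (a / 2) b n t = 1 := by
    rw [stepFun, Real.smoothTransition.one_of_one_le (by nlinarith [ht.1]),
      Real.smoothTransition.zero_of_nonpos (mul_nonpos_of_nonneg_of_nonpos hn'.le
        (by linarith [ht.2])), sub_zero]
  simp only [this, one_mul]

/-- The integrated form of the continuity equation. -/
theorem integral_sub_integral (hμ : IsRadialSolution W μ) (hβ : ContDiff ℝ ∞ β)
    (hβc : HasCompactSupport β) (hβ0 : tsupport β ⊆ Ioi 0) (ha : 0 < a) (hab : a ≤ b) :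
    ∫ r, β r ∂(radialPart (μ b)) - ∫ r, β r ∂(radialPart (μ a)) =
      ∫ t in a..b, ∫ r, radialVelocity W (μ t) r * deriv β r ∂(radialPart (μ t)) := by
  obtain ⟨C, hC⟩ := hβc.exists_bound_of_continuous hβ.continuous
  have hM : ContinuousOn (fun t => ∫ r, β r ∂(radialPart (μ t))) (Ioi 0) :=
    (hμ.continuousOn_integral hβ.continuous hC).mono Ioi_subset_Ici_self
  -- The time factor of the test function tends to the indicator of (a, b], and its derivative to
  -- the difference of the point masses at `a` and `b`.
  have h1 := (tendsto_integral_deriv_stepFun ha (ha.trans_le hab) hM).add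
    (tendsto_integral_stepFun_mul ha hab (hμ.integrableOn_velocity hβ hβc hβ0 ha (b + 1)))
  have h2 : (fun n : ℕ => (∫ t in Ioi 0, deriv (stepFun a b n) t * ∫ r, β r ∂(radialPart (μ t))) +
      ∫ t in Ioi 0, stepFun a b n t *
        ∫ r, radialVelocity W (μ t) r * deriv β r ∂(radialPart (μ t))) =ᶠ[atTop] fun _ => 0 := by
    filter_upwards [eventually_gt_atTop 0] with n hn
    exact (hμ.conservation_stepFun hβ hβc hβ0 ha hab hn).2
  have h3 := tendsto_nhds_unique (h1.congr' h2) tendsto_const_nhds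
  linarith

end IsRadialSolution

end SphericalShell

/-! ### Bounds and sign of the flux near the shell -/

namespace SphericalShell

variable {N : ℕ} {k Q : ℝ → ℝ} {R : ℝ}

/-- The radial component of the force is at most its modulus |k'|, taken at distances between |r -
η| and r + η. -/
theorem abs_flux_le_of_abs_deriv_le {r η C : ℝ} (hr : 0 < r) (hη : 0 ≤ η) (hne : r ≠ η)
    (hC : ∀ s ∈ Icc |r - η| (r + η), |deriv k s| ≤ C) :
    |flux N (forceProfile k) r η| ≤ r ^ (N - 1) * C * Real.pi := by
  have hd : 0 < |r - η| := abs_pos.2 (sub_ne_zero.2 hne)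
  rw [flux, abs_neg, ← Real.norm_eq_abs]
  have h := intervalIntegral.norm_integral_le_of_norm_le_const (a := 0) (b := Real.pi)
    (C := r ^ (N - 1) * C)
    (f := fun θ => r ^ (N - 1) * forceProfile k (sqDist r η θ) * (r - η * Real.cos θ) *
      Real.sin θ ^ (N - 2)) fun θ _ => ?_
  · rwa [sub_zero, abs_of_pos Real.pi_pos] at h
  have hs1 : |r - η| ≤ √(sqDist r η θ) := Real.abs_le_sqrt (sq_sub_le_sqDist hr.le hη θ)
  have hs2 : √(sqDist r η θ) ≤ r + η :=
    (Real.sqrt_le_left (by positivity)).2 (sqDist_le_sq_add hr.le hη θ)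
  have hs0 : 0 < √(sqDist r η θ) := hd.trans_le hs1
  have hsq : √(sqDist r η θ) ^ 2 = sqDist r η θ :=
    Real.sq_sqrt ((sq_nonneg _).trans (sq_sub_le_sqDist hr.le hη θ))
  have h1 : |forceProfile k (sqDist r η θ)| * |r - η * Real.cos θ| ≤ C := by
    refine le_trans ?_ (hC _ ⟨hs1, hs2⟩)
    rw [← mul_forceProfile_sq hs0, hsq, abs_mul, abs_of_pos hs0, mul_comm]
    gcongr
    exact abs_sub_mul_cos_le r η θ
  have h2 : |Real.sin θ ^ (N - 2)| ≤ 1 := by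
    rw [abs_pow]
    exact pow_le_one₀ (abs_nonneg _) (Real.abs_sin_le_one θ)
  rw [Real.norm_eq_abs, abs_mul, abs_mul, abs_mul, abs_of_pos (by positivity : 0 < r ^ (N - 1))]
  have hC0 : 0 ≤ C := (by positivity : (0 : ℝ) ≤ _).trans h1
  calc r ^ (N - 1) * |forceProfile k (sqDist r η θ)| * |r - η * Real.cos θ| * |Real.sin θ ^ (N - 2)|
      = r ^ (N - 1) * (|forceProfile k (sqDist r η θ)| * |r - η * Real.cos θ|) *
          |Real.sin θ ^ (N - 2)| := by ring
    _ ≤ r ^ (N - 1) * C * 1 := by gcongr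
    _ = _ := mul_one _

theorem flux_trunc_eq {n : ℕ} {r η : ℝ} (hr : 0 ≤ r) (hη : 0 ≤ η) (h : 2 ≤ n * (r - η) ^ 2) :
    flux N (trunc Q n) r η = flux N Q r η := by
  have : ∀ θ, trunc Q n (sqDist r η θ) = Q (sqDist r η θ) := fun θ =>
    trunc_of_two_le (h.trans (by gcongr; exact sq_sub_le_sqDist hr hη θ))
  simp only [flux, this]

/-- Off the diagonal the distances stay bounded below for nearby η, so the flux coincides with a
truncated, continuous one. -/
theorem continuousAt_flux_right (hQ : ContinuousOn Q (Ioi 0)) {r η : ℝ} (hr : 0 < r) (hη : 0 < η)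
    (hne : r ≠ η) : ContinuousAt (fun η => flux N Q r η) η := by
  have hd : 0 < (r - η) ^ 2 / 2 := by
    have := sub_ne_zero.2 hne
    positivity
  obtain ⟨n, hn⟩ := exists_nat_gt (2 / ((r - η) ^ 2 / 2))
  rw [div_lt_iff₀ hd] at hn
  have hn0 : 0 < n := by
    rw [Nat.pos_iff_ne_zero]
    rintro rfl
    norm_num at hn
  have hn' : (0 : ℝ) < n := Nat.cast_pos.2 hn0
  have h1 : ContinuousAt (fun η => flux N (trunc Q n) r η) η :=
    ((continuous_flux (N := N) (continuous_trunc hQ hn0)).comp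
      (by fun_prop : Continuous fun η : ℝ => (r, η))).continuousAt
  refine h1.congr ?_
  have h2 : ∀ᶠ x in 𝓝 η, (r - η) ^ 2 / 2 < (r - x) ^ 2 := by
    have : ContinuousAt (fun x => (r - x) ^ 2) η := by fun_prop
    exact this.eventually_const_lt (by linarith)
  filter_upwards [h2, lt_mem_nhds hη] with x hx hx0
  exact flux_trunc_eq hr.le hx0.le (by nlinarith)

/-- Expansion of the flux in an interval with a fixed small error coefficient. -/
def FluxExpandingOn (N : ℕ) (Q : ℝ → ℝ) (R c κ ε : ℝ) : Prop :=
  ∀ η ∈ Icc (R - ε) (R + ε), ∀ r ∈ Icc (R - ε) (R + ε), ∀ r' ∈ Icc (R - ε) (R + ε), r' ≤ r →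
      c * (r - r') - κ * (|r - η| + |r' - η|) ≤ flux N Q r η - flux N Q r' η

/-- For ε ≤ R/2 all radii lie between R/2 and 3R/2, where r^(N-1) varies by a factor of at most
3^(N-1). The error coefficient compensates this factor and leaves a margin of 32 in the covariance
estimate. -/
theorem FluxExpanding.exists_fluxExpandingOn (h : FluxExpanding N Q R) (hR : 0 < R) :
    ∃ c > 0, ∃ ε > 0, ε ≤ R / 2 ∧ FluxExpandingOn N Q R c (c / (32 * 3 ^ (N - 1))) ε := by
  obtain ⟨c, hc, h⟩ := h
  obtain ⟨ε, hε, -, h⟩ := h (c / (32 * 3 ^ (N - 1))) (by positivity)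
  have hsub : Icc (R - min ε (R / 2)) (R + min ε (R / 2)) ⊆ Icc (R - ε) (R + ε) := by
    have := min_le_left ε (R / 2)
    exact Icc_subset_Icc (by linarith) (by linarith)
  exact ⟨c, hc, min ε (R / 2), by positivity, min_le_right _ _,
    fun η hη r hr r' hr' hle => h η (hsub hη) r (hsub hr) r' (hsub hr') hle⟩

/-- In the outer part of the interval the force of a mass located near `R` points outwards. -/
theorem exists_sub_mul_flux_ge (hQ : ContinuousOn Q (Ioi 0)) {c κ ε : ℝ} (hc : 0 < c)
    (hκ : 0 ≤ κ) (hκc : κ ≤ c / 32) (hε : 0 < ε) (hεR : ε ≤ R / 2)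
    (h : FluxExpandingOn N Q R c κ ε) (h0 : flux N Q R R = 0) (C : ℝ) :
    ∃ m > 0, ∃ K > 0, ∃ δ > 0, ∀ η, (∀ r, 0 < r → r ≤ R + ε → ε / 4 ≤ |r - η| → |flux N Q r η| ≤ C) →
      ∀ r, ε / 4 ≤ |r - R| → |r - R| ≤ ε / 2 → m - K * min 1 (|η - R| / δ) ≤ (r - R) * flux N Q r η := by
  have hR : 0 < R := by linarith
  have hRmem : R ∈ Icc (R - ε) (R + ε) := ⟨by linarith, by linarith⟩
  have hp : R + ε / 8 ∈ Icc (R - ε) (R + ε) := ⟨by linarith, by linarith⟩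
  have hm : R - ε / 8 ∈ Icc (R - ε) (R + ε) := ⟨by linarith, by linarith⟩
  have hcε : 0 < c * ε := by positivity
  have hκε : 0 ≤ κ * ε := by positivity
  have hκcε : κ * ε ≤ c * ε / 32 := by nlinarith
  -- Expansion from the zero of the flux at (R,R) gives its sign at R ± ε/8. These radii are off the
  -- diagonal, so the sign persists for η near `R` by continuity.
  have hpR : 0 < flux N Q (R + ε / 8) R := by
    have := h R hRmem _ hp R hRmem (by linarith)
    rw [h0, sub_self, abs_zero, show R + ε / 8 - R = ε / 8 by ring,
      abs_of_pos (by linarith)] at this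
    nlinarith
  have hmR : flux N Q (R - ε / 8) R < 0 := by
    have := h R hRmem R hRmem _ hm (by linarith)
    rw [h0, sub_self, abs_zero, show R - ε / 8 - R = -(ε / 8) by ring,
      show R - (R - ε / 8) = ε / 8 by ring, abs_neg, abs_of_pos (by linarith)] at this
    nlinarith
  have hcp : ∀ᶠ η in 𝓝 R, 0 < flux N Q (R + ε / 8) η :=
    (continuousAt_flux_right hQ (by linarith) hR (by linarith)).eventually_const_lt hpR
  have hcm : ∀ᶠ η in 𝓝 R, flux N Q (R - ε / 8) η < 0 :=
    (continuousAt_flux_right hQ (by linarith) hR (by linarith)).eventually_lt_const hmR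
  obtain ⟨δ', hδ', hball⟩ := Metric.eventually_nhds_iff.1 (hcp.and hcm)
  set δ := min δ' (ε / 8) with hδ
  have hδ0 : 0 < δ := by positivity
  set C' := max C 0 with hC'
  have hC'0 : 0 ≤ C' := le_max_right _ _
  have hsign : ∀ r, ε / 4 ≤ |r - R| → |r - R| ≤ ε / 2 → r ∈ Icc (R - ε) (R + ε) ∧
      ((R + ε / 4 ≤ r ∧ r ≤ R + ε / 2) ∨ (r ≤ R - ε / 4 ∧ R - ε / 2 ≤ r)) := by
    intro r h1 h2
    rw [abs_le] at h2
    rw [le_abs] at h1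
    refine ⟨⟨by linarith, by linarith⟩, ?_⟩
    rcases h1 with h1 | h1
    · exact Or.inl ⟨by linarith, by linarith⟩
    · exact Or.inr ⟨by linarith, by linarith⟩
  have hnear : ∀ η, |η - R| < δ → ∀ r, ε / 4 ≤ |r - R| → |r - R| ≤ ε / 2 →
      c * ε ^ 2 / 64 ≤ (r - R) * flux N Q r η := by
    intro η hη r h1 h2
    obtain ⟨hr, hcase⟩ := hsign r h1 h2
    obtain ⟨hη1, hη2⟩ := hball (y := η) (by
      rw [Real.dist_eq]; exact hη.trans_le (min_le_left _ _))
    have hη3 : |η - R| < ε / 8 := hη.trans_le (min_le_right _ _)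
    rw [abs_lt] at hη3
    have hηm : η ∈ Icc (R - ε) (R + ε) := ⟨by linarith, by linarith⟩
    have hsmall : ∀ a b : ℝ, |a| ≤ ε * (5 / 8) → |b| ≤ ε / 4 → κ * (|a| + |b|) ≤ c * ε / 32 := by
      intro a b ha hb
      refine (mul_le_mul_of_nonneg_left (add_le_add ha hb) hκ).trans ?_
      nlinarith
    rcases hcase with ⟨h3, h4⟩ | ⟨h3, h4⟩
    · have h5 := h η hηm r hr _ hp (by linarith)
      have h6 := hsmall (r - η) (R + ε / 8 - η) (abs_le.2 ⟨by linarith, by linarith⟩)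
        (abs_le.2 ⟨by linarith, by linarith⟩)
      have h7 : c * (ε / 8) ≤ c * (r - (R + ε / 8)) := by gcongr; linarith
      have h8 : c * ε / 16 ≤ flux N Q r η := by linarith
      calc c * ε ^ 2 / 64 = ε / 4 * (c * ε / 16) := by ring
        _ ≤ (r - R) * flux N Q r η := by
            gcongr
            · linarith
            · linarith
    · have h5 := h η hηm _ hm r hr (by linarith)
      have h6 := hsmall (r - η) (R - ε / 8 - η) (abs_le.2 ⟨by linarith, by linarith⟩)
        (abs_le.2 ⟨by linarith, by linarith⟩)
      have h7 : c * (ε / 8) ≤ c * (R - ε / 8 - r) := by gcongr; linarith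
      have h8 : c * ε / 16 ≤ -flux N Q r η := by linarith
      calc c * ε ^ 2 / 64 = ε / 4 * (c * ε / 16) := by ring
        _ ≤ (R - r) * (-flux N Q r η) := by
            gcongr
            · linarith
            · linarith
        _ = _ := by ring
  -- Only a one-sided bound is needed. If η is away from `r` the bound `C` applies; if η is close to
  -- `r`, expansion compares `r` with the opposite end R - ε or R + ε of the interval, which is far
  -- from η.
  have hfar : ∀ η, (∀ r, 0 < r → r ≤ R + ε → ε / 4 ≤ |r - η| → |flux N Q r η| ≤ C) →
      ∀ r, ε / 4 ≤ |r - R| → |r - R| ≤ ε / 2 → -(ε / 2 * C') ≤ (r - R) * flux N Q r η := by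
    intro η hη r h1 h2
    obtain ⟨hr, hcase⟩ := hsign r h1 h2
    have hη' : ∀ r, 0 < r → r ≤ R + ε → ε / 4 ≤ |r - η| → |flux N Q r η| ≤ C' := fun r a b d =>
      (hη r a b d).trans (le_max_left _ _)
    have hr0 : 0 < r := by linarith [hr.1]
    rcases le_or_gt (ε / 4) |r - η| with h3 | h3
    · have h4 : |(r - R) * flux N Q r η| ≤ ε / 2 * C' := by
        rw [abs_mul]
        gcongr
        exact hη' r hr0 hr.2 h3
      exact (abs_le.1 h4).1
    · rw [abs_lt] at h3
      rcases hcase with ⟨h4, h5⟩ | ⟨h4, h5⟩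
      · have hηm : η ∈ Icc (R - ε) (R + ε) := ⟨by linarith, by linarith⟩
        have h6 := h η hηm r hr (R - ε) ⟨le_rfl, by linarith⟩ hr.1
        have h7 := (abs_le.1 (hη' (R - ε) (by linarith) (by linarith) (le_abs.2 (Or.inr (by linarith))))).1
        have h8 : κ * (|r - η| + |R - ε - η|) ≤ κ * (3 * ε) := by
          gcongr
          have e1 : |r - η| ≤ ε := abs_le.2 ⟨by linarith, by linarith⟩
          have e2 : |R - ε - η| ≤ 2 * ε := abs_le.2 ⟨by linarith, by linarith⟩
          linarith
        have h9 : c * ε ≤ c * (r - (R - ε)) := by gcongr; linarith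
        have h10 : -C' ≤ flux N Q r η := by nlinarith
        have h11 : 0 ≤ r - R := by linarith
        nlinarith
      · have hηm : η ∈ Icc (R - ε) (R + ε) := ⟨by linarith, by linarith⟩
        have h6 := h η hηm (R + ε) ⟨by linarith, le_rfl⟩ r hr hr.2
        have h7 := (abs_le.1 (hη' (R + ε) (by linarith) (by linarith) (le_abs.2 (Or.inl (by linarith))))).2
        have h8 : κ * (|R + ε - η| + |r - η|) ≤ κ * (3 * ε) := by
          gcongr
          have e1 : |r - η| ≤ ε := abs_le.2 ⟨by linarith, by linarith⟩
          have e2 : |R + ε - η| ≤ 2 * ε := abs_le.2 ⟨by linarith, by linarith⟩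
          linarith
        have h9 : c * ε ≤ c * (R + ε - r) := by gcongr; linarith
        have h10 : flux N Q r η ≤ C' := by nlinarith
        have h11 : 0 ≤ R - r := by linarith
        nlinarith
  -- `K` is chosen so that m - K, the value for |η - R| ≥ δ, is exactly the far bound -ε C'/2.
  refine ⟨c * ε ^ 2 / 64, by positivity, c * ε ^ 2 / 64 + ε / 2 * C', by positivity, δ, hδ0,
    fun η hη r h1 h2 => ?_⟩
  have hmin : 0 ≤ min 1 (|η - R| / δ) := by positivity
  rcases lt_or_ge |η - R| δ with h3 | h3
  · have h4 := hnear η h3 r h1 h2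
    have : 0 ≤ (c * ε ^ 2 / 64 + ε / 2 * C') * min 1 (|η - R| / δ) := by positivity
    linarith
  · rw [min_eq_left ((one_le_div hδ0).2 h3), mul_one]
    have h4 := hfar η hη r h1 h2
    linarith

variable [NeZero N] {W : Space N → ℝ} {μ : ℝ → Measure (Space N)} {p : ℝ}

/-- Both settings bound k' at all distances that matter: a Sobolev gradient on the whole half-line
beyond ε, a fixed ball because only distances in the compact interval [ε, B + ρ] occur. -/
theorem IsLpRadialSolution.exists_abs_flux_le (hN : 2 ≤ N) (hWk : ∀ x, x ≠ 0 → W x = k ‖x‖)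
    (hk : ContDiffOn ℝ 3 k (Ioi 0)) (hμ : IsLpRadialSolution W p μ) {ε : ℝ} (hε : 0 < ε) (B : ℝ) :
    ∃ C, ∀ t, 0 ≤ t → ∀ᵐ η ∂(radialPart (μ t)), 0 ≤ η ∧
      ∀ r, 0 < r → r ≤ B → ε ≤ |r - η| → |flux N (forceProfile k) r η| ≤ C := by
  have key : ∀ C, 0 ≤ C → ∀ r η, 0 < r → r ≤ B → 0 ≤ η → ε ≤ |r - η| →
      (∀ s ∈ Icc |r - η| (r + η), |deriv k s| ≤ C) →
      |flux N (forceProfile k) r η| ≤ B ^ (N - 1) * C * Real.pi := by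
    intro C hC r η hr hrB hη hd h
    have hne : r ≠ η := by
      rintro rfl
      simp at hd
      linarith
    refine (abs_flux_le_of_abs_deriv_le hr hη hne h).trans ?_
    have := Real.pi_pos
    gcongr
  rcases hμ.setting with ⟨q, hq, hS⟩ | ⟨ρ, hρ⟩
  · obtain ⟨C, hC⟩ := exists_abs_deriv_le_of_gradMemSobolev hN hWk hk hq.symm.lt.le hS hε
    have hC0 : 0 ≤ C := (abs_nonneg _).trans (hC ε le_rfl)
    refine ⟨B ^ (N - 1) * C * Real.pi, fun t ht => ?_⟩
    have h1 : ∀ᵐ η ∂(radialPart (μ t)), 0 ≤ η :=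
      (ae_map_iff measurable_norm.aemeasurable measurableSet_Ici).2
        (Eventually.of_forall fun x => norm_nonneg x)
    filter_upwards [h1] with η hη
    exact ⟨hη, fun r hr hrB hd => key C hC0 r η hr hrB hη hd fun s hs => hC s (hd.trans hs.1)⟩
  · obtain ⟨C, hC⟩ := (isCompact_Icc (a := ε) (b := B + ρ)).exists_bound_of_continuousOn
      ((contDiffOn_deriv_profile hk).continuousOn.mono fun s hs => hε.trans_le hs.1)
    refine ⟨B ^ (N - 1) * max C 0 * Real.pi, fun t ht => ?_⟩
    have h1 : ∀ᵐ η ∂(radialPart (μ t)), η ∈ Icc 0 ρ := by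
      refine (ae_map_iff measurable_norm.aemeasurable measurableSet_Icc).2 ?_
      have h2 : ∀ᵐ x ∂(μ t), x ∈ Metric.closedBall (0 : Space N) ρ := hρ t ht
      filter_upwards [h2] with x hx
      exact ⟨norm_nonneg x, by simpa using hx⟩
    filter_upwards [h1] with η hη
    refine ⟨hη.1, fun r hr hrB hd => key _ (le_max_right _ _) r η hr hrB hη.1 hd fun s hs => ?_⟩
    exact (hC s ⟨hd.trans hs.1, by linarith [hs.2, hη.2]⟩).trans (le_max_left _ _)

end SphericalShell

/-! ### Confinement of the mass near the shell -/

namespace SphericalShell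

variable {N : ℕ} {k : ℝ → ℝ} {R : ℝ}

theorem surf_univ_ne_zero (hN : 2 ≤ N) : surf N univ ≠ 0 := by
  obtain ⟨n, rfl⟩ : ∃ n, N = n + 2 := ⟨N - 2, by omega⟩
  intro h
  have := area_pos n
  rw [area, Measure.real, h] at this
  simp at this

theorem integral_shell (hN : 2 ≤ N) (hR : 0 ≤ R) {f : ℝ → ℝ} (hf : Continuous f) :
    ∫ x, f ‖x‖ ∂(shell N R) = f R := by
  have h0 := surf_univ_ne_zero hN
  have : IsFiniteMeasure (surf N) := by unfold surf; infer_instance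
  have h1 : surf N univ ≠ ⊤ := measure_ne_top _ _
  have hm : Measurable fun y : Metric.sphere (0 : Space N) 1 => R • (y : Space N) :=
    (by fun_prop : Continuous fun y : Metric.sphere (0 : Space N) 1 => R • (y : Space N)).measurable
  have hc : Continuous fun x : Space N => f ‖x‖ := hf.comp continuous_norm
  rw [shell, integral_map hm.aemeasurable hc.aestronglyMeasurable]
  have h2 : ∀ y : Metric.sphere (0 : Space N) 1, ‖R • (y : Space N)‖ = R := fun y => by
    rw [norm_smul, Real.norm_of_nonneg hR]; simp
  simp only [h2]
  rw [integral_const, Measure.real, Measure.smul_apply, smul_eq_mul, smul_eq_mul,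
    ENNReal.inv_mul_cancel h0 h1]
  simp

theorem WeakStarTendsto.tendsto_integral {μ : ℝ → Measure (Space N)}
    (h : WeakStarTendsto μ (shell N R)) (hN : 2 ≤ N) (hR : 0 ≤ R) {f : ℝ → ℝ} (hf : Continuous f)
    {C : ℝ} (hC : ∀ r, |f r| ≤ C) :
    Tendsto (fun t => ∫ r, f r ∂(radialPart (μ t))) atTop (𝓝 (f R)) := by
  obtain ⟨F, hF⟩ := exists_boundedContinuous_norm (N := N) hf hC
  have h1 := h F
  simp only [hF, integral_shell hN hR hf] at h1
  simpa only [integral_radialPart _ hf] using h1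

theorem ae_radialPart_nonneg (μ : Measure (Space N)) : ∀ᵐ η ∂(radialPart μ), 0 ≤ η :=
  (ae_map_iff measurable_norm.aemeasurable measurableSet_Ici).2
    (Eventually.of_forall fun x => norm_nonneg x)

variable [NeZero N] {W : Space N → ℝ} {μ : ℝ → Measure (Space N)} {p : ℝ}

theorem pow_mul_radialVelocity {A : ℝ} (hA : ∀ r, 0 < r → ∀ η, 0 ≤ η →
      r ^ (N - 1) * omega W r η = A * flux N (forceProfile k) r η) (μ : Measure (Space N)) {r : ℝ}
    (hr : 0 < r) : r ^ (N - 1) * radialVelocity W μ r =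
      A * ∫ η, flux N (forceProfile k) r η ∂(radialPart μ) := by
  rw [radialVelocity, ← integral_const_mul, ← integral_const_mul]
  refine integral_congr_ae ?_
  filter_upwards [ae_radialPart_nonneg μ] with η hη
  exact hA r hr η hη

theorem IsRadialSolution.integrable_flux (hμ : IsRadialSolution W μ) {A : ℝ} (hA0 : 0 < A)
    (hA : ∀ r, 0 < r → ∀ η, 0 ≤ η →
      r ^ (N - 1) * omega W r η = A * flux N (forceProfile k) r η) {t : ℝ} (ht : 0 < t) {r : ℝ}
    (hr : 0 < r) : Integrable (fun η => flux N (forceProfile k) r η) (radialPart (μ t)) := by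
  refine ((hμ.integrable_velocity t ht r hr).const_mul (A⁻¹ * r ^ (N - 1))).congr ?_
  filter_upwards [ae_radialPart_nonneg (μ t)] with η hη
  rw [mul_assoc, hA r hr η hη, inv_mul_cancel_left₀ hA0.ne']

/-- A radial cutoff equal to one for `|r - R| ≤ ε / 4` and to zero for `|r - R| ≥ ε / 2`. -/
noncomputable def cutoff (R ε r : ℝ) : ℝ :=
  Real.smoothTransition (16 / (3 * ε ^ 2) * (ε ^ 2 / 4 - (r - R) ^ 2))

theorem contDiff_cutoff (R ε : ℝ) : ContDiff ℝ ∞ (cutoff R ε) :=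
  Real.smoothTransition.contDiff.comp (by fun_prop)

theorem cutoff_eq_zero {ε r : ℝ} (hε : 0 < ε) (h : ε / 2 ≤ |r - R|) : cutoff R ε r = 0 := by
  refine Real.smoothTransition.zero_of_nonpos
    (mul_nonpos_of_nonneg_of_nonpos (by positivity) ?_)
  rw [← sq_abs (r - R)]
  nlinarith

theorem cutoff_center {ε : ℝ} (hε : 0 < ε) : cutoff R ε R = 1 := by
  refine Real.smoothTransition.one_of_one_le ?_
  rw [sub_self, show 16 / (3 * ε ^ 2) * (ε ^ 2 / 4 - 0 ^ 2) = 4 / 3 by field_simp; ring]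
  norm_num

theorem tsupport_cutoff_subset {ε : ℝ} (hε : 0 < ε) :
    tsupport (cutoff R ε) ⊆ Icc (R - ε / 2) (R + ε / 2) := by
  refine closure_minimal (fun r hr => ?_) isClosed_Icc
  by_contra h
  refine hr (cutoff_eq_zero hε ?_)
  by_contra h2
  obtain ⟨h3, h4⟩ := abs_lt.1 (not_le.1 h2)
  exact h ⟨by linarith, by linarith⟩

theorem deriv_cutoff (R ε r : ℝ) : deriv (cutoff R ε) r =
    -(deriv Real.smoothTransition (16 / (3 * ε ^ 2) * (ε ^ 2 / 4 - (r - R) ^ 2)) *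
      (16 / (3 * ε ^ 2)) * 2) * (r - R) := by
  have h := (Real.smoothTransition.contDiff (n := 1)).differentiable one_ne_zero
    (16 / (3 * ε ^ 2) * (ε ^ 2 / 4 - (r - R) ^ 2))
  have h2 : HasDerivAt (fun r : ℝ => 16 / (3 * ε ^ 2) * (ε ^ 2 / 4 - (r - R) ^ 2))
      (16 / (3 * ε ^ 2) * (-(2 * (r - R)))) r := by
    simpa using ((((hasDerivAt_id r).sub_const R).pow 2).const_sub (ε ^ 2 / 4)).const_mul
      (16 / (3 * ε ^ 2))
  have h3 := (h.hasDerivAt.comp r h2).deriv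
  rw [show deriv (cutoff R ε) r = _ from h3]
  ring

theorem deriv_cutoff_eq_zero {ε r : ℝ} (hε : 0 < ε) (h : |r - R| < ε / 4 ∨ ε / 2 < |r - R|) :
    deriv (cutoff R ε) r = 0 := by
  have : deriv Real.smoothTransition (16 / (3 * ε ^ 2) * (ε ^ 2 / 4 - (r - R) ^ 2)) = 0 := by
    rw [← sq_abs (r - R)]
    have h0 := abs_nonneg (r - R)
    rcases h with h | h
    -- The normalization 16/(3ε²) makes the argument equal to one exactly at |r - R| = ε/4, since
    -- ε²/4 - ε²/16 = 3ε²/16.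
    · refine deriv_smoothTransition_of_one_lt ?_
      rw [div_mul_eq_mul_div, lt_div_iff₀ (by positivity)]
      nlinarith
    · refine deriv_smoothTransition_of_neg (mul_neg_of_pos_of_neg (by positivity) ?_)
      nlinarith
  rw [deriv_cutoff, this]
  ring

/-- A solution that converges to the shell and whose velocity points outwards at the boundary of an
interval around `R` stays in this interval. -/
theorem IsRadialSolution.exists_forall_ae_mem_Icc (hμ : IsRadialSolution W μ) (hN : 2 ≤ N)
    (hlim : WeakStarTendsto μ (shell N R)) {ε : ℝ} (hε : 0 < ε) (hεR : ε ≤ R / 2)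
    (hv : ∀ᶠ t in atTop, ∀ r, ε / 4 ≤ |r - R| → |r - R| ≤ ε / 2 →
      0 ≤ (r - R) * radialVelocity W (μ t) r) :
    ∃ T > 0, ∀ t, T ≤ t → ∀ᵐ r ∂(radialPart (μ t)), r ∈ Icc (R - ε / 2) (R + ε / 2) := by
  obtain ⟨T₀, hT₀⟩ := eventually_atTop.1 hv
  set T := max T₀ 1 with hT
  have hT0 : 0 < T := one_pos.trans_le (le_max_right _ _)
  have hts := tsupport_cutoff_subset (R := R) hε
  have hs := contDiff_cutoff R ε
  have hc : HasCompactSupport (cutoff R ε) :=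
    isCompact_Icc.of_isClosed_subset (isClosed_tsupport _) hts
  have h0 : tsupport (cutoff R ε) ⊆ Ioi 0 := fun r hr =>
    (by linarith [(hts hr).1] : (0 : ℝ) < r)
  have hle : ∀ r, cutoff R ε r ≤ 1 := fun r => Real.smoothTransition.le_one _
  have hnn : ∀ r, 0 ≤ cutoff R ε r := fun r => Real.smoothTransition.nonneg _
  -- The cutoff slopes towards `R` only where the velocity points away from `R`.
  have hneg : ∀ t, T ≤ t → ∀ r, radialVelocity W (μ t) r * deriv (cutoff R ε) r ≤ 0 := by
    intro t ht r
    by_cases h : ε / 4 ≤ |r - R| ∧ |r - R| ≤ ε / 2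
    · have h1 := hT₀ t ((le_max_left _ _).trans ht) r h.1 h.2
      rw [deriv_cutoff]
      have h2 := deriv_smoothTransition_nonneg (16 / (3 * ε ^ 2) * (ε ^ 2 / 4 - (r - R) ^ 2))
      have h3 : 0 ≤ deriv Real.smoothTransition (16 / (3 * ε ^ 2) * (ε ^ 2 / 4 - (r - R) ^ 2)) *
          (16 / (3 * ε ^ 2)) * 2 := by positivity
      nlinarith
    · rw [deriv_cutoff_eq_zero hε, mul_zero]
      by_contra! h2
      exact h h2
  refine ⟨T, hT0, fun t ht => ?_⟩
  have ht0 : 0 < t := hT0.trans_le ht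
  have := hμ.prob t ht0.le
  have := isProbabilityMeasure_radialPart (μ t)
  -- From `T` on the integral of the cutoff is nonincreasing, and its limit is the value one at `R`;
  -- so it is never below one.
  have hge : 1 ≤ ∫ r, cutoff R ε r ∂(radialPart (μ t)) := by
    have h1 := hlim.tendsto_integral hN (by linarith) hs.continuous (C := 1) fun r => by
      rw [abs_of_nonneg (hnn r)]; exact hle r
    rw [cutoff_center hε] at h1
    refine le_of_tendsto h1 ?_
    filter_upwards [eventually_ge_atTop t] with s hts
    have h2 := hμ.integral_sub_integral hs hc h0 ht0 hts
    have h3 : ∫ t in t..s, ∫ r, radialVelocity W (μ t) r * deriv (cutoff R ε) r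
        ∂(radialPart (μ t)) ≤ ∫ t in t..s, (0 : ℝ) := by
      have hi := hμ.integrableOn_velocity hs hc h0 ht0 s
      refine intervalIntegral.integral_mono_on hts
        ((intervalIntegrable_iff_integrableOn_Ioc_of_le hts).2 hi) (by simp) fun u hu => ?_
      exact integral_nonpos fun r => hneg u (ht.trans hu.1) r
    rw [intervalIntegral.integral_zero] at h3
    linarith
  have hint := hμ.integrable_of_hasCompactSupport hs.continuous hc ht0.le
  have h1 : ∫ r, (1 - cutoff R ε r) ∂(radialPart (μ t)) = 0 := by
    refine le_antisymm ?_ (integral_nonneg fun r => sub_nonneg.2 (hle r))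
    rw [integral_sub (integrable_const _) hint]
    simpa using hge
  rw [integral_eq_zero_iff_of_nonneg (fun r => sub_nonneg.2 (hle r))
    ((integrable_const _).sub hint)] at h1
  filter_upwards [h1] with r hr
  refine hts (subset_tsupport _ fun h => ?_)
  simp [h] at hr

/-- A solution that converges to the shell is concentrated near the sphere for large times. -/
theorem IsLpRadialSolution.exists_forall_ae_mem_Icc (hN : 2 ≤ N)
    (hWk : ∀ x, x ≠ 0 → W x = k ‖x‖) (hk : ContDiffOn ℝ 3 k (Ioi 0))
    (hμ : IsLpRadialSolution W p μ) (hlim : WeakStarTendsto μ (shell N R)) {c κ ε : ℝ} (hc : 0 < c)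
    (hκ : 0 ≤ κ) (hκc : κ ≤ c / 32) (hε : 0 < ε) (hεR : ε ≤ R / 2)
    (h : FluxExpandingOn N (forceProfile k) R c κ ε) (hC0 : omega W R R = 0) :
    ∃ T > 0, ∀ t, T ≤ t → ∀ᵐ r ∂(radialPart (μ t)), r ∈ Icc (R - ε / 2) (R + ε / 2) := by
  have hR : 0 < R := by linarith
  obtain ⟨A, hA0, hA⟩ := exists_omega_eq_flux hN hWk hk
  have h0 : flux N (forceProfile k) R R = 0 := by
    have := hA R hR R hR.le
    rw [hC0, mul_zero] at this
    exact (mul_eq_zero.1 this.symm).resolve_left hA0.ne'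
  obtain ⟨C, hC⟩ := hμ.exists_abs_flux_le hN hWk hk (by positivity : 0 < ε / 4) (R + ε)
  obtain ⟨m, hm, K, hK, δ, hδ, hmK⟩ := exists_sub_mul_flux_ge
    (contDiffOn_forceProfile hk).continuousOn hc hκ hκc hε hεR h h0 C
  refine hμ.solution.exists_forall_ae_mem_Icc hN hlim hε hεR ?_
  have hg : Continuous fun η : ℝ => min 1 (|η - R| / δ) := by fun_prop
  have hg0 : ∀ η : ℝ, 0 ≤ min 1 (|η - R| / δ) := fun η => by positivity
  have hg1 : ∀ η : ℝ, |min 1 (|η - R| / δ)| ≤ 1 := fun η => by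
    rw [abs_of_nonneg (hg0 η)]; exact min_le_left _ _
  -- The penalty min(1, |η - R|/δ) is bounded, continuous and zero at `R`, so its mean tends to zero
  -- and the averaged flux becomes outward, uniformly in `r`.
  have hgl := hlim.tendsto_integral hN hR.le hg hg1
  simp only [sub_self, abs_zero, zero_div] at hgl
  rw [min_eq_right zero_le_one] at hgl
  filter_upwards [hgl.eventually_lt_const (show 0 < m / K by positivity), eventually_gt_atTop 0]
    with t ht ht0 r h1 h2
  have := hμ.solution.prob t ht0.le
  have := isProbabilityMeasure_radialPart (μ t)
  have hr : 0 < r := by linarith [(abs_le.1 h2).1]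
  have hint := hμ.solution.integrable_flux hA0 hA ht0 hr
  have hgi : Integrable (fun η : ℝ => min 1 (|η - R| / δ)) (radialPart (μ t)) :=
    Integrable.of_bound hg.aestronglyMeasurable 1 (Eventually.of_forall hg1)
  have h3 : m - K * ∫ η, min 1 (|η - R| / δ) ∂(radialPart (μ t)) ≤
      (r - R) * ∫ η, flux N (forceProfile k) r η ∂(radialPart (μ t)) := by
    have h4 : ∫ η, (m - K * min 1 (|η - R| / δ)) ∂(radialPart (μ t)) ≤
        ∫ η, (r - R) * flux N (forceProfile k) r η ∂(radialPart (μ t)) := by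
      refine integral_mono_ae ((integrable_const _).sub (hgi.const_mul K)) (hint.const_mul _) ?_
      filter_upwards [hC t ht0.le] with η hη
      exact hmK η hη.2 r h1 h2
    rw [integral_sub (integrable_const _) (hgi.const_mul K), integral_const_mul,
      integral_const_mul] at h4
    simpa using h4
  rw [lt_div_iff₀ hK] at ht
  have h5 : 0 ≤ (r - R) * ∫ η, flux N (forceProfile k) r η ∂(radialPart (μ t)) := by linarith
  have h6 := pow_mul_radialVelocity hA (μ t) hr
  have h7 : 0 < r ^ (N - 1) := by positivity
  have h8 : r ^ (N - 1) * ((r - R) * radialVelocity W (μ t) r) =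
      A * ((r - R) * ∫ η, flux N (forceProfile k) r η ∂(radialPart (μ t))) := by
    linear_combination (r - R) * h6
  refine nonneg_of_mul_nonneg_right (h8 ▸ mul_nonneg hA0.le h5) h7

end SphericalShell

/-! ### Variance, covariance and localization in the radius -/

namespace SphericalShell

/-- `L` is merely integrable, so `M` is absolutely continuous rather than C^1, and the chain rule
for its square comes from integration by parts for absolutely continuous functions. -/
theorem sq_sub_sq_eq_integral {L M : ℝ → ℝ} {a b : ℝ} (hab : a ≤ b)
    (hL : IntervalIntegrable L volume a b)
    (hM : ∀ x ∈ Icc a b, M x - M a = ∫ t in a..x, L t) :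
    M b ^ 2 - M a ^ 2 = 2 * ∫ t in a..b, M t * L t := by
  set G : ℝ → ℝ := fun x => ∫ t in a..x, L t with hG
  have hac : AbsolutelyContinuousOnInterval G a b :=
    hL.absolutelyContinuousOnInterval_intervalIntegral (c := a) (by simp)
  have h1 := hac.integral_deriv_mul_eq_sub hac
  have h2 : ∫ x in a..b, deriv G x * G x + G x * deriv G x = ∫ x in a..b, 2 * (G x * L x) := by
    refine intervalIntegral.integral_congr_ae ?_
    filter_upwards [hL.ae_hasDerivAt_integral] with x hx hx2
    rw [(hx (uIoc_subset_uIcc hx2) a (by simp)).deriv]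
    ring
  have hGa : G a = 0 := by simp [hG]
  rw [h2, hGa, intervalIntegral.integral_const_mul] at h1
  have hGL : IntervalIntegrable (fun t => G t * L t) volume a b :=
    hL.continuousOn_mul hac.continuousOn
  have h3 : ∫ t in a..b, M t * L t = ∫ t in a..b, (M a * L t + G t * L t) := by
    refine intervalIntegral.integral_congr fun t ht => ?_
    rw [uIcc_of_le hab] at ht
    simp only [hG]
    rw [← hM t ht]
    ring
  rw [h3, intervalIntegral.integral_add (hL.const_mul _) hGL, intervalIntegral.integral_const_mul]
  have h4 : M b - M a = G b := hM b ⟨hab, le_rfl⟩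
  have h5 : ∫ t in a..b, L t = G b := rfl
  rw [h5]
  rw [eq_add_of_sub_eq h4]
  linear_combination -h1

/-- A covariance is nonnegative if one of the variables is increasing up to an error controlled by
the mean deviations. -/
theorem integral_mul_integral_le_of_mul_sub_ge {ν : Measure ℝ} [IsProbabilityMeasure ν] {J : Set ℝ}
    (hJ : ∀ᵐ r ∂ν, r ∈ J) {f V : ℝ → ℝ} (hf : Integrable f ν) (hV : Integrable V ν)
    (hfV : Integrable (fun r => f r * V r) ν) (h1 : Integrable (fun r => r) ν)
    (h2 : Integrable (fun r => r ^ 2) ν) {m K : ℝ} (hK : 0 ≤ K) (hmK : 2 * K ≤ m)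
    (h : ∀ r ∈ J, ∀ s ∈ J, m * (r - s) ^ 2 - K * (|r - s| * (∫ η, |r - η| ∂ν + ∫ η, |s - η| ∂ν)) ≤
      (f r - f s) * (V r - V s)) :
    (∫ r, f r ∂ν) * ∫ r, V r ∂ν ≤ ∫ r, f r * V r ∂ν := by
  set e := ∫ r, r ∂ν with he
  set q := ∫ r, r ^ 2 ∂ν with hq
  have hsq : ∀ r : ℝ, Integrable (fun s => (r - s) ^ 2) ν ∧
      ∫ s, (r - s) ^ 2 ∂ν = r ^ 2 - 2 * r * e + q := by
    intro r
    have h3 : ∀ s : ℝ, (r - s) ^ 2 = r ^ 2 - 2 * r * s + s ^ 2 := fun s => by ring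
    simp only [h3]
    have h4 : Integrable (fun s => r ^ 2 - 2 * r * s) ν :=
      (integrable_const _).sub (h1.const_mul _)
    refine ⟨h4.add h2, ?_⟩
    rw [integral_add h4 h2, integral_sub (integrable_const _) (h1.const_mul _), integral_const_mul]
    simp [he, hq]
  set C : ℝ → ℝ := fun r => r ^ 2 - 2 * r * e + q with hC
  have hCi : Integrable C ν ∧ ∫ r, C r ∂ν = 2 * q - 2 * e ^ 2 := by
    have h4 : Integrable (fun r => 2 * r * e) ν := (h1.const_mul 2).mul_const e
    have h5 : Integrable (fun r => r ^ 2 - 2 * r * e) ν := h2.sub h4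
    refine ⟨h5.add (integrable_const _), ?_⟩
    simp only [hC]
    rw [integral_add h5 (integrable_const _), integral_sub h2 h4, integral_mul_const,
      integral_const_mul]
    simp only [← he, ← hq, integral_const, probReal_univ, smul_eq_mul]
    ring
  set D := 2 * q - 2 * e ^ 2 with hD
  have hC0 : ∀ r, 0 ≤ C r := fun r => by
    rw [hC]; simp only
    rw [← (hsq r).2]
    exact integral_nonneg fun s => sq_nonneg _
  have hD0 : 0 ≤ D := by
    rw [← hCi.2]
    exact integral_nonneg hC0
  have habs : ∀ r : ℝ, Integrable (fun η => |r - η|) ν := fun r => ((integrable_const r).sub h1).abs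
  -- Young's inequality under the integral converts mean deviations into the second moments `C r`
  -- about `r`.
  have hB : ∀ x r : ℝ, |x| * ∫ η, |r - η| ∂ν ≤ (x ^ 2 + C r) / 2 := by
    intro x r
    have h3 : ∫ η, |x| * |r - η| ∂ν ≤ ∫ η, (x ^ 2 + (r - η) ^ 2) / 2 ∂ν := by
      refine integral_mono ((habs r).const_mul _)
        (((integrable_const _).add (hsq r).1).div_const 2) fun η => ?_
      simp only
      nlinarith [sq_nonneg (|x| - |r - η|), sq_abs x, sq_abs (r - η)]
    rw [integral_const_mul, integral_div, integral_add (integrable_const _) (hsq r).1,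
      (hsq r).2] at h3
    simpa using h3
  have hpt : ∀ r ∈ J, ∀ s ∈ J, (m - K) * (r - s) ^ 2 - K / 2 * (C r + C s) ≤
      (f r - f s) * (V r - V s) := by
    intro r hr s hs
    refine le_trans ?_ (h r hr s hs)
    have h3 := mul_le_mul_of_nonneg_left (add_le_add (hB (r - s) r) (hB (r - s) s)) hK
    nlinarith
  set If := ∫ r, f r ∂ν with hIf
  set IV := ∫ r, V r ∂ν with hIV
  set IfV := ∫ r, f r * V r ∂ν with hIfV
  have hin : ∀ r ∈ J, (m - K) * C r - K / 2 * (C r + D) ≤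
      f r * V r - f r * IV - V r * If + IfV := by
    intro r hr
    have hi1 : Integrable (fun s => (m - K) * (r - s) ^ 2) ν := (hsq r).1.const_mul _
    have hi2 : Integrable (fun s => K / 2 * (C r + C s)) ν :=
      ((integrable_const _).add hCi.1).const_mul _
    have he1 : ∀ s, (f r - f s) * (V r - V s) = f r * V r - f r * V s - V r * f s + f s * V s :=
      fun s => by ring
    have hj1 : Integrable (fun s => f r * V r - f r * V s) ν :=
      (integrable_const _).sub (hV.const_mul _)
    have hj2 : Integrable (fun s => f r * V r - f r * V s - V r * f s) ν :=
      hj1.sub (hf.const_mul _)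
    have h3 : ∫ s, ((m - K) * (r - s) ^ 2 - K / 2 * (C r + C s)) ∂ν ≤
        ∫ s, (f r * V r - f r * V s - V r * f s + f s * V s) ∂ν := by
      refine integral_mono_ae (hi1.sub hi2) (hj2.add hfV) ?_
      filter_upwards [hJ] with s hs
      rw [← he1]
      exact hpt r hr s hs
    rw [integral_sub hi1 hi2, integral_const_mul, integral_const_mul,
      integral_add (integrable_const _) hCi.1, (hsq r).2, hCi.2, integral_add hj2 hfV,
      integral_sub hj1 (hf.const_mul _), integral_sub (integrable_const _) (hV.const_mul _),
      integral_const_mul, integral_const_mul, integral_const_mul] at h3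
    simp only [integral_const, probReal_univ, smul_eq_mul, one_mul, ← hIf, ← hIV, ← hIfV] at h3
    exact h3
  have hk1 : Integrable (fun r => (m - K) * C r) ν := hCi.1.const_mul _
  have hk2 : Integrable (fun r => K / 2 * (C r + D)) ν :=
    (hCi.1.add (integrable_const _)).const_mul _
  have hl1 : Integrable (fun r => f r * V r - f r * IV) ν := hfV.sub (hf.mul_const _)
  have hl2 : Integrable (fun r => f r * V r - f r * IV - V r * If) ν := hl1.sub (hV.mul_const _)
  have h4 : ∫ r, ((m - K) * C r - K / 2 * (C r + D)) ∂ν ≤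
      ∫ r, (f r * V r - f r * IV - V r * If + IfV) ∂ν := by
    refine integral_mono_ae (hk1.sub hk2) (hl2.add (integrable_const _)) ?_
    filter_upwards [hJ] with r hr
    exact hin r hr
  rw [integral_sub hk1 hk2, integral_const_mul, integral_const_mul,
    integral_add hCi.1 (integrable_const _), hCi.2, integral_add hl2 (integrable_const _),
    integral_sub hl1 (hV.mul_const _), integral_sub hfV (hf.mul_const _), integral_mul_const,
    integral_mul_const] at h4
  simp only [integral_const, probReal_univ, smul_eq_mul, one_mul, ← hIf, ← hIV, ← hIfV] at h4
  -- After integration in both variables the lower bound is (m - K) D - K D, where `D` is twice the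
  -- variance; this is why 2K ≤ m is required.
  have h5 : 0 ≤ (m - 2 * K) * D := mul_nonneg (by linarith) hD0
  nlinarith

/-- Powers of `r` are not admissible in the continuity equation. Multiplication by a bump equal to
one on radius 3ε/4, more than ε/2, preserves values and derivatives on the interval carrying the
mass; the outer radius ε < R keeps the support off the origin. -/
theorem exists_localization {R ε : ℝ} (hε : 0 < ε) (hεR : ε ≤ R / 2) {G : ℝ → ℝ}
    (hG : ContDiff ℝ ∞ G) : ∃ β : ℝ → ℝ, ContDiff ℝ ∞ β ∧ HasCompactSupport β ∧
      tsupport β ⊆ Ioi 0 ∧ ∀ r ∈ Icc (R - ε / 2) (R + ε / 2), β r = G r ∧ deriv β r = deriv G r := by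
  let χ : ContDiffBump R := ⟨3 * ε / 4, ε, by positivity, by linarith⟩
  have hts : tsupport (fun r => χ r * G r) ⊆ Metric.closedBall R ε := by
    refine (tsupport_mul_subset_left (f := χ) (g := G)).trans ?_
    rw [χ.tsupport_eq]
  refine ⟨fun r => χ r * G r, χ.contDiff.mul hG, χ.hasCompactSupport.mul_right, hts.trans ?_,
    fun r hr => ?_⟩
  · intro r hr
    rw [Real.closedBall_eq_Icc] at hr
    have := hr.1
    exact (by linarith : (0 : ℝ) < r)
  · have hmem : r ∈ Metric.ball R χ.rIn := by
      rw [Real.ball_eq_Ioo]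
      change r ∈ Ioo (R - 3 * ε / 4) (R + 3 * ε / 4)
      exact ⟨by linarith [hr.1], by linarith [hr.2]⟩
    have h1 := χ.eventuallyEq_one_of_mem_ball hmem
    have h2 : (fun r => χ r * G r) =ᶠ[𝓝 r] G := by
      filter_upwards [h1] with s hs
      rw [hs]; simp
    exact ⟨h2.self_of_nhds, h2.deriv_eq⟩

theorem hasDerivAt_pow_div {N : ℕ} (hN : N ≠ 0) (r : ℝ) :
    HasDerivAt (fun r : ℝ => r ^ N / N) (r ^ (N - 1)) r := by
  have hN' : (N : ℝ) ≠ 0 := Nat.cast_ne_zero.2 hN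
  refine ((hasDerivAt_pow N r).div_const _).congr_deriv ?_
  field_simp

theorem pow_div_sub_mem_Icc {N : ℕ} (hN : N ≠ 0) {a b r s : ℝ} (ha : 0 ≤ a) (has : a ≤ s)
    (hsr : s ≤ r) (hrb : r ≤ b) :
    r ^ N / N - s ^ N / N ∈ Icc (a ^ (N - 1) * (r - s)) (b ^ (N - 1) * (r - s)) := by
  rcases hsr.eq_or_lt with rfl | hlt
  · simp
  obtain ⟨x, hx, hxe⟩ := exists_hasDerivAt_eq_slope (fun r : ℝ => r ^ N / N) (fun r => r ^ (N - 1))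
    hlt (by fun_prop) fun x _ => hasDerivAt_pow_div hN x
  have h1 : 0 < r - s := sub_pos.2 hlt
  rw [eq_div_iff h1.ne'] at hxe
  rw [← hxe]
  have hx1 := hx.1
  have hx2 := hx.2
  constructor
  · gcongr
    linarith
  · gcongr
    · linarith
    · linarith

end SphericalShell

/-! ### Monotone variance and conclusion -/

namespace SphericalShell

variable {N : ℕ} {R : ℝ}

/-- The covariance of `r ^ N / N` and the velocity flux is nonnegative for measures concentrated near
a radius at which the flux is expanding. -/
theorem integral_mul_integral_flux_le (hN : 2 ≤ N) {Q : ℝ → ℝ} {c ε : ℝ} (hc : 0 < c)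
    (hε : 0 < ε) (hεR : ε ≤ R / 2)
    (h : FluxExpandingOn N Q R c (c / (32 * 3 ^ (N - 1))) ε) {ν : Measure ℝ}
    [IsProbabilityMeasure ν] (hJ : ∀ᵐ r ∂ν, r ∈ Icc (R - ε / 2) (R + ε / 2))
    (hint : ∀ r, 0 < r → Integrable (fun η => flux N Q r η) ν)
    (hV : Integrable (fun r => ∫ η, flux N Q r η ∂ν) ν)
    (hzV : Integrable (fun r => r ^ N / N * ∫ η, flux N Q r η ∂ν) ν) :
    (∫ r, r ^ N / N ∂ν) * ∫ r, ∫ η, flux N Q r η ∂ν ∂ν ≤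
      ∫ r, r ^ N / N * ∫ η, flux N Q r η ∂ν ∂ν := by
  have hR : 0 < R := by linarith
  have hbdd : ∀ g : ℝ → ℝ, Continuous g → Integrable g ν := by
    intro g hg
    obtain ⟨B, hB⟩ := (isCompact_Icc (a := R - ε / 2) (b := R + ε / 2)).exists_bound_of_continuousOn
      hg.continuousOn
    exact Integrable.of_bound hg.aestronglyMeasurable B (hJ.mono fun r hr => hB r hr)
  set κ := c / (32 * 3 ^ (N - 1)) with hκ
  have hκ0 : 0 < κ := by positivity
  have hpow : (3 * R / 2) ^ (N - 1) = 3 ^ (N - 1) * (R / 2) ^ (N - 1) := by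
    rw [← mul_pow]; ring_nf
  -- The error coefficient `K` of the covariance lemma is the main one divided by 32, well below the
  -- half that is allowed.
  have hκM : κ * (3 * R / 2) ^ (N - 1) = c * (R / 2) ^ (N - 1) / 32 := by
    rw [hpow, hκ]
    field_simp
  have hm0 : 0 < c * (R / 2) ^ (N - 1) := by positivity
  refine integral_mul_integral_le_of_mul_sub_ge hJ (hbdd _ (by fun_prop)) hV hzV
    (hbdd _ continuous_id) (hbdd _ (by fun_prop)) (m := c * (R / 2) ^ (N - 1))
    (K := κ * (3 * R / 2) ^ (N - 1)) (by positivity) (by rw [hκM]; linarith) ?_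
  have habs : ∀ r : ℝ, Integrable (fun η => |r - η|) ν := fun r => hbdd _ (by fun_prop)
  have key : ∀ r ∈ Icc (R - ε / 2) (R + ε / 2), ∀ s ∈ Icc (R - ε / 2) (R + ε / 2), s ≤ r →
      c * (R / 2) ^ (N - 1) * (r - s) ^ 2 - κ * (3 * R / 2) ^ (N - 1) *
        (|r - s| * (∫ η, |r - η| ∂ν + ∫ η, |s - η| ∂ν)) ≤
      (r ^ N / N - s ^ N / N) * (∫ η, flux N Q r η ∂ν - ∫ η, flux N Q s η ∂ν) := by
    intro r hr s hs hsr
    have hsub : ∀ x ∈ Icc (R - ε / 2) (R + ε / 2), x ∈ Icc (R - ε) (R + ε) := fun x hx =>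
      ⟨by linarith [hx.1], by linarith [hx.2]⟩
    have h1 : c * (r - s) - κ * (∫ η, |r - η| ∂ν + ∫ η, |s - η| ∂ν) ≤
        ∫ η, flux N Q r η ∂ν - ∫ η, flux N Q s η ∂ν := by
      have hir := hint r (by linarith [hr.1])
      have his := hint s (by linarith [hs.1])
      have hrs : Integrable (fun η => κ * (|r - η| + |s - η|)) ν :=
        ((habs r).add (habs s)).const_mul κ
      rw [← integral_sub hir his, ← integral_add (habs r) (habs s), ← integral_const_mul]
      have h2 : ∫ η, (c * (r - s) - κ * (|r - η| + |s - η|)) ∂ν ≤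
          ∫ η, (flux N Q r η - flux N Q s η) ∂ν := by
        refine integral_mono_ae ((integrable_const _).sub hrs) (hir.sub his) ?_
        filter_upwards [hJ] with η hη
        exact h η (hsub η hη) r (hsub r hr) s (hsub s hs) hsr
      rw [integral_sub (integrable_const _) hrs] at h2
      simpa using h2
    obtain ⟨h3, h4⟩ := pow_div_sub_mem_Icc (N := N) (by omega) (a := R / 2) (b := 3 * R / 2)
      (by positivity) (by linarith [hs.1]) hsr (by linarith [hr.2])
    have h5 : 0 ≤ r - s := sub_nonneg.2 hsr
    have hB : 0 ≤ ∫ η, |r - η| ∂ν + ∫ η, |s - η| ∂ν :=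
      add_nonneg (integral_nonneg fun η => abs_nonneg _) (integral_nonneg fun η => abs_nonneg _)
    have hz : 0 ≤ r ^ N / N - s ^ N / N := le_trans (by positivity) h3
    rw [abs_of_nonneg h5]
    have h6 := mul_le_mul_of_nonneg_left h1 hz
    have h7 := mul_le_mul_of_nonneg_right h3 (mul_nonneg hc.le h5)
    have h8 := mul_le_mul_of_nonneg_right h4 (mul_nonneg hκ0.le hB)
    linarith
  intro r hr s hs
  rcases le_total s r with hsr | hsr
  · exact key r hr s hs hsr
  · have h1 := key s hs r hr hsr
    rw [abs_sub_comm, add_comm (∫ η, |s - η| ∂ν)] at h1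
    linarith

variable [NeZero N] {W : Space N → ℝ} {k : ℝ → ℝ} {μ : ℝ → Measure (Space N)} {p : ℝ}

/-- The level sets of |x|^N/N are spheres, which are Lebesgue null. -/
theorem not_ae_eq_const_of_absolutelyContinuous {ρ : Measure (Space N)} [IsProbabilityMeasure ρ]
    (hac : ρ ≪ volume) (m : ℝ) : ¬ ∀ᵐ r ∂(radialPart ρ), r ^ N / N = m := by
  intro h
  have h1 : ∀ᵐ x ∂ρ, ‖x‖ ^ N / N = m := ae_of_ae_map measurable_norm.aemeasurable h
  obtain ⟨x₀, hx₀⟩ := h1.exists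
  have hN : (N : ℝ) ≠ 0 := Nat.cast_ne_zero.2 (NeZero.ne N)
  have h2 : ∀ᵐ x ∂ρ, x ∈ Metric.sphere (0 : Space N) ‖x₀‖ := by
    filter_upwards [h1] with x hx
    rw [mem_sphere_zero_iff_norm]
    have h3 : ‖x‖ ^ N = ‖x₀‖ ^ N := by
      have := hx.trans hx₀.symm
      rwa [div_left_inj' hN] at this
    exact (pow_left_inj₀ (norm_nonneg _) (norm_nonneg _) (NeZero.ne N)).1 h3
  have h4 : ∀ᵐ x ∂ρ, x ∉ Metric.sphere (0 : Space N) ‖x₀‖ :=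
    hac.ae_le (measure_eq_zero_iff_ae_notMem.1 (Measure.addHaar_sphere volume 0 ‖x₀‖))
  obtain ⟨x, hx, hx'⟩ := (h2.and h4).exists
  exact hx' hx

/-- The variance of `r ^ N / N` does not decrease along a solution that is concentrated near a radius
at which the flux is expanding. -/
theorem IsRadialSolution.variance_le (hμ : IsRadialSolution W μ) (hN : 2 ≤ N) {A : ℝ} (hA0 : 0 < A)
    (hA : ∀ r, 0 < r → ∀ η, 0 ≤ η →
      r ^ (N - 1) * omega W r η = A * flux N (forceProfile k) r η) {c ε : ℝ} (hc : 0 < c)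
    (hε : 0 < ε) (hεR : ε ≤ R / 2)
    (h : FluxExpandingOn N (forceProfile k) R c (c / (32 * 3 ^ (N - 1))) ε) {T t : ℝ} (hT : 0 < T)
    (hTt : T ≤ t)
    (hJ : ∀ t, T ≤ t → ∀ᵐ r ∂(radialPart (μ t)), r ∈ Icc (R - ε / 2) (R + ε / 2)) :
    ∫ r, (r ^ N / N) ^ 2 ∂(radialPart (μ T)) - (∫ r, r ^ N / N ∂(radialPart (μ T))) ^ 2 ≤
      ∫ r, (r ^ N / N) ^ 2 ∂(radialPart (μ t)) - (∫ r, r ^ N / N ∂(radialPart (μ t))) ^ 2 := by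
  have hN0 : N ≠ 0 := by omega
  obtain ⟨β₁, hs₁, hc₁, h0₁, he₁⟩ := exists_localization hε hεR
    (G := fun r : ℝ => r ^ N / N) (by fun_prop)
  obtain ⟨β₂, hs₂, hc₂, h0₂, he₂⟩ := exists_localization hε hεR
    (G := fun r : ℝ => (r ^ N / N) ^ 2) (by fun_prop)
  have hd₁ : ∀ r : ℝ, deriv (fun r : ℝ => r ^ N / N) r = r ^ (N - 1) := fun r =>
    (hasDerivAt_pow_div hN0 r).deriv
  have hd₂ : ∀ r : ℝ, deriv (fun r : ℝ => (r ^ N / N) ^ 2) r = 2 * (r ^ N / N) * r ^ (N - 1) :=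
    fun r => ((hasDerivAt_pow_div hN0 r).fun_pow 2).deriv.trans (by simp)
  have hM₁ : ∀ s, T ≤ s → ∫ r, r ^ N / N ∂(radialPart (μ s)) = ∫ r, β₁ r ∂(radialPart (μ s)) :=
    fun s hs => integral_congr_ae ((hJ s hs).mono fun r hr => (he₁ r hr).1.symm)
  have hM₂ : ∀ s, T ≤ s →
      ∫ r, (r ^ N / N) ^ 2 ∂(radialPart (μ s)) = ∫ r, β₂ r ∂(radialPart (μ s)) :=
    fun s hs => integral_congr_ae ((hJ s hs).mono fun r hr => (he₂ r hr).1.symm)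
  rw [hM₁ T le_rfl, hM₁ t hTt, hM₂ T le_rfl, hM₂ t hTt]
  set M : ℝ → ℝ := fun s => ∫ r, β₁ r ∂(radialPart (μ s)) with hM
  set L₁ : ℝ → ℝ := fun s => ∫ r, radialVelocity W (μ s) r * deriv β₁ r ∂(radialPart (μ s)) with hL₁
  set L₂ : ℝ → ℝ := fun s => ∫ r, radialVelocity W (μ s) r * deriv β₂ r ∂(radialPart (μ s)) with hL₂
  have hi₁ : IntervalIntegrable L₁ volume T t := (intervalIntegrable_iff_integrableOn_Ioc_of_le hTt).2
    (hμ.integrableOn_velocity hs₁ hc₁ h0₁ hT t)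
  have hi₂ : IntervalIntegrable L₂ volume T t := (intervalIntegrable_iff_integrableOn_Ioc_of_le hTt).2
    (hμ.integrableOn_velocity hs₂ hc₂ h0₂ hT t)
  have hsq := sq_sub_sq_eq_integral hTt hi₁ (M := M) fun s hs =>
    hμ.integral_sub_integral hs₁ hc₁ h0₁ hT hs.1
  have hlin := hμ.integral_sub_integral hs₂ hc₂ h0₂ hT hTt
  have hMc : ContinuousOn M (uIcc T t) := by
    obtain ⟨C, hC⟩ := hc₁.exists_bound_of_continuous hs₁.continuous
    refine (hμ.continuousOn_integral hs₁.continuous hC).mono fun s hs => ?_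
    rw [uIcc_of_le hTt] at hs
    exact hT.le.trans hs.1
  have hle : 2 * ∫ s in T..t, M s * L₁ s ≤ ∫ s in T..t, L₂ s := by
    rw [← intervalIntegral.integral_const_mul]
    refine intervalIntegral.integral_mono_on hTt ((hi₁.continuousOn_mul hMc).const_mul 2) hi₂
      fun s hs => ?_
    have hTs : T ≤ s := hs.1
    have hs0 : 0 < s := hT.trans_le hTs
    have := hμ.prob s hs0.le
    have := isProbabilityMeasure_radialPart (μ s)
    set V : ℝ → ℝ := fun r => ∫ η, flux N (forceProfile k) r η ∂(radialPart (μ s)) with hV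
    have hpos : ∀ r ∈ Icc (R - ε / 2) (R + ε / 2), 0 < r := fun r hr => by linarith [hr.1]
    -- The derivative r^(N-1) of r^N/N turns the velocity into the flux; this dictates the choice of
    -- variable.
    have hv₁ : (fun r => radialVelocity W (μ s) r * deriv β₁ r) =ᵐ[radialPart (μ s)]
        fun r => A * V r := by
      filter_upwards [hJ s hTs] with r hr
      rw [(he₁ r hr).2, hd₁, mul_comm, pow_mul_radialVelocity hA (μ s) (hpos r hr)]
    have hv₂ : (fun r => radialVelocity W (μ s) r * deriv β₂ r) =ᵐ[radialPart (μ s)]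
        fun r => 2 * A * (r ^ N / N * V r) := by
      filter_upwards [hJ s hTs] with r hr
      rw [(he₂ r hr).2, hd₂]
      linear_combination (2 * (r ^ N / N)) * pow_mul_radialVelocity hA (μ s) (hpos r hr)
    have hVi : Integrable V (radialPart (μ s)) := by
      refine (((hμ.integrable_velocity_mul_deriv hs₁ hc₁ h0₁ hs0).congr hv₁).const_mul A⁻¹).congr
        (Eventually.of_forall fun r => ?_)
      simp only
      field_simp
    have hzVi : Integrable (fun r => r ^ N / N * V r) (radialPart (μ s)) := by
      refine (((hμ.integrable_velocity_mul_deriv hs₂ hc₂ h0₂ hs0).congr hv₂).const_mul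
        (2 * A)⁻¹).congr (Eventually.of_forall fun r => ?_)
      exact inv_mul_cancel_left₀ (by positivity) _
    have hcov := integral_mul_integral_flux_le hN hc hε hεR h (hJ s hTs)
      (fun r hr => hμ.integrable_flux hA0 hA hs0 hr) hVi hzVi
    have e₁ : L₁ s = A * ∫ r, V r ∂(radialPart (μ s)) := by
      rw [hL₁, ← integral_const_mul]
      exact integral_congr_ae hv₁
    have e₂ : L₂ s = 2 * A * ∫ r, r ^ N / N * V r ∂(radialPart (μ s)) := by
      rw [hL₂, ← integral_const_mul]
      exact integral_congr_ae hv₂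
    have e₃ : M s = ∫ r, r ^ N / N ∂(radialPart (μ s)) := (hM₁ s hTs).symm
    rw [e₁, e₂, e₃]
    have h9 := mul_le_mul_of_nonneg_left hcov (by positivity : 0 ≤ 2 * A)
    linarith
  linarith

/-- No `L^p` solution converges to a spherical shell at which the flux is expanding. -/
theorem IsLpRadialSolution.not_weakStarTendsto_of_fluxExpanding (hN : 2 ≤ N)
    (hWk : ∀ x, x ≠ 0 → W x = k ‖x‖) (hk : ContDiffOn ℝ 3 k (Ioi 0))
    (hμ : IsLpRadialSolution W p μ) (hR : 0 < R) (hC0 : omega W R R = 0)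
    (hF : FluxExpanding N (forceProfile k) R) : ¬ WeakStarTendsto μ (shell N R) := by
  intro hlim
  obtain ⟨c, hc, ε, hε, hεR, h⟩ := hF.exists_fluxExpandingOn hR
  have hκ : c / (32 * 3 ^ (N - 1)) ≤ c / 32 := by
    have : (1 : ℝ) ≤ 3 ^ (N - 1) := one_le_pow₀ (by norm_num)
    gcongr
    linarith
  obtain ⟨T, hT, hJ⟩ := hμ.exists_forall_ae_mem_Icc hN hWk hk hlim hc (by positivity) hκ hε hεR h hC0
  obtain ⟨A, hA0, hA⟩ := exists_omega_eq_flux hN hWk hk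
  have hlimit : ∀ G : ℝ → ℝ, ContDiff ℝ ∞ G →
      Tendsto (fun t => ∫ r, G r ∂(radialPart (μ t))) atTop (𝓝 (G R)) := by
    intro G hG
    obtain ⟨β, hs, hcs, -, he⟩ := exists_localization hε hεR hG
    obtain ⟨C, hC⟩ := hcs.exists_bound_of_continuous hs.continuous
    have h1 := hlim.tendsto_integral hN hR.le hs.continuous hC
    rw [(he R ⟨by linarith, by linarith⟩).1] at h1
    refine h1.congr' ?_
    filter_upwards [eventually_ge_atTop T] with t ht
    exact integral_congr_ae ((hJ t ht).mono fun r hr => (he r hr).1)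
  have hvar : Tendsto (fun t => ∫ r, (r ^ N / N) ^ 2 ∂(radialPart (μ t)) -
      (∫ r, r ^ N / N ∂(radialPart (μ t))) ^ 2) atTop (𝓝 0) := by
    have h1 := (hlimit (fun r => (r ^ N / N) ^ 2) (by fun_prop)).sub
      ((hlimit (fun r => r ^ N / N) (by fun_prop)).pow 2)
    simpa using h1
  -- A nondecreasing quantity with limit zero is nonpositive at time `T`.
  have hle := ge_of_tendsto hvar ((eventually_ge_atTop T).mono fun t ht =>
    hμ.solution.variance_le hN hA0 hA hc hε hεR h hT ht hJ)
  have := hμ.solution.prob T hT.le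
  have := isProbabilityMeasure_radialPart (μ T)
  set ν := radialPart (μ T) with hν
  have hbdd : ∀ g : ℝ → ℝ, Continuous g → Integrable g ν := by
    intro g hg
    obtain ⟨B, hB⟩ := (isCompact_Icc (a := R - ε / 2) (b := R + ε / 2)).exists_bound_of_continuousOn
      hg.continuousOn
    exact Integrable.of_bound hg.aestronglyMeasurable B ((hJ T le_rfl).mono fun r hr => hB r hr)
  have hz : Integrable (fun r : ℝ => r ^ N / N) ν := hbdd _ (by fun_prop)
  have hz2 : Integrable (fun r : ℝ => (r ^ N / N) ^ 2) ν := hbdd _ (by fun_prop)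
  set m := ∫ r, r ^ N / N ∂ν with hm
  have hmean : ∫ r, (r ^ N / N - m) ^ 2 ∂ν = ∫ r, (r ^ N / N) ^ 2 ∂ν - m ^ 2 := by
    have h1 : ∀ r : ℝ, (r ^ N / N - m) ^ 2 = (r ^ N / N) ^ 2 - 2 * m * (r ^ N / N) + m ^ 2 :=
      fun r => by ring
    simp only [h1]
    have h2 : Integrable (fun r : ℝ => (r ^ N / N) ^ 2 - 2 * m * (r ^ N / N)) ν :=
      hz2.sub (hz.const_mul _)
    rw [integral_add h2 (integrable_const _), integral_sub hz2 (hz.const_mul _),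
      integral_const_mul, ← hm]
    simp only [integral_const, probReal_univ, smul_eq_mul]
    ring
  have hzero : ∫ r, (r ^ N / N - m) ^ 2 ∂ν = 0 :=
    le_antisymm (hmean.trans_le hle) (integral_nonneg fun r => sq_nonneg _)
  have hzi : Integrable (fun r : ℝ => (r ^ N / N - m) ^ 2) ν := hbdd _ (by fun_prop)
  rw [integral_eq_zero_iff_of_nonneg (fun r => sq_nonneg _) hzi] at hzero
  -- Zero variance puts the mass at time `T` on a single sphere, against its density.
  obtain ⟨f, -, hf⟩ := hμ.density T hT.le
  refine not_ae_eq_const_of_absolutelyContinuous (ρ := μ T)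
    (hf ▸ withDensity_absolutelyContinuous _ _) m ?_
  filter_upwards [hzero] with r hr
  exact sub_eq_zero.1 (pow_eq_zero_iff two_ne_zero |>.1 hr)

end SphericalShell

theorem theorem3p1 {N : ℕ} [NeZero N] (hN : 2 ≤ N)
    (W : SphericalShell.Space N → ℝ) (k : ℝ → ℝ)
    (hWk : ∀ x, x ≠ 0 → W x = k ‖x‖)
    (hW : ContDiffOn ℝ 3 W {0}ᶜ)
    (hk' : SphericalShell.LocIntHypersurface N (deriv k))
    (R : ℝ) (hR : 0 < R)
    (hC0 : SphericalShell.omega W R R = 0)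
    (h :
      -- (i)
      (SphericalShell.LocIntHypersurface N (deriv (deriv k)) ∧
        SphericalShell.LocIntHypersurface N (fun r => r⁻¹ * deriv k r) ∧
        0 < deriv (fun r => SphericalShell.omega W r R) R) ∨
      -- (ii)
      ((∀ᶠ x in 𝓝[≠] (0 : SphericalShell.Space N), (Δ W) x < 0) ∧
        ¬ SphericalShell.LocIntHypersurface N
          (fun r => (Δ W) (r • SphericalShell.e₁ N))))
    (p : ℝ) (μ : ℝ → Measure (SphericalShell.Space N))
    (hμ : SphericalShell.IsLpRadialSolution W p μ) :
    ¬ SphericalShell.WeakStarTendsto μ (SphericalShell.shell N R) := by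
  have hk := SphericalShell.contDiffOn_profile hWk hW
  exact hμ.not_weakStarTendsto_of_fluxExpanding hN hWk hk hR hC0
    (SphericalShell.fluxExpanding_of_alternative hN hWk hk hk' hR hC0 h)
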